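/- Let $N\ge 2$ be an integer and let $\hbar,\beta\in\mathbb{C}$. Put $q=e^{\hbar}$, $t=q^{\beta}=e^{\beta\hbar}$, $p=qt^{-1}$ and $p^{x}=e^{x(1-\beta)\hbar}$ for $x\in\mathbb{C}$, and assume that $p$ is not a root of unity. Let $h^i_n$ ($n\in\mathbb{Z}$, $1\le i\le N$) be bosons with $\sum_{i=1}^N p^{in}h^i_n=0$ and, for $n\neq 0$, $$[h^i_n,h^j_m]=-\tfrac1n(1-q^n)(1-t^{-n})\frac{1-p^{(N\delta_{ij}-1)n}}{1-p^{Nn}}\,p^{Nn\theta(i<j)}\,\delta_{n+m,0},$$ where $\theta(P)=1$ if $P$ is true and $0$ otherwise, the zero modes $h^i_0$ being central. They act on the Fock space $\mathcal{F}_\lambda$, which is the polynomial algebra in $h^i_{-n}$ ($n\ge1$, $1\le i\le N-1$), with $h^i_0=\lambda_i$, where $\lambda\in\mathbb{C}^N$, $\sum_i\lambda_i=0$. Let $$\Lambda_i(z)=\,:\!\exp\Bigl(\sum_{n\ne0}h^i_nz^{-n}\Bigr)\!:\,q^{\sqrt\beta h^i_0}\,p^{\frac{N+1}{2}-i},\qquad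 W^i(z)=\sum_{n\in\mathbb{Z}}W^i_nz^{-n}=\sum_{1\le j_1<\dots<j_i\le N}:\!\Lambda_{j_1}(p^{\frac{i-1}2}z)\Lambda_{j_2}(p^{\frac{i-3}2}z)\cdots\Lambda_{j_i}(p^{-\frac{i-1}2}z)\!:$$ for $1\le i\le N-1$, and $W^0(z)=W^N(z)=1$, $W^i(z)=0$ for $i<0$ or $i>N$. For $i,j\in\mathbb{Z}$ let $$f^{i,j}(z)=\exp\Bigl(\sum_{n>0}\tfrac1n(1-q^n)(1-t^{-n})\frac{1-p^{\min(i,j)n}}{1-p^n}\,\frac{1-p^{(N-\max(i,j))n}}{1-p^{Nn}}\,p^{\frac{|i-j|}2n}z^n\Bigr),$$ and let $\delta(z)=\sum_{n\in\mathbb{Z}}z^n$ and $\gamma(p^{\frac12}z)=\dfrac{(1-qz)(1-t^{-1}z)}{(1-z)(1-pz)}$. Let $0\le i\le j\le N$. Then for $1\le k\le i$ the products $f^{i-k,j+k}(w_2/w_1)W^{i-k}(w_1)W^{j+k}(w_2)$ are regular at $w_2/w_1=p^{\pm\frac{j-i}{2}}$: applied to any vector of $\mathcal{F}_\lambda$,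 their part of each fixed total mode, as a series in $w_2/w_1$, is the expansion at $0$ of a rational function that is regular at these points. As formal series in $z_1,z_2$ acting on $\mathcal{F}_\lambda$, $$\begin{aligned} &f^{i,j}(\tfrac{z_2}{z_1})W^i(z_1)W^j(z_2)-W^j(z_2)W^i(z_1)f^{j,i}(\tfrac{z_1}{z_2})\\ &=-\frac{(1-q)(1-t^{-1})}{1-p}\sum_{k=1}^{i}\ \prod_{l=1}^{k-1}\gamma(p^{l+\frac12})\\ &\quad\times\Bigl(\delta(p^{\frac{j-i}2+k}\tfrac{z_2}{z_1})\,f^{i-k,j+k}(p^{-\frac{j-i}2})\,W^{i-k}(p^{-\frac k2}z_1)\,W^{j+k}(p^{\frac k2}z_2)\\ &\qquad\ -\delta(p^{-(\frac{j-i}2+k)}\tfrac{z_2}{z_1})\,f^{i-k,j+k}(p^{\frac{j-i}2})\,W^{i-k}(p^{\frac k2}z_1)\,W^{j+k}(p^{-\frac k2}z_2)\Bigr). \end{aligned}$$ Here $f^{a,b}(x)W^a(w_1)W^b(w_2)$ at the points $w_2/w_1=x$ selected by the delta functions denotes the value at $w_2/w_1=x$ of the rational function just described. -/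

import Mathlib

noncomputable section

set_option linter.unusedSimpArgs false

namespace DWA

/-! ## Parameters

The parameters are `q = exp ħ` and `t = q ^ β = exp (β ħ)`; all complex powers of `q`, `t` and
`p = q t⁻¹` are taken with respect to this choice of logarithm. -/

/-- `q = exp ħ`. -/
def qPar (ħ : ℂ) : ℂ := Complex.exp ħ

/-- `t = q ^ β`. -/
def tPar (ħ β : ℂ) : ℂ := Complex.exp (β * ħ)

/-- `p ^ x` for a complex exponent `x`, where `p = q t⁻¹ = q ^ (1 - β)`. -/
def pPow (ħ β x : ℂ) : ℂ := Complex.exp (x * ((1 - β) * ħ))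

theorem pPow_one (ħ β : ℂ) : pPow ħ β 1 = qPar ħ * (tPar ħ β)⁻¹ := by
  rw [pPow, qPar, tPar, ← Complex.exp_neg, ← Complex.exp_add]
  congr 1
  ring

theorem pPow_ne_zero (ħ β x : ℂ) : pPow ħ β x ≠ 0 := Complex.exp_ne_zero _

theorem pPow_add (ħ β x y : ℂ) : pPow ħ β (x + y) = pPow ħ β x * pPow ħ β y := by
  rw [pPow, pPow, pPow, ← Complex.exp_add, ← add_mul]

theorem pPow_neg (ħ β x : ℂ) : pPow ħ β (-x) = (pPow ħ β x)⁻¹ := by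
  rw [pPow, pPow, ← Complex.exp_neg, neg_mul]

theorem pPow_nat_mul (ħ β x : ℂ) (k : ℕ) : pPow ħ β (k * x) = pPow ħ β x ^ k := by
  rw [pPow, pPow, ← Complex.exp_nat_mul, mul_assoc]

theorem pPow_int (ħ β : ℂ) (n : ℤ) : pPow ħ β n = qPar ħ ^ n * tPar ħ β ^ (-n) := by
  rw [pPow, qPar, tPar, ← Complex.exp_int_mul, ← Complex.exp_int_mul, ← Complex.exp_add]
  congr 1
  push_cast
  ring

theorem pPow_zero (ħ β : ℂ) : pPow ħ β 0 = 1 := by simp [pPow]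

/-! ## Exponentials of formal power series -/

/-- `exp A = ∑ₖ Aᵏ / k!` for a power series `A` without constant term (the terms with `k > s` do
not contribute to the coefficient of degree `s`). -/
def expSeries {R : Type*} [Ring R] [Algebra ℂ R] (A : PowerSeries R) : PowerSeries R :=
  PowerSeries.mk fun s =>
    ∑ k ∈ Finset.range (s + 1), ((k.factorial : ℂ)⁻¹) • PowerSeries.coeff s (A ^ k)

/-! ## Fundamental bosons and the Fock space

Indices `i = 1, …, N` of the text are represented by `i : Fin N` through `i ↦ i + 1`. -/

/-- The scalar in `[h^i_n, h^j_m] = comm i j n * δ_{n+m,0}`: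
`-(1/n) (1-q^n) (1-t^{-n}) (1-p^{(Nδ_{ij}-1)n}) / (1-p^{Nn}) * p^{N n θ(i<j)}`.
(At `n = 0` it is `0`.) -/
def comm (N : ℕ) (ħ β : ℂ) (i j : Fin N) (n : ℤ) : ℂ :=
  -(1 / (n : ℂ)) * (1 - qPar ħ ^ n) * (1 - tPar ħ β ^ (-n)) *
    ((1 - pPow ħ β (((N : ℂ) * (if i = j then 1 else 0) - 1) * n)) / (1 - pPow ħ β (N * n))) *
    pPow ħ β (N * n * (if i < j then 1 else 0))

/-- The Fock space: polynomials in the creation operators. The variable `(i, k)` is the creation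
operator `h^{i+1}_{-(k+1)}` for `i = 0, …, N - 2`; the boson `h^N_{-(k+1)}` is expressed through
these by the linear relation `∑ᵢ p^{i n} h^i_n = 0`. The vacuum is the polynomial `1`. -/
abbrev Fock (N : ℕ) : Type := MvPolynomial (Fin (N - 1) × ℕ) ℂ

/-- The element `h^{i+1}_{-(k+1)} |vac⟩` of the Fock space. -/
def creationVar (N : ℕ) (ħ β : ℂ) (i : Fin N) (k : ℕ) : Fock N :=
  if h : (i : ℕ) < N - 1 then MvPolynomial.X (⟨i, h⟩, k)
  else -∑ j : Fin (N - 1),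
    pPow ħ β (((N : ℂ) - ((j : ℕ) + 1)) * ((k : ℂ) + 1)) • MvPolynomial.X (j, k)

/-- The bosons `h^{i+1}_n` on the Fock space of highest weight `lam`: creation operators act by
multiplication, annihilation operators by the derivations determined by the commutation relations,
and the central zero mode `h^{i+1}_0` by the scalar `lam i`. -/
def boson (N : ℕ) (ħ β : ℂ) (lam : Fin N → ℂ) (i : Fin N) : ℤ → Module.End ℂ (Fock N)
  | .ofNat 0 => lam i • LinearMap.id
  | .ofNat (k + 1) => ∑ j : Fin (N - 1),
      comm N ħ β i (Fin.castLE (Nat.sub_le N 1) j) ((k : ℤ) + 1) •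
        (MvPolynomial.pderiv (R := ℂ) (j, k)).toLinearMap
  | .negSucc k => LinearMap.mulLeft ℂ (creationVar N ħ β i k)

/-! ### The relations of the bosons

The operators `boson` satisfy the defining relations of the fundamental bosons, see `boson_sum` and
`boson_comm` below. -/

theorem comm_antisymm (N : ℕ) (ħ β : ℂ) (i j : Fin N) (n : ℤ) :
    comm N ħ β j i (-n) = -comm N ħ β i j n := by
  have hy := pPow_int ħ β n
  have hq : qPar ħ ^ n ≠ 0 := zpow_ne_zero _ (Complex.exp_ne_zero _)
  have ht : tPar ħ β ^ n ≠ 0 := zpow_ne_zero _ (Complex.exp_ne_zero _)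
  rw [zpow_neg] at hy
  have hy0 := pPow_ne_zero ħ β n
  have hY0 := pPow_ne_zero ħ β (N * n)
  set Q := qPar ħ ^ n with hQ
  set T := tPar ħ β ^ n with hT
  set y := pPow ħ β n with hy'
  set Y := pPow ħ β (N * n) with hY
  have eNn : pPow ħ β (-(N * (n : ℂ))) = Y⁻¹ := pPow_neg _ _ _
  have e1 : pPow ħ β ((N - 1) * (n : ℂ)) = Y * y⁻¹ := by
    rw [sub_mul, one_mul, sub_eq_add_neg, pPow_add, pPow_neg]
  have e2 : pPow ħ β (-((N - 1) * (n : ℂ))) = Y⁻¹ * y := by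
    rw [pPow_neg, e1]; field_simp
  have e3 : pPow ħ β (-(n : ℂ)) = y⁻¹ := pPow_neg _ _ _
  have hQT : Q = y * T := by rw [hy]; field_simp
  by_cases hn : (n : ℂ) = 0
  · simp [comm, hn]
  by_cases hY1 : 1 - Y = 0
  · have : 1 - Y⁻¹ = 0 := by
      have : Y = 1 := (sub_eq_zero.1 hY1).symm
      simp [this]
    simp [comm, eNn, ← hY, hY1, this]
  have hY2 : 1 - Y⁻¹ ≠ 0 := by
    intro h
    apply hY1
    have : Y⁻¹ = 1 := (sub_eq_zero.1 h).symm
    rw [inv_eq_one.1 this, sub_self]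
  have hY3 : Y - 1 ≠ 0 := by
    intro h; apply hY1; linear_combination -h
  rcases lt_trichotomy i j with h | h | h
  · have h1 : ¬ i = j := h.ne
    have h2 : ¬ j < i := not_lt.2 h.le
    simp only [comm, if_neg h1, if_neg (Ne.symm h1 : ¬ j = i), if_neg h2, if_pos h, zpow_neg, ← hQ, ← hT,
      inv_inv, Int.cast_neg, mul_neg, mul_zero, mul_one, zero_sub, neg_mul, one_mul, neg_neg, eNn, e3,
      ← hY, ← hy', neg_zero, pPow_zero]
    rw [hQT]
    field_simp
    ring
  · subst h
    simp only [comm, if_true, lt_irrefl, if_false, zpow_neg, ← hQ, ← hT,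
      inv_inv, Int.cast_neg, mul_neg, mul_zero, mul_one, eNn, e1, e2,
      ← hY, ← hy', neg_zero, pPow_zero]
    rw [hQT]
    field_simp
    ring
  · have h1 : ¬ i = j := h.ne'
    have h2 : ¬ i < j := not_lt.2 h.le
    simp only [comm, if_neg h1, if_neg (Ne.symm h1 : ¬ j = i), if_neg h2, if_pos h, zpow_neg, ← hQ, ← hT,
      inv_inv, Int.cast_neg, mul_neg, mul_zero, mul_one, zero_sub, neg_mul, one_mul, neg_neg, eNn, e3,
      ← hY, ← hy', neg_zero, pPow_zero]
    rw [hQT]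
    field_simp
    ring

theorem comm_sum_left (N : ℕ) (ħ β : ℂ) (j : Fin N) (n : ℤ) :
    ∑ i : Fin N, pPow ħ β (((i : ℕ) + 1) * n) * comm N ħ β i j n = 0 := by
  have hy0 := pPow_ne_zero ħ β n
  set y := pPow ħ β n with hy
  have hY : pPow ħ β (N * n) = y ^ N := pPow_nat_mul _ _ _ _
  let G : ℕ → ℂ := fun m => if m ≤ j then y ^ (N + m) else y ^ m
  have key : ∀ i : Fin N, pPow ħ β (((i : ℕ) + 1) * n) * comm N ħ β i j n =
      (-(1 / (n : ℂ)) * (1 - qPar ħ ^ n) * (1 - tPar ħ β ^ (-n)) / (1 - y ^ N)) *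
        (G (i + 1) - G i) := by
    intro i
    have e0 : pPow ħ β (((i : ℕ) + 1) * n) = y ^ ((i : ℕ) + 1) := by
      rw [← pPow_nat_mul]; push_cast; rfl
    have e1 : pPow ħ β ((N - 1) * (n : ℂ)) = y ^ N * y⁻¹ := by
      rw [sub_mul, one_mul, sub_eq_add_neg, pPow_add, pPow_neg, hY]
    have e3 : pPow ħ β (-(n : ℂ)) = y⁻¹ := pPow_neg _ _ _
    rw [e0]
    rcases lt_trichotomy i j with h | h | h
    · have h1 : ¬ i = j := h.ne
      have a1 : (i : ℕ) + 1 ≤ j := h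
      have a2 : (i : ℕ) ≤ j := by omega
      simp only [comm, G, if_neg h1, if_pos h, if_pos a1, if_pos a2, mul_zero, zero_sub, mul_one,
        neg_mul, one_mul, e3, hY]
      field_simp
      ring
    · subst h
      simp only [comm, G, if_true, lt_irrefl, if_false, mul_zero, mul_one, e1, hY, pPow_zero,
        le_refl, if_neg (Nat.not_succ_le_self (i : ℕ))]
      field_simp
      ring
    · have h1 : ¬ i = j := h.ne'
      have h2 : ¬ i < j := not_lt.2 h.le
      have a1 : ¬ (i : ℕ) + 1 ≤ j := by have : (j : ℕ) < i := h; omega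
      have a2 : ¬ (i : ℕ) ≤ j := not_le.2 h
      simp only [comm, G, if_neg h1, if_neg h2, if_neg a1, if_neg a2, mul_zero, zero_sub, mul_one,
        neg_mul, one_mul, e3, hY, pPow_zero]
      field_simp
      ring
  rw [Finset.sum_congr rfl fun i _ => key i, ← Finset.mul_sum,
    Fin.sum_univ_eq_sum_range (fun i => G (i + 1) - G i), Finset.sum_range_sub]
  have a1 : ¬ N ≤ (j : ℕ) := not_le.2 j.2
  simp [G, a1]

theorem comm_sum_right (N : ℕ) (ħ β : ℂ) (i : Fin N) (n : ℤ) :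
    ∑ j : Fin N, pPow ħ β (-(((j : ℕ) + 1) * n)) * comm N ħ β i j n = 0 := by
  have h := comm_sum_left N ħ β i (-n)
  simp only [comm_antisymm, Int.cast_neg, mul_neg, Finset.sum_neg_distrib, neg_eq_zero] at h
  exact h

theorem creationVar_sum (N : ℕ) (hN : 0 < N) (ħ β : ℂ) (k : ℕ) :
    ∑ i : Fin N, pPow ħ β (-(((i : ℕ) + 1) * ((k : ℂ) + 1))) • creationVar N ħ β i k = 0 := by
  obtain ⟨M, rfl⟩ := Nat.exists_eq_succ_of_ne_zero hN.ne'
  rw [Fin.sum_univ_castSucc]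
  have e1 : ∀ i : Fin M, creationVar (M + 1) ħ β i.castSucc k =
      (MvPolynomial.X (i, k) : MvPolynomial (Fin M × ℕ) ℂ) := by
    intro i
    rw [creationVar, dif_pos (show ((i.castSucc : Fin (M + 1)) : ℕ) < M + 1 - 1 by simp)]
    rfl
  have e2 : creationVar (M + 1) ħ β (Fin.last M) k = -∑ j : Fin M,
      pPow ħ β ((((M + 1 : ℕ) : ℂ) - ((j : ℕ) + 1)) * ((k : ℂ) + 1)) •
        (MvPolynomial.X (j, k) : MvPolynomial (Fin M × ℕ) ℂ) := by
    rw [creationVar, dif_neg (show ¬ ((Fin.last M : Fin (M + 1)) : ℕ) < M + 1 - 1 by simp)]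
    rfl
  rw [e2]
  simp only [e1]
  rw [smul_neg, Finset.smul_sum, ← sub_eq_add_neg, sub_eq_zero]
  refine Finset.sum_congr rfl fun j _ => ?_
  rw [smul_smul, ← pPow_add]
  congr 2
  simp only [Fin.val_castSucc, Fin.val_last]
  push_cast
  ring

/-- The bosons satisfy `∑ᵢ p^{i n} h^i_n = 0`. -/
theorem boson_sum (N : ℕ) (ħ β : ℂ) (lam : Fin N → ℂ) (hlam : ∑ i, lam i = 0) (n : ℤ) :
    ∑ i : Fin N, pPow ħ β (((i : ℕ) + 1) * n) • boson N ħ β lam i n = 0 := by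
  rcases Nat.eq_zero_or_pos N with rfl | hN
  · simp
  match n with
  | .ofNat 0 =>
    simp only [boson, smul_smul, ← Finset.sum_smul]
    simp [pPow_zero, hlam]
  | .ofNat (k + 1) =>
    simp only [boson, Finset.smul_sum, smul_smul]
    rw [Finset.sum_comm]
    refine Finset.sum_eq_zero fun j _ => ?_
    rw [← Finset.sum_smul]
    have h := comm_sum_left N ħ β (Fin.castLE (Nat.sub_le N 1) j) ((k : ℤ) + 1)
    have e : ((Int.ofNat (k + 1) : ℤ) : ℂ) = (((k : ℤ) + 1 : ℤ) : ℂ) := by simp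
    rw [e, h, zero_smul]
  | .negSucc k =>
    refine LinearMap.ext fun v => ?_
    have h : (∑ i : Fin N, pPow ħ β (-(((i : ℕ) + 1) * ((k : ℂ) + 1))) • creationVar N ħ β i k) * v
        = 0 := by rw [creationVar_sum N hN ħ β k, zero_mul]
    rw [Finset.sum_mul] at h
    rw [LinearMap.sum_apply, LinearMap.zero_apply, ← h]
    refine Finset.sum_congr rfl fun i _ => ?_
    have e : ((Int.negSucc k : ℤ) : ℂ) = -((k : ℂ) + 1) := by
      rw [Int.cast_negSucc]; push_cast; ring
    rw [e, mul_neg, LinearMap.smul_apply, smul_mul_assoc]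
    rfl

theorem annihilation_creationVar (N : ℕ) (ħ β : ℂ) (i j : Fin N) (k l : ℕ) :
    ∑ x : Fin (N - 1), comm N ħ β i (Fin.castLE (Nat.sub_le N 1) x) ((k : ℤ) + 1) •
      MvPolynomial.pderiv (R := ℂ) (x, k) (creationVar N ħ β j l) =
    if k = l then MvPolynomial.C (comm N ħ β i j ((k : ℤ) + 1)) else 0 := by
  have hX : ∀ x y : Fin (N - 1), MvPolynomial.pderiv (R := ℂ) (x, k) (MvPolynomial.X (y, l)) =
      if k = l ∧ y = x then 1 else 0 := by
    intro x y
    rw [MvPolynomial.pderiv_X, Pi.single_apply]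
    congr 1
    simp only [Prod.mk.injEq, eq_iff_iff]
    tauto
  rw [creationVar]
  split_ifs with hj hkl hkl
  · subst hkl
    simp only [hX, true_and]
    rw [Finset.sum_eq_single ⟨(j : ℕ), hj⟩]
    · simp only [if_true, MvPolynomial.smul_eq_C_mul, mul_one]
      rfl
    · intro b _ hb
      rw [if_neg (Ne.symm hb), smul_zero]
    · simp
  · simp [hX, hkl]
  · subst hkl
    have e : ∀ x : Fin (N - 1), MvPolynomial.pderiv (R := ℂ) (x, k) (-∑ y : Fin (N - 1),
        pPow ħ β (((N : ℂ) - ((y : ℕ) + 1)) * ((k : ℂ) + 1)) • MvPolynomial.X (y, k)) =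
        MvPolynomial.C (-pPow ħ β (((N : ℂ) - ((x : ℕ) + 1)) * ((k : ℂ) + 1))) := by
      intro x
      rw [map_neg, map_sum, map_neg]
      congr 1
      rw [Finset.sum_eq_single x]
      · rw [Derivation.map_smul, hX, if_pos ⟨rfl, rfl⟩, MvPolynomial.smul_eq_C_mul, mul_one]
      · intro y _ hy
        rw [Derivation.map_smul, hX, if_neg (fun h => hy h.2), smul_zero]
      · simp
    simp only [e]
    simp only [MvPolynomial.smul_eq_C_mul, ← map_mul, ← map_sum]
    congr 1
    obtain ⟨M, rfl⟩ : ∃ M, N = M + 1 := ⟨N - 1, by have := j.2; omega⟩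
    have hjl : j = Fin.last M := by
      apply Fin.ext
      have := j.2
      simp only [Fin.val_last]
      omega
    subst hjl
    have h := comm_sum_right (M + 1) ħ β i ((k : ℤ) + 1)
    rw [Fin.sum_univ_castSucc] at h
    have h2 : pPow ħ β (((M : ℂ) + 1) * ((k : ℂ) + 1)) * (_ + _) = _ * 0 := congrArg _ h
    rw [mul_add, mul_zero, Finset.mul_sum, ← mul_assoc, ← pPow_add] at h2
    have e3 : ((M : ℂ) + 1) * ((k : ℂ) + 1) + -((((Fin.last M : Fin (M + 1)) : ℕ) + 1) *
        (((k : ℤ) + 1 : ℤ) : ℂ)) = 0 := by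
      simp only [Fin.val_last]; push_cast; ring
    rw [e3, pPow_zero, one_mul] at h2
    rw [eq_neg_of_add_eq_zero_right h2, ← Finset.sum_neg_distrib]
    refine Finset.sum_congr rfl fun x _ => ?_
    rw [← mul_assoc, ← pPow_add, mul_neg, mul_comm]
    congr 2
    · congr 1
      simp only [Fin.val_castSucc]
      push_cast
      ring
  · simp [hX, hkl]

theorem boson_pos_apply_mul (N : ℕ) (ħ β : ℂ) (lam : Fin N → ℂ) (i j : Fin N) (k l : ℕ)
    (v : Fock N) :
    boson N ħ β lam i (Int.ofNat (k + 1)) (creationVar N ħ β j l * v) =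
      creationVar N ħ β j l * boson N ħ β lam i (Int.ofNat (k + 1)) v +
      (if k = l then comm N ħ β i j ((k : ℤ) + 1) else 0) • v := by
  have h := congrArg (· * v) (annihilation_creationVar N ħ β i j k l)
  simp only [Finset.sum_mul] at h
  have h2 : (if k = l then comm N ħ β i j ((k : ℤ) + 1) else 0) • v =
      (if k = l then MvPolynomial.C (comm N ħ β i j ((k : ℤ) + 1)) else 0) * v := by
    split_ifs <;> simp [MvPolynomial.smul_eq_C_mul]
  rw [h2, ← h]
  simp only [boson, LinearMap.sum_apply, LinearMap.smul_apply, Finset.mul_sum]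
  rw [← Finset.sum_add_distrib]
  refine Finset.sum_congr rfl fun x _ => ?_
  change _ • MvPolynomial.pderiv (R := ℂ) (x, k) _ =
    _ * (_ • MvPolynomial.pderiv (R := ℂ) (x, k) _) + _
  rw [Derivation.leibniz, smul_add, smul_eq_mul, smul_eq_mul, mul_smul_comm, smul_mul_assoc,
    mul_comm v]

theorem pderiv_pderiv_comm {σ : Type*} (x y : σ) (v : MvPolynomial σ ℂ) :
    MvPolynomial.pderiv x (MvPolynomial.pderiv y v) =
      MvPolynomial.pderiv y (MvPolynomial.pderiv x v) := by
  classical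
  have h : ⁅MvPolynomial.pderiv (R := ℂ) x, MvPolynomial.pderiv (R := ℂ) y⁆ = 0 := by
    apply MvPolynomial.derivation_ext
    intro z
    rw [Derivation.commutator_apply, MvPolynomial.pderiv_X, MvPolynomial.pderiv_X]
    simp only [Pi.single_apply]
    split_ifs <;> simp
  have h2 : ⁅MvPolynomial.pderiv (R := ℂ) x, MvPolynomial.pderiv (R := ℂ) y⁆ v = 0 := by
    rw [h]; rfl
  rw [Derivation.commutator_apply] at h2
  exact sub_eq_zero.1 h2

theorem boson_pos_commute (N : ℕ) (ħ β : ℂ) (lam : Fin N → ℂ) (i j : Fin N) (k l : ℕ) :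
    boson N ħ β lam i (Int.ofNat (k + 1)) * boson N ħ β lam j (Int.ofNat (l + 1)) =
      boson N ħ β lam j (Int.ofNat (l + 1)) * boson N ħ β lam i (Int.ofNat (k + 1)) :=
  Commute.sum_left _ _ _ fun x _ => Commute.sum_right _ _ _ fun y _ =>
    Commute.smul_left (Commute.smul_right
      (LinearMap.ext fun v => pderiv_pderiv_comm (x, k) (y, l) v) _) _

/-- The bosons satisfy `[h^i_n, h^j_m] = comm i j n * δ_{n+m,0}`. -/
theorem boson_comm (N : ℕ) (ħ β : ℂ) (lam : Fin N → ℂ) (i j : Fin N) (n m : ℤ) :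
    boson N ħ β lam i n * boson N ħ β lam j m - boson N ħ β lam j m * boson N ħ β lam i n =
      (if n + m = 0 then comm N ħ β i j n else 0) • 1 := by
  have c0 : comm N ħ β i j 0 = 0 := by simp [comm]
  refine LinearMap.ext fun v => ?_
  simp only [LinearMap.sub_apply, Module.End.mul_apply, LinearMap.smul_apply, Module.End.one_apply]
  match n, m with
  | .ofNat 0, m =>
    have : (if (Int.ofNat 0) + m = 0 then comm N ħ β i j (Int.ofNat 0) else 0) = 0 := by
      split_ifs
      · exact c0
      · rfl
    rw [this]
    simp [boson]
  | .ofNat (k + 1), .ofNat 0 =>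
    rw [if_neg (by simp; omega)]
    change boson N ħ β lam i _ (lam j • v) - lam j • boson N ħ β lam i _ v = (0 : ℂ) • v
    rw [map_smul, sub_self, zero_smul]
  | .negSucc k, .ofNat 0 =>
    rw [if_neg (by simp)]
    simp [boson]
  | .ofNat (k + 1), .ofNat (l + 1) =>
    rw [if_neg (by simp; omega)]
    rw [zero_smul, sub_eq_zero]
    exact LinearMap.congr_fun (boson_pos_commute N ħ β lam i j k l) v
  | .negSucc k, .negSucc l =>
    rw [if_neg (by omega)]
    simp only [boson, LinearMap.mulLeft_apply, zero_smul]
    ring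
  | .ofNat (k + 1), .negSucc l =>
    have h := boson_pos_apply_mul N ħ β lam i j k l v
    have e : ((Int.ofNat (k + 1)) + Int.negSucc l = 0) ↔ k = l := by
      simp only [Int.ofNat_eq_natCast]
      omega
    simp only [e]
    change boson N ħ β lam i (Int.ofNat (k + 1)) (creationVar N ħ β j l * v) -
      creationVar N ħ β j l * boson N ħ β lam i (Int.ofNat (k + 1)) v = _
    rw [h, add_sub_cancel_left]
    rfl
  | .negSucc l, .ofNat (k + 1) =>
    have h := boson_pos_apply_mul N ħ β lam j i k l v
    have e : (Int.negSucc l + (Int.ofNat (k + 1)) = 0) ↔ k = l := by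
      simp only [Int.ofNat_eq_natCast]
      omega
    simp only [e]
    change creationVar N ħ β i l * boson N ħ β lam j (Int.ofNat (k + 1)) v -
      boson N ħ β lam j (Int.ofNat (k + 1)) (creationVar N ħ β i l * v) = _
    rw [h, sub_add_cancel_left, ← neg_smul]
    congr 1
    split_ifs with hk
    · subst hk
      rw [← comm_antisymm]
      congr 1
    · simp

/-! ## The currents -/

/-- For indices `J 0, J 1, …` and points `r₀, r₁, …`, the coefficients `E_s` of
`exp (∑_{n>0} ∑ₘ h^{J m}_{-n} (rₘ z)^n) = ∑ₛ E_s z^s` (the creation part). -/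
def creationPart (N : ℕ) (ħ β : ℂ) (lam : Fin N → ℂ) {a : ℕ} (J : Fin a → Fin N) (r : Fin a → ℂ) :
    PowerSeries (Module.End ℂ (Fock N)) :=
  expSeries (PowerSeries.mk fun n =>
    if n = 0 then 0 else ∑ m : Fin a, (r m ^ n) • boson N ħ β lam (J m) (-(n : ℤ)))

/-- The coefficients `E_s` of `exp (∑_{n>0} ∑ₘ h^{J m}_n (rₘ z)^{-n}) = ∑ₛ E_s z^{-s}`
(the annihilation part). -/
def annihilationPart (N : ℕ) (ħ β : ℂ) (lam : Fin N → ℂ) {a : ℕ} (J : Fin a → Fin N)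
    (r : Fin a → ℂ) : PowerSeries (Module.End ℂ (Fock N)) :=
  expSeries (PowerSeries.mk fun n =>
    if n = 0 then 0 else ∑ m : Fin a, (r m ^ (-(n : ℤ))) • boson N ħ β lam (J m) (n : ℤ))

/-- The value of the central factor `q^{√β h^i_0} p^{(N+1)/2-i}` of `Λ_i(z)` on the Fock space of
highest weight `lam`. -/
def zeroModeFactor (N : ℕ) (ħ β : ℂ) (lam : Fin N → ℂ) (i : Fin N) : ℂ :=
  Complex.exp (ħ * (β ^ (1 / 2 : ℂ) * lam i)) *
    pPow ħ β (((N : ℂ) + 1) / 2 - ((i : ℕ) + 1))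

/-! ### Local finiteness

An annihilation operator `h^i_n` lowers the degree by `n`, so every vector is killed by almost all
coefficients of the annihilation part. -/

/-- The degree of a monomial, the variable `(i, k)` having degree `k + 1`. -/
def wt {N : ℕ} (m : Fin (N - 1) × ℕ →₀ ℕ) : ℤ := m.sum fun x e => (e : ℤ) * ((x.2 : ℤ) + 1)

/-- Vectors of degree at most `d`. -/
def deg (N : ℕ) (d : ℤ) : Submodule ℂ (Fock N) :=
  MvPolynomial.restrictSupport ℂ {m | wt m ≤ d}

/-- `T` lowers the degree by at least `s`. -/
def Lowers {N : ℕ} (s : ℕ) (T : Module.End ℂ (Fock N)) : Prop :=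
  ∀ d : ℤ, ∀ v ∈ deg N d, T v ∈ deg N (d - s)

theorem Lowers.zero {N : ℕ} (s : ℕ) : Lowers s (0 : Module.End ℂ (Fock N)) :=
  fun _ _ _ => by simp

theorem Lowers.add {N s : ℕ} {T U : Module.End ℂ (Fock N)} (hT : Lowers s T) (hU : Lowers s U) :
    Lowers s (T + U) :=
  fun d v hv => Submodule.add_mem _ (hT d v hv) (hU d v hv)

theorem Lowers.smul {N s : ℕ} {T : Module.End ℂ (Fock N)} (c : ℂ) (hT : Lowers s T) :
    Lowers s (c • T) :=
  fun d v hv => Submodule.smul_mem _ c (hT d v hv)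

theorem Lowers.sum {N s : ℕ} {ι : Type*} (S : Finset ι) {T : ι → Module.End ℂ (Fock N)}
    (h : ∀ i ∈ S, Lowers s (T i)) : Lowers s (∑ i ∈ S, T i) := by
  classical
  induction S using Finset.induction_on with
  | empty => simpa using Lowers.zero s
  | insert a S ha ih =>
    rw [Finset.sum_insert ha]
    exact (h a (by simp)).add (ih fun i hi => h i (by simp [hi]))

theorem Lowers.mul {N s u : ℕ} {T U : Module.End ℂ (Fock N)} (hT : Lowers s T) (hU : Lowers u U) :
    Lowers (s + u) (T * U) := by
  intro d v hv
  have h := hT _ _ (hU d v hv)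
  rw [sub_sub] at h
  rw [Nat.cast_add, add_comm]
  exact h

theorem Lowers.one {N : ℕ} : Lowers 0 (1 : Module.End ℂ (Fock N)) :=
  fun d v hv => by simpa using hv

theorem wt_nonneg {N : ℕ} (m : Fin (N - 1) × ℕ →₀ ℕ) : 0 ≤ wt m :=
  Finset.sum_nonneg fun x _ => by positivity

theorem deg_neg {N : ℕ} {d : ℤ} (hd : d < 0) : deg N d = ⊥ := by
  rw [deg, MvPolynomial.restrictSupport_eq_span]
  have : {m : Fin (N - 1) × ℕ →₀ ℕ | wt m ≤ d} = ∅ := by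
    ext m
    have := wt_nonneg m
    simp only [Set.mem_ofPred_eq, Set.mem_empty_iff_false, iff_false]
    omega
  simp [this]

theorem exists_mem_deg {N : ℕ} (v : Fock N) : ∃ d : ℕ, v ∈ deg N d := by
  refine ⟨∑ m ∈ v.support, (wt m).toNat, ?_⟩
  rw [deg, MvPolynomial.mem_restrictSupport_iff]
  intro m hm
  have h := Finset.single_le_sum (f := fun m => (wt m).toNat) (fun _ _ => Nat.zero_le _) hm
  have h0 := Int.toNat_of_nonneg (wt_nonneg m)
  simp only [Set.mem_ofPred_eq]
  rw [← h0]
  exact_mod_cast h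

theorem lowers_pderiv {N : ℕ} (j : Fin (N - 1)) (k : ℕ) :
    Lowers (k + 1) (MvPolynomial.pderiv (R := ℂ) (j, k)).toLinearMap := by
  intro d v hv
  rw [deg, MvPolynomial.restrictSupport_eq_span] at hv
  induction hv using Submodule.span_induction with
  | zero => simp
  | add x y _ _ hx hy => rw [map_add]; exact Submodule.add_mem _ hx hy
  | smul c x _ hx => rw [map_smul]; exact Submodule.smul_mem _ c hx
  | mem x hx =>
    obtain ⟨m, hm, rfl⟩ := hx
    have e : (MvPolynomial.pderiv (R := ℂ) (j, k)).toLinearMap (MvPolynomial.monomial m (1 : ℂ)) =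
        MvPolynomial.monomial (m - Finsupp.single (j, k) 1) (1 * (m (j, k) : ℂ)) :=
      MvPolynomial.pderiv_monomial
    simp only [e, deg]
    rw [MvPolynomial.monomial_mem_restrictSupport]
    by_cases h0 : m (j, k) = 0
    · right; simp [h0]
    · left
      have hle : Finsupp.single (j, k) 1 ≤ m := by
        rw [Finsupp.single_le_iff]; omega
      have hs : wt m = wt (m - Finsupp.single (j, k) 1) + ((k : ℤ) + 1) := by
        conv_lhs => rw [← tsub_add_cancel_of_le hle]
        rw [wt, Finsupp.sum_add_index' (by simp) (by intros; push_cast; ring)]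
        simp [wt]
      simp only [Set.mem_ofPred_eq] at hm ⊢
      push_cast
      omega

theorem lowers_boson (N : ℕ) (ħ β : ℂ) (lam : Fin N → ℂ) (i : Fin N) (k : ℕ) :
    Lowers (k + 1) (boson N ħ β lam i ((k + 1 : ℕ) : ℤ)) :=
  Lowers.sum _ fun j _ => (lowers_pderiv j k).smul _

theorem lowers_coeff_expSeries {N : ℕ} {A : PowerSeries (Module.End ℂ (Fock N))}
    (hA : ∀ n, Lowers n (PowerSeries.coeff n A)) (s : ℕ) :
    Lowers s (PowerSeries.coeff s (expSeries A)) := by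
  have hp : ∀ k s : ℕ, Lowers s (PowerSeries.coeff s (A ^ k)) := by
    intro k
    induction k with
    | zero =>
      intro s
      rw [pow_zero, PowerSeries.coeff_one]
      split_ifs with h
      · rw [h]; exact Lowers.one
      · exact Lowers.zero s
    | succ k ih =>
      intro s
      rw [pow_succ, PowerSeries.coeff_mul]
      refine Lowers.sum _ fun x hx => ?_
      rw [← (Finset.HasAntidiagonal.mem_antidiagonal (n := s)).1 hx]
      exact (ih _).mul (hA _)
  rw [expSeries, PowerSeries.coeff_mk]
  exact Lowers.sum _ fun k _ => (hp k s).smul _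

theorem lowers_annihilationPart (N : ℕ) (ħ β : ℂ) (lam : Fin N → ℂ) {a : ℕ} (J : Fin a → Fin N)
    (r : Fin a → ℂ) (s : ℕ) :
    Lowers s (PowerSeries.coeff s (annihilationPart N ħ β lam J r)) := by
  refine lowers_coeff_expSeries (fun n => ?_) s
  rw [PowerSeries.coeff_mk]
  split_ifs with h
  · exact Lowers.zero n
  · obtain ⟨k, rfl⟩ := Nat.exists_eq_succ_of_ne_zero h
    exact Lowers.sum _ fun m _ => (lowers_boson N ħ β lam (J m) k).smul _

theorem annihilationPart_eventually_zero (N : ℕ) (ħ β : ℂ) (lam : Fin N → ℂ) {a : ℕ}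
    (J : Fin a → Fin N) (r : Fin a → ℂ) (v : Fock N) :
    ∃ M : ℕ, ∀ s : ℕ, M < s → PowerSeries.coeff s (annihilationPart N ħ β lam J r) v = 0 := by
  obtain ⟨d, hd⟩ := exists_mem_deg v
  refine ⟨d, fun s hs => ?_⟩
  have h := lowers_annihilationPart N ħ β lam J r s d v hd
  rw [deg_neg (by omega)] at h
  simpa using h

/-! ### The modes of the currents -/

/-- The summand of index `s` of the mode of `z^{-n}` in `:Λ_{J 0}(r₀ z) Λ_{J 1}(r₁ z) ⋯:`
(without the central factor): the annihilation part contributes `z^{-s}`, the creation part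
`z^{s-n}`. -/
def normalOrderedTerm (N : ℕ) (ħ β : ℂ) (lam : Fin N → ℂ) {a : ℕ} (J : Fin a → Fin N)
    (r : Fin a → ℂ) (n : ℤ) (s : ℕ) : Module.End ℂ (Fock N) :=
  if n ≤ s then
    PowerSeries.coeff ((s : ℤ) - n).toNat (creationPart N ħ β lam J r) *
      PowerSeries.coeff s (annihilationPart N ħ β lam J r)
  else 0

theorem normalOrderedTerm_finite (N : ℕ) (ħ β : ℂ) (lam : Fin N → ℂ) {a : ℕ} (J : Fin a → Fin N)
    (r : Fin a → ℂ) (n : ℤ) (v : Fock N) :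
    (Function.support fun s => normalOrderedTerm N ħ β lam J r n s v).Finite := by
  obtain ⟨M, hM⟩ := annihilationPart_eventually_zero N ħ β lam J r v
  refine (Set.finite_Iic M).subset fun s hs => ?_
  by_contra h
  refine hs ?_
  have h0 := hM s (not_le.1 h)
  simp only [normalOrderedTerm]
  split_ifs <;> simp [h0]

/-- The mode of `z^{-n}` in the normal ordered product
`:Λ_{J 0}(r₀ z) Λ_{J 1}(r₁ z) ⋯ = :exp (∑ₘ ∑_{n≠0} h^{J m}_n (rₘ z)^{-n}): × (central factors)`.
The sum over `s` is finite on every vector. -/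
def normalOrderedMode (N : ℕ) (ħ β : ℂ) (lam : Fin N → ℂ) {a : ℕ} (J : Fin a → Fin N)
    (r : Fin a → ℂ) (n : ℤ) : Module.End ℂ (Fock N) where
  toFun v := (∏ m : Fin a, zeroModeFactor N ħ β lam (J m)) •
    ∑ᶠ s : ℕ, normalOrderedTerm N ħ β lam J r n s v
  map_add' v w := by
    simp only [map_add]
    rw [finsum_add_distrib (normalOrderedTerm_finite N ħ β lam J r n v)
      (normalOrderedTerm_finite N ħ β lam J r n w), smul_add]
  map_smul' c v := by
    simp only [map_smul, RingHom.id_apply]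
    rw [← smul_finsum' c (normalOrderedTerm_finite N ħ β lam J r n v), smul_comm]

open Classical in
/-- The mode `W^a_n`, where `W^a(z) = ∑ₙ W^a_n z^{-n}` is
`∑_{j₁ < ⋯ < j_a} :Λ_{j₁}(p^{(a-1)/2} z) Λ_{j₂}(p^{(a-3)/2} z) ⋯ Λ_{j_a}(p^{-(a-1)/2} z):` for
`1 ≤ a ≤ N - 1`, with `W^0(z) = W^N(z) = 1` and `W^a(z) = 0` for `a < 0` or `a > N`. -/
def W (N : ℕ) (ħ β : ℂ) (lam : Fin N → ℂ) (a n : ℤ) : Module.End ℂ (Fock N) :=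
  if a = 0 ∨ a = N then (if n = 0 then 1 else 0)
  else if 0 < a ∧ a < N then
    ∑ J : Fin a.toNat → Fin N with StrictMono J,
      normalOrderedMode N ħ β lam J (fun m => pPow ħ β (((a : ℂ) - 1) / 2 - (m : ℕ))) n
  else 0

theorem W_eventually_zero (N : ℕ) (ħ β : ℂ) (lam : Fin N → ℂ) (a : ℤ) (v : Fock N) :
    ∃ M : ℤ, ∀ n : ℤ, M < n → W N ħ β lam a n v = 0 := by
  classical
  have key : ∀ J : Fin a.toNat → Fin N, ∃ M : ℕ, ∀ n : ℤ, (M : ℤ) < n →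
      normalOrderedMode N ħ β lam J (fun m => pPow ħ β (((a : ℂ) - 1) / 2 - (m : ℕ))) n v = 0 := by
    intro J
    obtain ⟨M, hM⟩ := annihilationPart_eventually_zero N ħ β lam J
      (fun m => pPow ħ β (((a : ℂ) - 1) / 2 - (m : ℕ))) v
    refine ⟨M, fun n hn => ?_⟩
    have : ∀ s : ℕ, normalOrderedTerm N ħ β lam J
        (fun m => pPow ħ β (((a : ℂ) - 1) / 2 - (m : ℕ))) n s v = 0 := by
      intro s
      rw [normalOrderedTerm]
      split_ifs with h
      · rw [Module.End.mul_apply, hM s (by omega), map_zero]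
      · rfl
    simp [normalOrderedMode, this]
  choose M hM using key
  refine ⟨∑ J, (M J : ℤ), fun n hn => ?_⟩
  have hpos : 0 ≤ ∑ J, (M J : ℤ) := Finset.sum_nonneg fun _ _ => by positivity
  rw [W]
  split_ifs with h1 h2 h3
  · omega
  · rfl
  · rw [LinearMap.sum_apply]
    refine Finset.sum_eq_zero fun J _ => hM J n (lt_of_le_of_lt ?_ hn)
    exact Finset.single_le_sum (f := fun J => (M J : ℤ)) (fun _ _ => by positivity)
      (Finset.mem_univ J)
  · rfl

/-! ## Structure functions and products of currents -/

/-- The structure function `f^{a,b}(z) = ∑_{ℓ ≥ 0} f^{a,b}_ℓ z^ℓ`, for all integers `a`, `b`: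
`exp (∑_{n>0} (1/n) (1-q^n) (1-t^{-n}) (1-p^{min(a,b)n})/(1-p^n)
  (1-p^{(N-max(a,b))n})/(1-p^{Nn}) p^{|a-b|n/2} z^n)`. -/
def f (N : ℕ) (ħ β : ℂ) (a b : ℤ) : PowerSeries ℂ :=
  expSeries (PowerSeries.mk fun n =>
    if n = 0 then 0 else
      (1 / (n : ℂ)) * (1 - qPar ħ ^ n) * (1 - (tPar ħ β)⁻¹ ^ n) *
        ((1 - pPow ħ β ((min a b : ℤ) * n)) / (1 - pPow ħ β n)) *
        ((1 - pPow ħ β (((N : ℂ) - (max a b : ℤ)) * n)) / (1 - pPow ħ β (N * n))) *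
        pPow ħ β ((|a - b| : ℤ) / 2 * n))

/-- `γ(p^{1/2} z) = (1 - q z) (1 - t⁻¹ z) / ((1 - z) (1 - p z))`. -/
def γ (ħ β w : ℂ) : ℂ :=
  let z := pPow ħ β (-1 / 2) * w
  (1 - qPar ħ * z) * (1 - (tPar ħ β)⁻¹ * z) / ((1 - z) * (1 - pPow ħ β 1 * z))

/-- The coefficient of `z₁^{-n} z₂^{-m}` in `f^{a,b}(z₂/z₁) W^a(z₁) W^b(z₂)`, applied to `v`.
The sum is finite, since `W^b_{m+ℓ} v = 0` for large `ℓ`. -/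
def fWW (N : ℕ) (ħ β : ℂ) (lam : Fin N → ℂ) (a b n m : ℤ) (v : Fock N) : Fock N :=
  ∑ᶠ ℓ : ℕ, PowerSeries.coeff ℓ (f N ħ β a b) •
    W N ħ β lam a (n - ℓ) (W N ħ β lam b (m + ℓ) v)

/-- The part of total mode `s` of `f^{a,b}(z₂/z₁) W^a(z₁) W^b(z₂) v`. With `x = z₂/z₁` one has
`f^{a,b}(z₂/z₁) W^a(z₁) W^b(z₂) v = ∑ₛ z₂^{-s} ∑ₙ x^n (fWWSeries s n)`, and `fWWSeries s` is a
Laurent series in `x` with coefficients in the Fock space. -/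
def fWWSeries (N : ℕ) (ħ β : ℂ) (lam : Fin N → ℂ) (a b s : ℤ) (v : Fock N) (n : ℤ) : Fock N :=
  fWW N ħ β lam a b n (s - n) v

/-- The formal series `∑ₙ S n x^n` with coefficients in `V` is the expansion of a rational function
which is regular at `x₀` and has the value `w` there: there is a polynomial `Q` with `Q(x₀) ≠ 0`
such that `Q S = P` is a Laurent polynomial with `P(x₀) = Q(x₀) w`. -/
def HasRegularValue {V : Type*} [AddCommGroup V] [Module ℂ V] (S : ℤ → V) (x₀ : ℂ) (w : V) : Prop :=
  ∃ (Q : Polynomial ℂ) (P : ℤ →₀ V), Q.eval x₀ ≠ 0 ∧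
    (∀ n : ℤ, Q.sum (fun k c => c • S (n - k)) = P n) ∧
    P.sum (fun n u => x₀ ^ n • u) = Q.eval x₀ • w

/-- The value of a formal series at a point where it is regular is unique. -/
theorem HasRegularValue.unique {V : Type*} [AddCommGroup V] [Module ℂ V] {S : ℤ → V} {x₀ : ℂ}
    (hx : x₀ ≠ 0) {w w' : V} (h : HasRegularValue S x₀ w) (h' : HasRegularValue S x₀ w') :
    w = w' := by
  obtain ⟨Q, P, hQ, hS, hP⟩ := h
  obtain ⟨Q', P', hQ', hS', hP'⟩ := h'
  have ev : ∀ (R : Polynomial ℂ) (U : ℤ →₀ V),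
      ∑ᶠ n : ℤ, x₀ ^ n • R.sum (fun k c => c • U (n - k)) =
        R.eval x₀ • U.sum (fun n u => x₀ ^ n • u) := by
    intro R U
    have fin : ∀ k : ℕ, (Function.support fun n : ℤ => x₀ ^ n • R.coeff k • U (n - k)).Finite := by
      intro k
      refine ((U.support.finite_toSet).image (fun n => n + (k : ℤ))).subset fun n hn => ?_
      refine ⟨n - k, ?_, by simp⟩
      simp only [SetLike.mem_coe, Finsupp.mem_support_iff]
      intro h0
      exact hn (by simp [h0])
    simp only [Polynomial.sum_def, Finset.smul_sum]
    rw [finsum_sum_comm _ _ fun k _ => fin k, Polynomial.eval_eq_sum, Polynomial.sum_def,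
      Finset.sum_smul]
    refine Finset.sum_congr rfl fun k _ => ?_
    rw [← finsum_comp_equiv (Equiv.addRight (k : ℤ))]
    simp only [Equiv.coe_addRight, add_sub_cancel_right, Finsupp.sum, Finset.smul_sum]
    rw [finsum_eq_sum_of_support_subset (s := U.support)]
    · refine Finset.sum_congr rfl fun n _ => ?_
      rw [zpow_add₀ hx, smul_smul, smul_smul, zpow_natCast]
      congr 1
      ring
    · intro n hn
      simp only [SetLike.mem_coe, Finsupp.mem_support_iff]
      intro h0
      exact hn (by simp [h0])
  have key : ∀ n : ℤ, Q'.sum (fun k c => c • P (n - k)) = Q.sum (fun k c => c • P' (n - k)) := by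
    intro n
    simp only [← hS, ← hS', Polynomial.sum_def, Finset.smul_sum]
    rw [Finset.sum_comm]
    refine Finset.sum_congr rfl fun k _ => Finset.sum_congr rfl fun l _ => ?_
    rw [smul_comm, sub_right_comm]
  have h1 := ev Q' P
  have h2 := ev Q P'
  simp only [key] at h1
  rw [h2, hP, hP', smul_smul, smul_smul, mul_comm] at h1
  exact (smul_right_injective V (mul_ne_zero hQ' hQ) h1).symm

open Classical in
/-- The value at `x₀` of the rational function with expansion `S` (`0` if `S` is not the expansion
of a rational function regular at `x₀`). -/
def regularValue {V : Type*} [AddCommGroup V] [Module ℂ V] (S : ℤ → V) (x₀ : ℂ) : V :=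
  if h : ∃ w, HasRegularValue S x₀ w then h.choose else 0

/-- The coefficient of `z₁^{-n} z₂^{-m}` in
`δ(c z₂/z₁) f^{a,b}(x) W^a(r₁ z₁) W^b(r₂ z₂)`, applied to `v`, where `δ(z) = ∑_{n ∈ ℤ} z^n` and
`f^{a,b}(x) W^a(w₁) W^b(w₂)` stands for the value of (the analytic continuation of)
`f^{a,b}(w₂/w₁) W^a(w₁) W^b(w₂)` at `w₂/w₁ = x`. On the support `z₁ = c z₂` of the delta function
the ratio of the arguments `w₁ = r₁ z₁` and `w₂ = r₂ z₂` is `x = r₂/(r₁ c)`, so the product is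
`∑ᵣ c^r z₂^r z₁^{-r} ∑ₛ (r₂ z₂)^{-s} (regular value of fWWSeries s at x)`. -/
def deltaTerm (N : ℕ) (ħ β : ℂ) (lam : Fin N → ℂ) (a b : ℤ) (c r₁ r₂ : ℂ) (n m : ℤ)
    (v : Fock N) : Fock N :=
  (c ^ n * r₂ ^ (-(n + m))) • regularValue (fWWSeries N ħ β lam a b (n + m) v) (r₂ / (r₁ * c))

end DWA

end

/-! Expand `W^i` and `W^j` as sums over subsets `S`, `T` of the index set with `i` and `j` elements.
Normal ordering a pair of terms produces a scalar series. By a telescoping sum (`sum_sum_bracket`)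
its exponent is a part depending only on the cardinalities, which the structure function cancels,
plus a sum over `S \ T`. What remains is `∏_{d ∈ S \ T} g(p^{rk_S d - rk_T d} u)`, where `g(y) =
γ(p^{1/2} y)`, `u = p^{(j-i)/2} x` and `x = z₂/z₁` (`f_mul_contraction`). Since `g(y) = g(1/(p y))`,
the product in the opposite order carries the expansion at infinity of the same rational function
(`gTS_snd`, `f_mul_contraction_swap`). The left-hand side is therefore the difference of the two
expansions of one rational function of `x`, with values in a commutative algebra of normal ordered
products. If its poles away from `0` and infinity are simple, this difference is a sum of residues
times delta functions (`coeff_sub_coeff_of_simple_poles`).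

Single terms may have further poles, and poles of higher order; they must cancel in the sum. To see
this, read a pair `(S, T)` as a lattice path from `(0, 0)` to `(i, j)`: at a site `d` the first
coordinate grows if `d ∈ S` and the second if `d ∈ T`. A step `(1, 0)` leaving height `h` (the
difference of the coordinates) has the extra weight `g(p^h u)`. Near a point with `u = p^{-H}` this
weight is singular only at the two levels next to height `H`, with opposite residues
(`goodWeight_gTS`), and there the currents in `z₁` and `z₂` at height `H` have equal arguments
(`siteValue_reflect`).

A reflection principle follows by induction on the sites (`Tame.step`): for paths starting at height
at least `H`, the sum is regular if it ends at height at most `H`; otherwise it has a simple pole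
whose residue is `(1-q)(1-t⁻¹)/(1-p) · g(p) ⋯ g(p^{r-1})` times the sum with end point reflected at
height `H`, `r` being the height above `H`. Reversing the paths gives the same for starting points.
As the path runs from height `0` to height `i - j ≤ 0`, one of the two versions applies for every
`H`. Poles occur for `H = i - j - k` and `H = k` with `1 ≤ k ≤ i`, and the reflected sums are those
of `W^{i-k} W^{j+k}`. For `k > i` the reflected sum is empty. For `i - j ≤ H ≤ 0` there is no pole,
which also gives the regularity assertion. -/

noncomputable section
namespace DWA
open PowerSeries Finset

/-! ## Exponential series -/

section Exp

variable {R : Type*} [Ring R] [Algebra ℂ R]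

/-- The Euler operator `z d/dz` on power series. -/
def euler (A : PowerSeries R) : PowerSeries R := PowerSeries.mk fun n => (n : ℂ) • coeff n A

theorem coeff_euler (n : ℕ) (A : PowerSeries R) : coeff n (euler A) = (n : ℂ) • coeff n A :=
  coeff_mk _ _

theorem euler_add (A B : PowerSeries R) : euler (A + B) = euler A + euler B := by
  ext n; simp [coeff_euler]

theorem euler_one : euler (1 : PowerSeries R) = 0 := by
  ext n
  rw [coeff_euler, coeff_one]
  split_ifs with h <;> simp [h]

theorem euler_mul (A B : PowerSeries R) : euler (A * B) = euler A * B + A * euler B := by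
  ext n
  simp only [coeff_euler, coeff_mul, map_add, smul_sum, ← sum_add_distrib]
  refine sum_congr rfl fun x hx => ?_
  rw [← mem_antidiagonal.1 hx, Nat.cast_add, add_smul, smul_mul_assoc, mul_smul_comm]

theorem euler_pow {A : PowerSeries R} (h : Commute A (euler A)) (k : ℕ) :
    euler (A ^ (k + 1)) = ((k : ℂ) + 1) • (euler A * A ^ k) := by
  induction k with
  | zero => simp
  | succ k ih =>
    rw [pow_succ, euler_mul, ih, smul_mul_assoc, mul_assoc, ← pow_succ,
      (h.pow_left (k + 1)).eq, add_smul ((k + 1 : ℕ) : ℂ)]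
    push_cast
    rw [one_smul]

omit [Algebra ℂ R] in
theorem coeff_pow_eq_zero {A : PowerSeries R} (h0 : coeff 0 A = 0) {k s : ℕ} (h : s < k) :
    coeff s (A ^ k) = 0 := by
  induction k generalizing s with
  | zero => omega
  | succ k ih =>
    rw [pow_succ, coeff_mul]
    refine sum_eq_zero fun x hx => ?_
    have hx := mem_antidiagonal.1 hx
    by_cases h2 : x.2 = 0
    · rw [h2, h0, mul_zero]
    · rw [ih (by omega), zero_mul]

/-- `E` solves the differential equation of `exp A`. -/
structure IsExp (A E : PowerSeries R) : Prop where
  coeff_zero : coeff 0 E = 1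
  euler_eq : euler E = euler A * E

theorem IsExp.coeff_eq {A E : PowerSeries R} (h : IsExp A E) (s : ℕ) :
    (s : ℂ) • coeff s E =
      ∑ x ∈ antidiagonal s, (x.1 : ℂ) • (coeff x.1 A * coeff x.2 E) := by
  rw [← coeff_euler, h.euler_eq, coeff_mul]
  simp only [coeff_euler, smul_mul_assoc]

/-- In degree `s > 0` the term of the recursion containing the coefficient of degree `s` of `E` has
factor `0`, so lower coefficients determine it after division by `s`. All identities between
exponentials below are proved by comparing exponents through this uniqueness. -/
theorem IsExp.unique {A E F : PowerSeries R} (hE : IsExp A E) (hF : IsExp A F) : E = F := by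
  ext s
  induction s using Nat.strong_induction_on with
  | _ s ih =>
    rcases Nat.eq_zero_or_pos s with rfl | hs
    · rw [hE.coeff_zero, hF.coeff_zero]
    · have hs' : (s : ℂ) ≠ 0 := by exact_mod_cast hs.ne'
      have : (s : ℂ) • coeff s E = (s : ℂ) • coeff s F := by
        rw [hE.coeff_eq, hF.coeff_eq]
        refine sum_congr rfl fun x hx => ?_
        have hx := mem_antidiagonal.1 hx
        by_cases h1 : x.1 = 0
        · simp [h1]
        · rw [ih x.2 (by omega)]
      have h2 := congrArg (fun y => (s : ℂ)⁻¹ • y) this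
      simpa [smul_smul, inv_mul_cancel₀ hs'] using h2

/-- The Euler operator does not see the constant term of the exponent. -/
theorem IsExp.congr {A B E : PowerSeries R} (h : IsExp A E)
    (hAB : ∀ n, n ≠ 0 → coeff n A = coeff n B) : IsExp B E := by
  refine ⟨h.coeff_zero, ?_⟩
  rw [h.euler_eq]
  congr 1
  ext n
  rw [coeff_euler, coeff_euler]
  by_cases hn : n = 0
  · simp [hn]
  · rw [hAB n hn]

theorem isExp_zero : IsExp (0 : PowerSeries R) 1 :=
  ⟨by simp, by rw [euler_one]; ext n; simp [euler]⟩

omit [Algebra ℂ R] in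
theorem commute_of_coeff {A B : PowerSeries R}
    (h : ∀ m n, Commute (coeff m A) (coeff n B)) : Commute A B := by
  change A * B = B * A
  ext n
  rw [coeff_mul, coeff_mul, ← Nat.sum_antidiagonal_swap]
  exact sum_congr rfl fun x _ => h _ _

theorem isExp_expSeries {A : PowerSeries R} (h0 : coeff 0 A = 0)
    (h : ∀ m n, Commute (coeff m A) (coeff n A)) : IsExp A (expSeries A) := by
  have hc : Commute A (euler A) := commute_of_coeff fun m n => by
    rw [coeff_euler]; exact (h m n).smul_right _
  -- The cut-off `k ≤ s` in `expSeries` depends on the degree; enlarging it adds only zeros, so a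
  -- common cut-off is available. The cut-off `s + 2` used next leaves, after removal of `k = 0`,
  -- the range `s + 1` on both sides.
  have hcoe : ∀ s M : ℕ, s < M → coeff s (expSeries A) =
      ∑ k ∈ range M, ((k.factorial : ℂ)⁻¹) • coeff s (A ^ k) := by
    intro s M hM
    rw [expSeries, coeff_mk]
    refine sum_subset (range_subset_range.2 hM) fun k _ hk => ?_
    rw [coeff_pow_eq_zero h0 (by simpa using hk), smul_zero]
  refine ⟨by simp [expSeries], ?_⟩
  ext s
  rw [coeff_euler, hcoe s (s + 2) (by omega), sum_range_succ', smul_add, coeff_mul]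
  have e0 : (s : ℂ) • ((Nat.factorial 0 : ℂ)⁻¹) • coeff s (A ^ 0) = 0 := by
    rw [pow_zero, coeff_one]
    split_ifs with hs <;> simp [hs]
  rw [e0, add_zero, smul_sum]
  have e1 : ∀ x ∈ antidiagonal s, coeff x.1 (euler A) * coeff x.2 (expSeries A) =
      ∑ k ∈ range (s + 1), ((k.factorial : ℂ)⁻¹) • (coeff x.1 (euler A) * coeff x.2 (A ^ k)) := by
    intro x hx
    have hx := mem_antidiagonal.1 hx
    rw [hcoe x.2 (s + 1) (by omega), mul_sum]
    simp only [mul_smul_comm]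
  rw [sum_congr rfl e1, sum_comm]
  refine sum_congr rfl fun k _ => ?_
  rw [← smul_sum, ← coeff_mul, smul_comm, ← coeff_euler, euler_pow hc]
  rw [coeff_smul, smul_smul]
  congr 1
  have : ((k : ℂ) + 1) ≠ 0 := by exact_mod_cast Nat.succ_ne_zero k
  rw [Nat.factorial_succ]
  push_cast
  field_simp

theorem IsExp.map {S : Type*} [Ring S] [Algebra ℂ S] (φ : R →ₐ[ℂ] S) {A E : PowerSeries R}
    (h : IsExp A E) : IsExp (PowerSeries.map (φ : R →+* S) A) (PowerSeries.map (φ : R →+* S) E) := by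
  have he : ∀ B : PowerSeries R, euler (PowerSeries.map (φ : R →+* S) B) =
      PowerSeries.map (φ : R →+* S) (euler B) := by
    intro B
    ext n
    simp [coeff_euler]
  refine ⟨by simp [h.coeff_zero], ?_⟩
  rw [he, he, h.euler_eq, map_mul]

end Exp

section ExpComm

variable {R : Type*} [CommRing R] [Algebra ℂ R]

theorem isExp_expSeries_comm {A : PowerSeries R} (h0 : coeff 0 A = 0) :
    IsExp A (expSeries A) :=
  isExp_expSeries h0 fun _ _ => Commute.all _ _

theorem IsExp.mul {A B E F : PowerSeries R} (hE : IsExp A E) (hF : IsExp B F) :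
    IsExp (A + B) (E * F) := by
  refine ⟨?_, ?_⟩
  · rw [coeff_mul]; simp [hE.coeff_zero, hF.coeff_zero]
  · rw [euler_mul, euler_add, hE.euler_eq, hF.euler_eq]; ring

theorem IsExp.prod {ι : Type*} (S : Finset ι) {A E : ι → PowerSeries R}
    (h : ∀ i ∈ S, IsExp (A i) (E i)) : IsExp (∑ i ∈ S, A i) (∏ i ∈ S, E i) := by
  classical
  induction S using Finset.induction_on with
  | empty => simpa using isExp_zero
  | insert a S ha ih =>
    rw [sum_insert ha, prod_insert ha]
    exact (h a (by simp)).mul (ih fun i hi => h i (by simp [hi]))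

theorem IsExp.rescale {A E : PowerSeries R} (h : IsExp A E) (c : R) :
    IsExp (PowerSeries.rescale c A) (PowerSeries.rescale c E) := by
  have he : ∀ B : PowerSeries R, euler (PowerSeries.rescale c B) =
      PowerSeries.rescale c (euler B) := by
    intro B
    ext n
    simp [coeff_euler]
  refine ⟨by simp [h.coeff_zero], ?_⟩
  rw [he, he, h.euler_eq, map_mul]

/-- This recognizes `1 - c X` as an exponential, as the inverse of the geometric series. -/
theorem isExp_neg {A E F : PowerSeries R} (h : IsExp A E) (hEF : E * F = 1) : IsExp (-A) F := by
  have h0 : coeff 0 F = 1 := by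
    have := congrArg (coeff 0) hEF
    rw [coeff_mul] at this
    simpa [h.coeff_zero] using this
  refine ⟨h0, ?_⟩
  have h1 := congrArg euler hEF
  rw [euler_mul, euler_one, h.euler_eq] at h1
  have h2 : euler (-A) = -euler A := by ext n; simp [coeff_euler]
  rw [h2]
  have h3 := congrArg (F * ·) h1
  simp only [mul_zero, mul_add] at h3
  linear_combination h3 - (euler F + euler A * F) * hEF

end ExpComm

/-! ### Exchange of exponentials -/

/-- The coefficient of `z ^ k` for an integer `k`. -/
def zcoeff {R : Type*} [Semiring R] (k : ℤ) (B : PowerSeries R) : R :=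
  if 0 ≤ k then coeff k.toNat B else 0

section zcoeff

variable {R : Type*} [Semiring R]

theorem zcoeff_natCast (n : ℕ) (B : PowerSeries R) : zcoeff (n : ℤ) B = coeff n B := by
  simp [zcoeff]

theorem zcoeff_of_neg {k : ℤ} (hk : k < 0) (B : PowerSeries R) : zcoeff k B = 0 := by
  rw [zcoeff, if_neg (by omega)]

theorem zcoeff_map {S : Type*} [Semiring S] (φ : R →+* S) (k : ℤ) (B : PowerSeries R) :
    zcoeff k (PowerSeries.map φ B) = φ (zcoeff k B) := by
  rw [zcoeff, zcoeff]
  split_ifs <;> simp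

end zcoeff

theorem sum_range_sum_range_eq_antidiagonal {M : Type*} [AddCommMonoid M] (n : ℕ)
    (F : ℕ → ℕ → M) (h : ∀ i j, n ≤ i + j → F i j = 0) :
    ∑ i ∈ range n, ∑ j ∈ range n, F i j = ∑ l ∈ range n, ∑ x ∈ antidiagonal l, F x.1 x.2 := by
  have h1 : ∀ i ∈ range n, ∑ j ∈ range n, F i j = ∑ j ∈ range (n - i), F i j := by
    intro i _
    refine (sum_subset (range_subset_range.2 (Nat.sub_le n i)) fun j _ hj => h i j ?_).symm
    simp only [mem_range] at hj
    omega
  rw [sum_congr rfl h1, ← sum_range_diag_flip n F]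
  refine sum_congr rfl fun l _ => ?_
  rw [Nat.sum_antidiagonal_eq_sum_range_succ_mk]

theorem IsExp.zcoeff_eq {R : Type*} [Ring R] [Algebra ℂ R] {A E : PowerSeries R} (h : IsExp A E)
    {M : ℕ} {t : ℤ} (ht : t < M) :
    (t : ℂ) • zcoeff t E = ∑ n ∈ range M, (n : ℂ) • (coeff n A * zcoeff (t - n) E) := by
  rcases lt_or_ge t 0 with h0 | h0
  · rw [zcoeff_of_neg h0, smul_zero]
    refine (sum_eq_zero fun n _ => ?_).symm
    rw [zcoeff_of_neg (by omega), mul_zero, smul_zero]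
  · obtain ⟨s, rfl⟩ := Int.eq_ofNat_of_zero_le h0
    rw [zcoeff_natCast, Int.cast_natCast, h.coeff_eq, Nat.sum_antidiagonal_eq_sum_range_succ_mk]
    have hM : s + 1 ≤ M := by omega
    refine (sum_subset_zero_on_sdiff (range_subset_range.2 hM) (fun n hn => ?_)
      fun n hn => ?_)
    · simp only [mem_sdiff, mem_range] at hn
      rw [zcoeff_of_neg (by omega), mul_zero, smul_zero]
    · have : (s : ℤ) - n = ((s - n : ℕ) : ℤ) := by
        have := mem_range.1 hn; omega
      rw [this, zcoeff_natCast]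

/-- If `aₙ B_s = B_s aₙ + cₙ B_{s-n}` for the coefficients `B_s` of a series `B`, then
`exp a · B = exp c · B · exp a`. -/
theorem IsExp.exchange {R : Type*} [Ring R] [Algebra ℂ R] {a E B : PowerSeries R}
    {c γ : PowerSeries ℂ} (hE : IsExp a E) (hγ : IsExp c γ)
    (h : ∀ (n : ℕ) (s : ℤ), n ≠ 0 → coeff n a * zcoeff s B = zcoeff s B * coeff n a +
      coeff n c • zcoeff (s - n) B) {M : ℕ} {t : ℤ} (ht : t < M) (s : ℤ) :
    zcoeff t E * zcoeff s B =
      ∑ e ∈ range M, coeff e γ • (zcoeff (s - e) B * zcoeff (t - e) E) := by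
  rcases lt_or_ge t 0 with h0 | h0
  · rw [zcoeff_of_neg h0, zero_mul]
    refine (sum_eq_zero fun n _ => ?_).symm
    rw [zcoeff_of_neg (show t - (n : ℤ) < 0 by omega), mul_zero, smul_zero]
  obtain ⟨t, rfl⟩ := Int.eq_ofNat_of_zero_le h0
  induction t using Nat.strong_induction_on generalizing s with
  | _ t ih =>
  rcases Nat.eq_zero_or_pos t with rfl | htpos
  · rw [sum_eq_single 0]
    · simp [hE.coeff_zero, hγ.coeff_zero, zcoeff]
    · intro e _ he
      rw [zcoeff_of_neg (show ((0 : ℕ) : ℤ) - (e : ℤ) < 0 by omega), mul_zero, smul_zero]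
    · intro h; exact absurd (mem_range.2 (by omega)) h
  have ht' : ((t : ℤ) : ℂ) ≠ 0 := by exact_mod_cast htpos.ne'
  -- Write `t = (t - e) + e` in each summand on the right. The part `t - e` comes from the recursion
  -- of `E`; the part `e` comes from the recursion of `γ`, which collects the commutator terms. The
  -- induction hypothesis moves the remaining coefficients of `E` past `B`.
  have key : ((t : ℤ) : ℂ) • (zcoeff t E * zcoeff s B) = ((t : ℤ) : ℂ) •
      ∑ e ∈ range M, coeff e γ • (zcoeff (s - e) B * zcoeff (t - e) E) := by
    rw [← smul_mul_assoc, hE.zcoeff_eq ht, sum_mul]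
    have e1 : ∀ n ∈ range M, (n : ℂ) • (coeff n a * zcoeff ((t : ℤ) - n) E) * zcoeff s B =
        ∑ e ∈ range M, (coeff e γ • (zcoeff (s - e) B *
            ((n : ℂ) • (coeff n a * zcoeff ((t : ℤ) - e - n) E))) +
          (((n : ℂ) * coeff n c) * coeff e γ) •
            (zcoeff (s - (n + e : ℕ)) B * zcoeff ((t : ℤ) - (n + e : ℕ)) E)) := by
      intro n hn
      by_cases hn0 : n = 0
      · simp [hn0]
      have e2 : zcoeff ((t : ℤ) - n) E * zcoeff s B = ∑ e ∈ range M,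
          coeff e γ • (zcoeff (s - e) B * zcoeff ((t : ℤ) - n - e) E) := by
        rcases le_or_gt n t with hnt | hnt
        · have : (t : ℤ) - n = ((t - n : ℕ) : ℤ) := by omega
          rw [this]
          exact ih (t - n) (by omega) s (by omega) (by omega)
        · rw [zcoeff_of_neg (by omega), zero_mul]
          refine (sum_eq_zero fun e _ => ?_).symm
          rw [zcoeff_of_neg (show (t : ℤ) - n - (e : ℤ) < 0 by omega), mul_zero, smul_zero]
      rw [smul_mul_assoc, mul_assoc, e2, mul_sum, smul_sum]
      refine sum_congr rfl fun e _ => ?_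
      have e3 : s - ((n + e : ℕ) : ℤ) = s - e - n := by push_cast; ring
      have e4 : (t : ℤ) - ((n + e : ℕ) : ℤ) = t - n - e := by push_cast; ring
      have e5 : (t : ℤ) - e - n = t - n - e := by ring
      rw [mul_smul_comm, ← mul_assoc, h n _ hn0, e3, e4, e5, add_mul, smul_add, smul_add]
      simp only [smul_mul_assoc, mul_smul_comm, smul_smul, mul_assoc]
      congr 2 <;> ring
    rw [sum_congr rfl e1]
    simp only [sum_add_distrib]
    rw [sum_comm]
    simp only [← smul_sum, ← mul_sum]
    have e6 : ∀ e : ℕ, ∑ n ∈ range M, (n : ℂ) • (coeff n a * zcoeff ((t : ℤ) - e - n) E) =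
        (((t : ℤ) - e : ℤ) : ℂ) • zcoeff ((t : ℤ) - e) E := fun e =>
      (hE.zcoeff_eq (by omega)).symm
    simp only [e6]
    rw [sum_range_sum_range_eq_antidiagonal M (fun n e => (((n : ℂ) * coeff n c) * coeff e γ) •
            (zcoeff (s - (n + e : ℕ)) B * zcoeff ((t : ℤ) - (n + e : ℕ)) E))]
    · rw [smul_sum, ← sum_add_distrib]
      refine sum_congr rfl fun e _ => ?_
      have e7 : ∑ x ∈ antidiagonal e, (((x.1 : ℂ) * coeff x.1 c) * coeff x.2 γ) •
            (zcoeff (s - (x.1 + x.2 : ℕ)) B * zcoeff ((t : ℤ) - (x.1 + x.2 : ℕ)) E) =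
          ((e : ℂ) * coeff e γ) • (zcoeff (s - e) B * zcoeff ((t : ℤ) - e) E) := by
        have := hγ.coeff_eq e
        simp only [smul_eq_mul, ← mul_assoc] at this
        rw [this, sum_smul]
        refine sum_congr rfl fun x hx => ?_
        rw [mem_antidiagonal.1 hx]
      rw [e7, mul_smul_comm, smul_smul, smul_smul, ← add_smul]
      congr 1
      push_cast
      ring
    · intro n e hne
      rw [zcoeff_of_neg (show (t : ℤ) - ((n + e : ℕ) : ℤ) < 0 by omega), mul_zero, smul_zero]
  have h2 := congrArg (fun y => ((t : ℤ) : ℂ)⁻¹ • y) key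
  simpa only [smul_smul, inv_mul_cancel₀ ht', one_smul] using h2

end DWA
end

noncomputable section
namespace DWA
open Finset

/-! ## Places and path sums -/

/-- A point at which some elements of `K` have a value in `S`, with a uniformizer `π`. -/
structure Place (K S : Type*) [CommRing K] [CommRing S] where
  /-- `rel z w`: the element `z` is regular with value `w`. -/
  rel : K → S → Prop
  /-- The uniformizer. -/
  π : K
  rel_add : ∀ {z z' w w'}, rel z w → rel z' w' → rel (z + z') (w + w')
  rel_mul : ∀ {z z' w w'}, rel z w → rel z' w' → rel (z * z') (w * w')
  rel_zero : rel 0 0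
  rel_one : rel 1 1
  rel_π : rel π 0
  -- The axiom that removes a simple pole of residue zero. Values are not required to be unique, so
  -- `rel` stays a relation.
  rel_div : ∀ {z}, rel (π * z) 0 → ∃ w, rel z w

namespace Place

variable {K S : Type*} [CommRing K] [CommRing S] (P : Place K S)

theorem rel_sum {ι : Type*} (T : Finset ι) {z : ι → K} {w : ι → S}
    (h : ∀ i ∈ T, P.rel (z i) (w i)) : P.rel (∑ i ∈ T, z i) (∑ i ∈ T, w i) := by
  classical
  induction T using Finset.induction_on with
  | empty => simpa using P.rel_zero
  | insert a T ha ih =>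
    rw [sum_insert ha, sum_insert ha]
    exact P.rel_add (h a (by simp)) (ih fun i hi => h i (by simp [hi]))

theorem rel_pow {z : K} {w : S} (h : P.rel z w) (n : ℕ) : P.rel (z ^ n) (w ^ n) := by
  induction n with
  | zero => simpa using P.rel_one
  | succ n ih => rw [pow_succ, pow_succ]; exact P.rel_mul ih h

theorem rel_π_mul {z : K} {w : S} (h : P.rel z w) : P.rel (P.π * z) 0 := by
  simpa using P.rel_mul P.rel_π h

end Place

section pathSum

variable {ι K : Type*} [CommRing K]

/-- The sum over all paths from `(m, l)` to `(i, j)`: at each site of the list the path stays, or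
takes a step `(1, 1)`, `(1, 0)` or `(0, 1)`; `a` and `b` are the weights of steps in the first and
second coordinate, and `G` is the additional weight of the step `(1, 0)`. -/
def pathSum (a b : ι → ℤ → K) (G : ℤ → K) (i j : ℤ) : List ι → ℤ → ℤ → K
  | [], m, l => if m = i ∧ l = j then 1 else 0
  | s :: L, m, l => pathSum a b G i j L m l + a s m * b s l * pathSum a b G i j L (m + 1) (l + 1) +
      G (m - l) * a s m * pathSum a b G i j L (m + 1) l + b s l * pathSum a b G i j L m (l + 1)

/-- The effect of one further site on the path sums as a function of the end point. -/
def pathStep (a b : ℤ → K) (G : ℤ → K) (ψ : ℤ → ℤ → K) (m l : ℤ) : K :=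
  ψ m l + a (m - 1) * b (l - 1) * ψ (m - 1) (l - 1) + G (m - 1 - l) * a (m - 1) * ψ (m - 1) l +
    b (l - 1) * ψ m (l - 1)

/-- Path sums are defined by recursion at the starting point; this peels off the last site instead,
which the induction over end points needs. -/
theorem pathSum_append (a b : ι → ℤ → K) (G : ℤ → K) (i j : ℤ) (s : ι) (L : List ι) (m l : ℤ) :
    pathSum a b G i j (L ++ [s]) m l =
      pathStep (a s) (b s) G (fun i j => pathSum a b G i j L m l) i j := by
  induction L generalizing m l with
  | nil =>
    have e1 : m + 1 = i ↔ m = i - 1 := by omega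
    have e2 : l + 1 = j ↔ l = j - 1 := by omega
    have n1 : ¬ i = i - 1 := by omega
    have n2 : ¬ j = j - 1 := by omega
    simp only [List.nil_append, pathSum, pathStep, e1, e2]
    by_cases h1 : m = i <;> by_cases h2 : l = j <;> by_cases h3 : m = i - 1 <;>
      by_cases h4 : l = j - 1 <;> simp [h1, h2, h3, h4, n1, n2]
  | cons s' L ih =>
    simp only [List.cons_append, pathSum, ih, pathStep]
    ring

/-- Coordinates never decrease along a path. -/
theorem pathSum_eq_zero (a b : ι → ℤ → K) (G : ℤ → K) {i j : ℤ} (L : List ι) {m l : ℤ}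
    (h : i < m ∨ j < l) : pathSum a b G i j L m l = 0 := by
  induction L generalizing m l with
  | nil => rw [pathSum, if_neg (by omega)]
  | cons s L ih =>
    rw [pathSum, ih h, ih (by omega), ih (by omega), ih (by omega)]
    simp

end pathSum

/-! ### The reflection principle for path sums. -/

section step

variable {K S : Type*} [CommRing K] [CommRing S] [Algebra ℂ S] (P : Place K S)

/-- `c · g(1) ⋯ g(r - 1)`. -/
def residueFactor (c : ℂ) (g : ℤ → ℂ) (r : ℤ) : ℂ := c * ∏ l ∈ Icc 1 (r - 1), g l

theorem residueFactor_one (c : ℂ) (g : ℤ → ℂ) : residueFactor c g 1 = c := by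
  simp [residueFactor]

theorem residueFactor_succ (c : ℂ) (g : ℤ → ℂ) {r : ℤ} (hr : 1 ≤ r) :
    residueFactor c g (r + 1) = residueFactor c g r * g r := by
  have : Icc 1 (r + 1 - 1) = insert r (Icc 1 (r - 1)) := by
    ext x; simp only [mem_Icc, mem_insert]; omega
  rw [residueFactor, residueFactor, this, prod_insert (by simp)]
  ring

/-- The weight `G` of up-steps at a place: `G h` is regular except at the two levels adjacent to
`H`, where it has simple poles with opposite residues. -/
structure GoodWeight (H : ℤ) (c : ℂ) (g : ℤ → ℂ) (G : ℤ → K) : Prop where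
  rel_of_ne : ∀ h, h ≠ H → h ≠ H - 1 → P.rel (G h) (algebraMap ℂ S (g (h - H)))
  rel_at : P.rel (P.π * G H) (algebraMap ℂ S c)
  rel_pred : P.rel (P.π * G (H - 1)) (-algebraMap ℂ S c)
  symm : ∀ r, g (-1 - r) = g r

/-- The function `ψ` of the end point is regular at heights `≤ H`, and at heights `> H` it has a
simple pole whose residue is given by the value at the end point reflected at height `H`. -/
def Tame (H : ℤ) (c : ℂ) (g : ℤ → ℂ) (ψ : ℤ → ℤ → K) (w : ℤ → ℤ → S) : Prop :=
  (∀ m l, m - l ≤ H → P.rel (ψ m l) (w m l)) ∧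
  ∀ m l, H < m - l →
    P.rel (P.π * ψ m l) (algebraMap ℂ S (residueFactor c g (m - l - H)) * w (l + H) (m - H))

/-- Reflection at height `H` swaps the coordinates up to the shift by `H`, hence steps `(1, 0)` and
`(0, 1)`. At the place the weights of the two kinds of step correspond by `hab`, and the extra
factor `g` of the up-steps is accounted for by the growth of `residueFactor` with the height. -/
theorem Tame.step {H : ℤ} {c : ℂ} {g : ℤ → ℂ} {G : ℤ → K} (hG : GoodWeight P H c g G)
    {a b : ℤ → K} {a₀ b₀ : ℤ → S} (ha : ∀ m, P.rel (a m) (a₀ m)) (hb : ∀ l, P.rel (b l) (b₀ l))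
    (hab : ∀ m, a₀ m = b₀ (m - H)) {ψ : ℤ → ℤ → K} {w : ℤ → ℤ → S} (h : Tame P H c g ψ w) :
    ∃ w', Tame P H c g (pathStep a b G ψ) w' := by
  obtain ⟨h1, h2⟩ := h
  have below : ∀ m l, m - l < H → P.rel (pathStep a b G ψ m l)
      (w m l + a₀ (m - 1) * b₀ (l - 1) * w (m - 1) (l - 1) +
        algebraMap ℂ S (g (m - 1 - l - H)) * a₀ (m - 1) * w (m - 1) l +
        b₀ (l - 1) * w m (l - 1)) := by
    intro m l hml
    refine P.rel_add (P.rel_add (P.rel_add (h1 _ _ (by omega))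
      (P.rel_mul (P.rel_mul (ha _) (hb _)) (h1 _ _ (by omega))))
      (P.rel_mul (P.rel_mul (hG.rel_of_ne _ (by omega) (by omega)) (ha _)) (h1 _ _ (by omega))))
      (P.rel_mul (hb _) (h1 _ _ (by omega)))
  have level : ∀ m l, m - l = H → ∃ w', P.rel (pathStep a b G ψ m l) w' := by
    intro m l hml
    have hreg := P.rel_add (h1 m l (by omega))
      (P.rel_mul (P.rel_mul (ha (m - 1)) (hb (l - 1))) (h1 (m - 1) (l - 1) (by omega)))
    -- At height `H` two poles meet: that of `G (H - 1)` on the step from height `H - 1`, with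
    -- residue `-c`, and that of `ψ` at height `H + 1`, with residue `c` times the value at the
    -- reflected point, which is `(m - 1, l)`. By `hab` the two residues cancel.
    obtain ⟨v, hv⟩ : ∃ v, P.rel (G (m - 1 - l) * a (m - 1) * ψ (m - 1) l +
        b (l - 1) * ψ m (l - 1)) v := by
      apply P.rel_div
      have e1 : m - 1 - l = H - 1 := by omega
      have q1 := P.rel_mul (P.rel_mul hG.rel_pred (ha (m - 1))) (h1 (m - 1) l (by omega))
      have q2 := P.rel_mul (hb (l - 1)) (h2 m (l - 1) (by omega))
      have q := P.rel_add q1 q2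
      have e2 : m - (l - 1) - H = 1 := by omega
      have e3 : l - 1 + H = m - 1 := by omega
      have e4 : m - H = l := by omega
      have e5 : m - 1 - H = l - 1 := by omega
      rw [e2, residueFactor_one, e3, e4, hab, e5] at q
      rw [e1]
      convert q using 1 <;> ring
    have q := P.rel_add hreg hv
    rw [← add_assoc] at q
    exact ⟨_, q⟩
  -- Below height `H` the explicit value is kept, because the residues above `H` are compared with
  -- it. The value `0` above `H` is never used.
  have all : ∀ m l, ∃ w', m - l ≤ H → P.rel (pathStep a b G ψ m l) w' ∧
      (m - l < H → w' = w m l + a₀ (m - 1) * b₀ (l - 1) * w (m - 1) (l - 1) +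
        algebraMap ℂ S (g (m - 1 - l - H)) * a₀ (m - 1) * w (m - 1) l +
        b₀ (l - 1) * w m (l - 1)) := by
    intro m l
    rcases lt_trichotomy (m - l) H with hlt | heq | hgt
    · exact ⟨_, fun _ => ⟨below m l hlt, fun _ => rfl⟩⟩
    · obtain ⟨w', hw'⟩ := level m l heq
      exact ⟨w', fun _ => ⟨hw', fun h => absurd heq h.ne⟩⟩
    · exact ⟨0, fun h => absurd hgt (not_lt.2 h)⟩
  choose w' hw' using all
  refine ⟨w', fun m l hml => (hw' m l hml).1, fun m l hml => ?_⟩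
  rw [(hw' (l + H) (m - H) (by omega)).2 (by omega)]
  set r := m - l - H with hr
  have q1 := h2 m l hml
  have q2 := P.rel_mul (P.rel_mul (ha (m - 1)) (hb (l - 1))) (h2 (m - 1) (l - 1) (by omega))
  have q4 := P.rel_mul (hb (l - 1)) (h2 m (l - 1) (by omega))
  have f1 : m - 1 - (l - 1) - H = r := by omega
  have f2 : m - (l - 1) - H = r + 1 := by omega
  have f3 : l + H - 1 - (m - H) - H = -1 - r := by omega
  have f4 : l - 1 + H = l + H - 1 := by omega
  have f5 : m - 1 - H = m - H - 1 := by omega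
  have g1 : a₀ (l + H - 1) = b₀ (l - 1) := by rw [hab]; congr 1; omega
  have g2 : a₀ (m - 1) = b₀ (m - H - 1) := by rw [hab, f5]
  -- For `r = 1` the step starts at height `H`, where `ψ` is regular and the pole is that of `G H`.
  -- For `r > 1` the pole is that of `ψ`, and the factor `g (r - 1)` extends the product in
  -- `residueFactor`.
  have q3 : P.rel (P.π * (G (m - 1 - l) * a (m - 1) * ψ (m - 1) l))
      (algebraMap ℂ S (residueFactor c g r) * b₀ (m - H - 1) * w (l + H) (m - H - 1)) := by
    rcases eq_or_ne r 1 with hr1 | hr1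
    · have k1 : m - 1 - l = H := by omega
      have := P.rel_mul (P.rel_mul hG.rel_at (ha (m - 1))) (h1 (m - 1) l (by omega))
      rw [hr1, residueFactor_one, k1, ← g2]
      have k2 : l + H = m - 1 := by omega
      have k3 : m - H - 1 = l := by omega
      rw [k2, k3]
      convert this using 1; ring
    · have := P.rel_mul (P.rel_mul (hG.rel_of_ne (m - 1 - l) (by omega) (by omega)) (ha (m - 1)))
        (h2 (m - 1) l (by omega))
      have k1 : m - 1 - l - H = r - 1 := by omega
      have k2 := residueFactor_succ c g (show 1 ≤ r - 1 by omega)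
      rw [sub_add_cancel] at k2
      rw [k1, g2, f5] at this
      rw [k2, map_mul]
      convert this using 1 <;> ring
  rw [f1, f4, f5] at q2
  rw [f2, f4, residueFactor_succ c g (show 1 ≤ r by omega), map_mul] at q4
  have q := P.rel_add (P.rel_add (P.rel_add q1 q2) q3) q4
  -- The up-step into the reflected end point carries `g (-1 - r) = g r`. This is the factor gained
  -- by the step coming from height `r + 1` above `H`.
  rw [f3, hG.symm, g1]
  rw [g2] at q
  convert q using 1
  · rw [pathStep]; ring
  · ring

/-- With no sites the path ends where it starts, at height at least `H`; the reflection of an end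
point above `H` lies below `H`, so the value there is `0` and there is no pole. -/
theorem Tame.delta {H : ℤ} (c : ℂ) (g : ℤ → ℂ) {m₀ l₀ : ℤ} (h : H ≤ m₀ - l₀) :
    ∃ w, Tame P H c g (fun m l => if m₀ = m ∧ l₀ = l then 1 else 0) w := by
  refine ⟨fun m l => if m₀ = m ∧ l₀ = l then 1 else 0, fun m l _ => ?_, fun m l hml => ?_⟩
  · dsimp only
    split_ifs
    · exact P.rel_one
    · exact P.rel_zero
  · dsimp only
    rw [if_neg (show ¬ (m₀ = l + H ∧ l₀ = m - H) by omega), mul_zero]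
    split_ifs
    · exact P.rel_π_mul P.rel_one
    · exact P.rel_π_mul P.rel_zero

variable {ι : Type*}

/-- Path sums as functions of the end point. -/
theorem tame_pathSum_end {H : ℤ} {c : ℂ} {g : ℤ → ℂ} {G : ℤ → K} (hG : GoodWeight P H c g G)
    {a b : ι → ℤ → K} {a₀ b₀ : ι → ℤ → S} (ha : ∀ s m, P.rel (a s m) (a₀ s m))
    (hb : ∀ s l, P.rel (b s l) (b₀ s l)) (hab : ∀ s m, a₀ s m = b₀ s (m - H))
    {m₀ l₀ : ℤ} (h : H ≤ m₀ - l₀) (L : List ι) :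
    ∃ w, Tame P H c g (fun i j => pathSum a b G i j L m₀ l₀) w := by
  induction L using List.reverseRecOn with
  | nil => exact Tame.delta P c g h
  | append_singleton L s ih =>
    obtain ⟨w, hw⟩ := ih
    have := hw.step P hG (ha s) (hb s) (hab s)
    simp only [pathSum_append]
    exact this

/-- Path sums as functions of the starting point. -/
theorem tame_pathSum_start {H : ℤ} {c : ℂ} {g : ℤ → ℂ} {G : ℤ → K} (hG : GoodWeight P H c g G)
    {a b : ι → ℤ → K} {a₀ b₀ : ι → ℤ → S} (ha : ∀ s m, P.rel (a s m) (a₀ s m))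
    (hb : ∀ s l, P.rel (b s l) (b₀ s l)) (hab : ∀ s m, a₀ s m = b₀ s (m - H))
    {i j : ℤ} (h : i - j ≤ H) (L : List ι) :
    ∃ w, Tame P (-H) (-c) g (fun m l => pathSum a b G i j L (-m) (-l)) w := by
  induction L with
  | nil =>
    have := Tame.delta P (-c) g (H := -H) (m₀ := -i) (l₀ := -j) (by omega)
    have e : ∀ m l : ℤ, (-m = i ∧ -l = j) ↔ (-i = m ∧ -j = l) := by intros; omega
    simpa only [pathSum, e] using this
  | cons s L ih =>
    obtain ⟨w, hw⟩ := ih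
    -- Reversing a path negates heights and exchanges the two ends of a step, so an up-step leaving
    -- `h` becomes one leaving `-1 - h`. This interchanges the two singular levels, whence the sign
    -- of the residue.
    have hG' : GoodWeight P (-H) (-c) g (fun h => G (-1 - h)) := by
      refine ⟨fun h h1 h2 => ?_, ?_, ?_, hG.symm⟩
      · have := hG.rel_of_ne (-1 - h) (by omega) (by omega)
        rwa [show -1 - h - H = -1 - (h - -H) by ring, hG.symm] at this
      · rw [show -1 - -H = H - 1 by ring, map_neg]
        exact hG.rel_pred
      · rw [show -1 - (-H - 1) = H by ring, map_neg, neg_neg]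
        exact hG.rel_at
    have := hw.step P hG' (a := fun m => a s (-m - 1)) (b := fun l => b s (-l - 1))
      (fun m => ha s _) (fun l => hb s _) (fun m => by rw [hab]; congr 1; ring)
    convert this using 3 with w'
    funext m l
    simp only [pathSum, pathStep]
    rw [show -(m - 1) - 1 = -m by ring, show -(l - 1) - 1 = -l by ring,
      show -(m - 1) = -m + 1 by ring, show -(l - 1) = -l + 1 by ring,
      show -1 - (m - 1 - l) = -m - -l by ring]

end step

end DWA
end

noncomputable section
namespace DWA
open Finset

/-! ## Two-sided expansions of rational functions -/

section TwoSided

/-- Pairs consisting of a Laurent series in `x` and a Laurent series in `x⁻¹`. -/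
abbrev TwoSided (R : Type*) [CommRing R] : Type _ := LaurentSeries R × LaurentSeries R

variable {R : Type*} [CommRing R]

/-- Constants. -/
def tsC : R →+* TwoSided R := (HahnSeries.C).prod HahnSeries.C

/-- The monomial `x ^ k`. -/
def tsX (k : ℤ) : TwoSided R := (HahnSeries.single k 1, HahnSeries.single (-k) 1)

theorem tsX_mul (k l : ℤ) : (tsX k * tsX l : TwoSided R) = tsX (k + l) := by
  simp [tsX, add_comm]

theorem tsX_zero : (tsX 0 : TwoSided R) = 1 := by
  simp [tsX]

theorem tsX_one_pow (n : ℕ) : (tsX 1 : TwoSided R) ^ n = tsX n := by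
  induction n with
  | zero => simp [tsX_zero]
  | succ n ih => rw [pow_succ, ih, tsX_mul]; simp

theorem coeff_fst_tsX_mul (c : R) (k n : ℤ) (z : TwoSided R) :
    (tsC c * tsX k * z).1.coeff n = c * z.1.coeff (n - k) := by
  have : (tsC c * tsX k * z).1 = HahnSeries.single k c * z.1 := by
    simp [tsC, tsX, HahnSeries.C_apply]
  rw [this, HahnSeries.coeff_single_mul]

theorem coeff_snd_tsX_mul (c : R) (k n : ℤ) (z : TwoSided R) :
    (tsC c * tsX k * z).2.coeff n = c * z.2.coeff (n + k) := by
  have : (tsC c * tsX k * z).2 = HahnSeries.single (-k) c * z.2 := by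
    simp [tsC, tsX, HahnSeries.C_apply]
  rw [this, HahnSeries.coeff_single_mul, sub_neg_eq_add]

/-- The Laurent expansions of a polynomial in `x`. -/
def tsEval : Polynomial R →+* TwoSided R := Polynomial.eval₂RingHom tsC (tsX 1)

theorem tsEval_C (c : R) : tsEval (Polynomial.C c) = tsC c := by simp [tsEval]

theorem tsEval_X : tsEval (Polynomial.X : Polynomial R) = tsX 1 := by simp [tsEval]

theorem tsEval_eq_sum (P : Polynomial R) :
    tsEval P = ∑ k ∈ P.support, tsC (P.coeff k) * tsX (k : ℤ) := by
  simp [tsEval, Polynomial.eval₂_eq_sum, Polynomial.sum_def, tsX_one_pow]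

theorem coeff_fst_tsEval_mul (P : Polynomial R) (z : TwoSided R) (n : ℤ) :
    (tsEval P * z).1.coeff n = ∑ k ∈ P.support, P.coeff k * z.1.coeff (n - k) := by
  rw [tsEval_eq_sum, sum_mul, Prod.fst_sum, HahnSeries.coeff_sum]
  exact sum_congr rfl fun k _ => coeff_fst_tsX_mul _ _ _ _

theorem coeff_tsEval (P : Polynomial R) (n : ℤ) :
    (tsEval P).1.coeff n = (tsEval P).2.coeff (-n) := by
  rw [tsEval_eq_sum, Prod.fst_sum, Prod.snd_sum, HahnSeries.coeff_sum, HahnSeries.coeff_sum]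
  refine sum_congr rfl fun k _ => ?_
  rw [← mul_one (tsC _ * _), coeff_fst_tsX_mul, coeff_snd_tsX_mul]
  simp only [Prod.fst_one, Prod.snd_one, HahnSeries.coeff_one]
  congr 1
  split_ifs <;> first | rfl | omega

variable [Algebra ℂ R]

/-- Complex constants. -/
def tsK : ℂ →+* TwoSided R := tsC.comp (algebraMap ℂ R)

/-- The expansions of `(1 - c x)⁻¹`. -/
def tsGeom (c : ℂ) : TwoSided R :=
  (HahnSeries.ofPowerSeries ℤ R (PowerSeries.mk fun n => algebraMap ℂ R (c ^ n)),
    HahnSeries.single 1 (-algebraMap ℂ R c⁻¹) *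
      HahnSeries.ofPowerSeries ℤ R (PowerSeries.mk fun n => algebraMap ℂ R (c⁻¹ ^ n)))

omit [Algebra ℂ R] in
theorem mk_pow_mul_one_sub (c : R) :
    (1 - PowerSeries.C c * PowerSeries.X) * (PowerSeries.mk fun n => c ^ n) = 1 := by
  ext n
  rw [sub_mul, one_mul, mul_assoc, map_sub, PowerSeries.coeff_C_mul]
  cases n with
  | zero => simp
  | succ n => simp [PowerSeries.coeff_succ_X_mul, PowerSeries.coeff_one, pow_succ, mul_comm]

theorem one_sub_mul_tsGeom {c : ℂ} (hc : c ≠ 0) :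
    (1 - tsK c * tsX 1) * tsGeom c = (1 : TwoSided R) := by
  have h := fun c : ℂ => congrArg (HahnSeries.ofPowerSeries ℤ R)
    (mk_pow_mul_one_sub (algebraMap ℂ R c))
  simp only [map_mul, map_sub, map_one, HahnSeries.ofPowerSeries_C, HahnSeries.ofPowerSeries_X]
    at h
  refine Prod.ext ?_ ?_
  · have := h c
    simpa [tsGeom, tsK, tsC, tsX] using this
  · have := h c⁻¹
    have e : (1 - HahnSeries.C (algebraMap ℂ R c) * HahnSeries.single (-1) 1) *
        HahnSeries.single 1 (-algebraMap ℂ R c⁻¹) =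
        (1 - HahnSeries.C (algebraMap ℂ R c⁻¹) * HahnSeries.single 1 1 : LaurentSeries R) := by
      have e1 : (algebraMap ℂ R c) * (algebraMap ℂ R c⁻¹) = 1 := by
        rw [← map_mul, mul_inv_cancel₀ hc, map_one]
      rw [HahnSeries.C_apply, HahnSeries.C_apply, HahnSeries.single_mul_single,
        HahnSeries.single_mul_single, sub_mul, one_mul, HahnSeries.single_mul_single]
      simp [mul_neg, e1]
      abel
    simp only [tsGeom, tsK, tsC, tsX, Prod.snd_mul, Prod.snd_sub, Prod.snd_one, RingHom.comp_apply,
      RingHom.prod_apply]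
    rw [← mul_assoc, e]
    simpa only [map_pow, HahnSeries.C_apply, HahnSeries.single_mul_single, zero_add, mul_one]
      using this

/-- The two expansions of `1 / (1 - c x)` differ by the delta function `∑ cⁿ xⁿ`. -/
theorem coeff_tsGeom (c : ℂ) (n : ℤ) :
    (tsGeom c : TwoSided R).1.coeff n - (tsGeom c : TwoSided R).2.coeff (-n) =
      algebraMap ℂ R (c ^ n) := by
  simp only [tsGeom, HahnSeries.coeff_single_mul]
  rw [PowerSeries.coeff_coe, PowerSeries.coeff_coe]
  simp only [PowerSeries.coeff_mk]
  rcases lt_or_ge n 0 with h | h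
  · rw [if_pos h, if_neg (by omega)]
    obtain ⟨k, rfl⟩ : ∃ k : ℕ, n = -(k + 1 : ℕ) := ⟨(-n - 1).toNat, by omega⟩
    have : (- -((k + 1 : ℕ) : ℤ) - 1).natAbs = k := by omega
    rw [this, neg_mul, zero_sub, neg_neg, ← map_mul, zpow_neg, zpow_natCast, ← pow_succ',
      inv_pow]
  · rw [if_neg (by omega), if_pos (by omega), mul_zero, sub_zero]
    conv_rhs => rw [← Int.natAbs_of_nonneg h, zpow_natCast]

theorem eq_zero_of_one_sub_mul_eq_zero {c : ℂ} (hc : c ≠ 0) {z : TwoSided R} (h : (1 - tsK c * tsX 1) * z = 0) :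
    z = 0 := by
  have := congrArg (tsGeom c * ·) h
  simp only [mul_zero] at this
  rw [← mul_assoc, mul_comm (tsGeom c), one_sub_mul_tsGeom hc, one_mul] at this
  exact this

/-- Regularity and value at the point `x₀ ≠ 0` of an element `P / Q`. -/
def placeAt (R : Type*) [CommRing R] [Algebra ℂ R] (x₀ : ℂ) (hx : x₀ ≠ 0) :
    Place (TwoSided R) R where
  -- The denominator has complex coefficients and only the numerator involves `R`, so nothing about
  -- zero divisors of `R` is needed.
  rel z w := ∃ (Q : Polynomial ℂ) (P : Polynomial R), Q.eval x₀ ≠ 0 ∧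
    tsEval (Q.map (algebraMap ℂ R)) * z = tsEval P ∧
    P.eval (algebraMap ℂ R x₀) = algebraMap ℂ R (Q.eval x₀) * w
  π := 1 - tsK x₀⁻¹ * tsX 1
  rel_add := by
    rintro z z' w w' ⟨Q, P, hQ, hz, hP⟩ ⟨Q', P', hQ', hz', hP'⟩
    refine ⟨Q * Q', Q'.map (algebraMap ℂ R) * P + Q.map (algebraMap ℂ R) * P', ?_, ?_, ?_⟩
    · rw [Polynomial.eval_mul]; exact mul_ne_zero hQ hQ'
    · rw [Polynomial.map_mul, map_mul, map_add, map_mul, map_mul, ← hz, ← hz']; ring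
    · simp only [Polynomial.eval_add, Polynomial.eval_mul, Polynomial.eval_map_algebraMap, hP, hP',
        Polynomial.aeval_algebraMap_apply, Polynomial.coe_aeval_eq_eval, map_mul]
      ring
  rel_mul := by
    rintro z z' w w' ⟨Q, P, hQ, hz, hP⟩ ⟨Q', P', hQ', hz', hP'⟩
    refine ⟨Q * Q', P * P', ?_, ?_, ?_⟩
    · rw [Polynomial.eval_mul]; exact mul_ne_zero hQ hQ'
    · rw [Polynomial.map_mul, map_mul, map_mul, ← hz, ← hz']; ring
    · simp only [Polynomial.eval_mul, hP, hP', map_mul]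
      ring
  rel_zero := ⟨1, 0, by simp, by simp, by simp⟩
  rel_one := ⟨1, 1, by simp, by simp, by simp⟩
  rel_π := by
    refine ⟨1, 1 - Polynomial.C (algebraMap ℂ R x₀⁻¹) * Polynomial.X, by simp, ?_, ?_⟩
    · simp [tsEval_C, tsEval_X, tsK]
    · simp [← map_mul, inv_mul_cancel₀ hx]
  rel_div := by
    rintro z ⟨Q, P, hQ, hz, hP⟩
    rw [mul_zero] at hP
    -- The numerator vanishes at `x₀`, hence is divisible by `X - x₀ = -x₀ (1 - x₀⁻¹ X)`. The factor
    -- `1 - x₀⁻¹ X` cancels because it is invertible in both rings of Laurent series.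
    obtain ⟨P', rfl⟩ := Polynomial.dvd_iff_isRoot.2 hP
    have e : tsEval (Polynomial.X - Polynomial.C (algebraMap ℂ R x₀)) =
        (1 - tsK x₀⁻¹ * tsX 1) * -tsK x₀ := by
      have e1 : (tsK x₀⁻¹ * tsK x₀ : TwoSided R) = 1 := by
        rw [← map_mul, inv_mul_cancel₀ hx, map_one]
      rw [map_sub, tsEval_C, tsEval_X, show tsC (algebraMap ℂ R x₀) = tsK x₀ from rfl]
      linear_combination -(tsX 1 : TwoSided R) * e1
    have h0 : (1 - tsK x₀⁻¹ * tsX 1) *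
        (tsEval (Q.map (algebraMap ℂ R)) * z + tsK x₀ * tsEval P') = 0 := by
      rw [map_mul, e] at hz
      linear_combination hz
    have h1 := eq_zero_of_one_sub_mul_eq_zero (inv_ne_zero hx) h0
    refine ⟨algebraMap ℂ R (Q.eval x₀)⁻¹ *
      (-(Polynomial.C (algebraMap ℂ R x₀) * P')).eval (algebraMap ℂ R x₀),
      Q, -(Polynomial.C (algebraMap ℂ R x₀) * P'), hQ, ?_, ?_⟩
    · rw [map_neg, map_mul, tsEval_C, show tsC (algebraMap ℂ R x₀) = tsK x₀ from rfl]
      linear_combination h1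
    · rw [← mul_assoc, ← map_mul, mul_inv_cancel₀ hQ, map_one, one_mul]

section placeAt

variable {x₀ : ℂ} (hx : x₀ ≠ 0)

theorem placeAt_tsC (r : R) : (placeAt R x₀ hx).rel (tsC r) r :=
  ⟨1, Polynomial.C r, by simp, by simp [tsEval_C], by simp⟩

theorem placeAt_tsK (c : ℂ) : (placeAt R x₀ hx).rel (tsK c) (algebraMap ℂ R c) :=
  placeAt_tsC hx _

theorem placeAt_tsX (k : ℤ) : (placeAt R x₀ hx).rel (tsX k) (algebraMap ℂ R (x₀ ^ k)) := by
  rcases le_or_gt 0 k with h | h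
  · obtain ⟨n, rfl⟩ := Int.eq_ofNat_of_zero_le h
    refine ⟨1, Polynomial.X ^ n, by simp, ?_, by simp⟩
    rw [map_pow, tsEval_X, tsX_one_pow]; simp
  · obtain ⟨n, rfl⟩ : ∃ n : ℕ, k = -n := ⟨(-k).toNat, by omega⟩
    refine ⟨Polynomial.X ^ n, 1, by simp [hx], ?_, ?_⟩
    · rw [Polynomial.map_pow, Polynomial.map_X, map_pow, tsEval_X, tsX_one_pow, tsX_mul]
      simp [tsX_zero]
    · simp only [Polynomial.eval_one, Polynomial.eval_pow, Polynomial.eval_X]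
      rw [← map_mul, zpow_neg, zpow_natCast, mul_inv_cancel₀ (pow_ne_zero _ hx), map_one]

theorem placeAt_tsGeom {c : ℂ} (hc : c ≠ 0) (h : 1 - c * x₀ ≠ 0) :
    (placeAt R x₀ hx).rel (tsGeom c) (algebraMap ℂ R (1 - c * x₀)⁻¹) := by
  refine ⟨1 - Polynomial.C c * Polynomial.X, 1, by simpa using h, ?_, ?_⟩
  · rw [map_one, ← one_sub_mul_tsGeom hc]
    simp [tsEval_C, tsEval_X, tsK]
  · rw [← map_mul]; simp [h]

/-- A regular element gives a regular series in the sense of `HasRegularValue`. -/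
theorem hasRegularValue_of_rel {V : Type*} [AddCommGroup V] [Module ℂ V] (Θ : R →ₗ[ℂ] V)
    {z : TwoSided R} {w : R} (h : (placeAt R x₀ hx).rel z w) :
    HasRegularValue (fun n => Θ (z.1.coeff n)) x₀ (Θ w) := by
  obtain ⟨Q, P, hQ, hz, hP⟩ := h
  refine ⟨Q, ∑ k ∈ P.support, Finsupp.single (k : ℤ) (Θ (P.coeff k)), hQ, fun n => ?_, ?_⟩
  · have h1 := congrArg (fun y => Θ (y.1.coeff n)) hz
    rw [coeff_fst_tsEval_mul] at h1
    have h2 : (tsEval P).1.coeff n = ∑ k ∈ P.support, if n = k then P.coeff k else 0 := by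
      have := coeff_fst_tsEval_mul P 1 n
      rw [mul_one] at this
      rw [this]
      refine sum_congr rfl fun k _ => ?_
      simp only [Prod.fst_one, HahnSeries.coeff_one, sub_eq_zero]
      split_ifs <;> simp
    rw [h2, map_sum, map_sum] at h1
    rw [Polynomial.sum_def, Finsupp.finsetSum_apply]
    have h3 : (Q.map (algebraMap ℂ R)).support ⊆ Q.support := Polynomial.support_map_subset _ _
    rw [sum_subset h3] at h1
    · simp only [Polynomial.coeff_map, ← Algebra.smul_def, map_smul] at h1
      rw [h1]
      refine sum_congr rfl fun k _ => ?_
      rw [Finsupp.single_apply]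
      simp only [eq_comm (a := n)]
      split_ifs <;> simp
    · intro k _ hk
      rw [Polynomial.notMem_support_iff.1 hk, zero_mul, map_zero]
  · have h1 := congrArg Θ hP
    rw [Polynomial.eval_eq_sum, Polynomial.sum_def, map_sum, ← Algebra.smul_def, map_smul] at h1
    rw [← h1]
    have hadd : ∀ (s : Finset ℕ) (u : ℕ → V),
        (∑ k ∈ s, Finsupp.single (k : ℤ) (u k)).sum (fun n u => x₀ ^ n • u) =
          ∑ k ∈ s, x₀ ^ k • u k := by
      intro s u
      rw [← Finsupp.sum_finsetSum_index (by simp) (by simp)]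
      refine sum_congr rfl fun k _ => ?_
      rw [Finsupp.sum_single_index (by simp), zpow_natCast]
    rw [hadd]
    refine sum_congr rfl fun k _ => ?_
    rw [← map_pow, mul_comm, ← Algebra.smul_def, map_smul]

end placeAt

/-- An element which is regular at all `x₀ ≠ 0` is a Laurent polynomial. -/
theorem coeff_eq_of_regular {z : TwoSided R}
    (h : ∀ (x₀ : ℂ) (hx : x₀ ≠ 0), ∃ w, (placeAt R x₀ hx).rel z w) (n : ℤ) :
    z.1.coeff n = z.2.coeff (-n) := by
  -- The possible denominators of `z` form an ideal. As nothing is assumed at `x = 0`, it is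
  -- enlarged to `I'` by admitting powers of `X`; it will be shown that `I'` contains `1`, so that
  -- `X ^ k * z` is a polynomial for some `k`.
  let I : Ideal (Polynomial ℂ) :=
    { carrier := {Q | ∃ P : Polynomial R, tsEval (Q.map (algebraMap ℂ R)) * z = tsEval P}
      add_mem' := by
        rintro Q Q' ⟨P, hP⟩ ⟨P', hP'⟩
        exact ⟨P + P', by rw [Polynomial.map_add, map_add, add_mul, hP, hP', map_add]⟩
      zero_mem' := ⟨0, by simp⟩
      smul_mem' := by
        rintro Q Q' ⟨P, hP⟩
        exact ⟨Q.map (algebraMap ℂ R) * P, by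
          rw [smul_eq_mul, Polynomial.map_mul, map_mul, mul_assoc, hP, map_mul]⟩ }
  let I' : Ideal (Polynomial ℂ) :=
    { carrier := {Q | ∃ (k : ℕ) , Polynomial.X ^ k * Q ∈ I}
      add_mem' := by
        rintro Q Q' ⟨k, hk⟩ ⟨k', hk'⟩
        refine ⟨k + k', ?_⟩
        have h1 := I.mul_mem_left (Polynomial.X ^ k') hk
        have h2 := I.mul_mem_left (Polynomial.X ^ k) hk'
        have := I.add_mem h1 h2
        convert this using 1
        ring
      zero_mem' := ⟨0, by simp⟩
      smul_mem' := by
        rintro Q Q' ⟨k, hk⟩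
        refine ⟨k, ?_⟩
        have := I.mul_mem_left Q hk
        convert this using 1
        simp only [smul_eq_mul]
        ring }
  have hI : ∀ x₀ : ℂ, x₀ ≠ 0 → ∃ Q ∈ I', Q.eval x₀ ≠ 0 := by
    intro x₀ hx
    obtain ⟨w, Q, P, hQ, hz, -⟩ := h x₀ hx
    exact ⟨Q, ⟨0, P, by rw [pow_zero, one_mul]; exact hz⟩, hQ⟩
  set q := Submodule.IsPrincipal.generator I' with hq
  have hdvd : ∀ Q ∈ I', q ∣ Q := fun Q hQ =>
    (Submodule.IsPrincipal.mem_iff_generator_dvd I').1 hQ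
  have hq0 : q ≠ 0 := by
    intro h0
    obtain ⟨Q, hQ, hQ1⟩ := hI 1 one_ne_zero
    have := hdvd Q hQ
    rw [h0, zero_dvd_iff] at this
    exact hQ1 (by simp [this])
  -- A root `x₀ ≠ 0` of the generator would divide all denominators, against regularity at `x₀`. A
  -- factor `X` could be dropped without leaving `I'`, against minimality of the degree.
  have hdeg : q.degree = 0 := by
    by_contra hd
    obtain ⟨x₀, hroot⟩ := IsAlgClosed.exists_root q hd
    by_cases hx : x₀ = 0
    · subst hx
      obtain ⟨q₁, hq₁⟩ := Polynomial.dvd_iff_isRoot.2 hroot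
      rw [map_zero, sub_zero] at hq₁
      have hmem : q₁ ∈ I' := by
        obtain ⟨k, hk⟩ : q ∈ I' := Submodule.IsPrincipal.generator_mem I'
        refine ⟨k + 1, ?_⟩
        rw [hq₁, ← mul_assoc, ← pow_succ] at hk
        exact hk
      have h1 : q₁ ≠ 0 := by rintro rfl; exact hq0 (by rw [hq₁, mul_zero])
      have := Polynomial.natDegree_le_of_dvd (hdvd q₁ hmem) h1
      rw [hq₁, Polynomial.natDegree_X_mul h1] at this
      omega
    · obtain ⟨Q, hQ, hQ1⟩ := hI x₀ hx
      exact hQ1 (hroot.dvd (hdvd Q hQ))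
  have hone : (1 : Polynomial ℂ) ∈ I' := by
    have hu : IsUnit q := Polynomial.isUnit_iff_degree_eq_zero.2 hdeg
    have : I' = ⊤ := Ideal.eq_top_of_isUnit_mem I' (Submodule.IsPrincipal.generator_mem I') hu
    rw [this]; trivial
  obtain ⟨k, P, hP⟩ := hone
  rw [mul_one, Polynomial.map_pow, Polynomial.map_X, map_pow, tsEval_X, tsX_one_pow] at hP
  have h1 := coeff_fst_tsX_mul 1 (k : ℤ) (n + k) z
  have h2 := coeff_snd_tsX_mul 1 (k : ℤ) (-(n + k)) z
  rw [map_one, one_mul, one_mul, hP] at h1 h2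
  rw [show n + k - (k : ℤ) = n by ring] at h1
  rw [show -(n + k) + (k : ℤ) = -n by ring] at h2
  rw [← h1, ← h2, coeff_tsEval]

/-- The difference of the two expansions of an element with simple poles. -/
theorem coeff_sub_coeff_of_simple_poles {ι : Type*} [Fintype ι] {z : TwoSided R} (x : ι → ℂ)
    (hx : ∀ f, x f ≠ 0) (hinj : Function.Injective x) (ρ : ι → R)
    (hpole : ∀ f, (placeAt R (x f) (hx f)).rel ((placeAt R (x f) (hx f)).π * z) (ρ f))
    (hreg : ∀ (x₀ : ℂ) (h₀ : x₀ ≠ 0), (∀ f, x f ≠ x₀) → ∃ w, (placeAt R x₀ h₀).rel z w) (n : ℤ) :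
    z.1.coeff n - z.2.coeff (-n) = ∑ f, algebraMap ℂ R ((x f)⁻¹ ^ n) * ρ f := by
  classical
  -- The principal parts `ρ f / (1 - x / x_f)` are subtracted. The difference is regular everywhere,
  -- so its two expansions agree, and only the delta functions of the principal parts remain.
  set z' := z + ∑ f, tsC (-ρ f) * tsGeom (x f)⁻¹ with hz'
  have hxinv : ∀ f, (x f)⁻¹ ≠ 0 := fun f => inv_ne_zero (hx f)
  have hterm : ∀ (x₀ : ℂ) (h₀ : x₀ ≠ 0) (f : ι), x f ≠ x₀ →
      ∃ w, (placeAt R x₀ h₀).rel (tsC (-ρ f) * tsGeom (x f)⁻¹) w := by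
    intro x₀ h₀ f hf
    refine ⟨_, (placeAt R x₀ h₀).rel_mul (placeAt_tsC h₀ _) (placeAt_tsGeom h₀ (hxinv f) ?_)⟩
    intro h
    apply hf
    have := hx f
    field_simp at h
    simpa [sub_eq_zero] using h
  have hz : ∀ (x₀ : ℂ) (h₀ : x₀ ≠ 0), ∃ w, (placeAt R x₀ h₀).rel z' w := by
    intro x₀ h₀
    by_cases hf : ∃ f, x f = x₀
    · obtain ⟨f, rfl⟩ := hf
      choose! w hw using hterm (x f) h₀
      refine (placeAt R (x f) h₀).rel_div ?_
      rw [hz', mul_add, ← add_sum_erase univ _ (mem_univ f), mul_add]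
      have q1 := hpole f
      have q2 : (placeAt R (x f) h₀).rel
          ((placeAt R (x f) h₀).π * (tsC (-ρ f) * tsGeom (x f)⁻¹)) (-ρ f) := by
        have : (placeAt R (x f) h₀).π * (tsC (-ρ f) * tsGeom (x f)⁻¹) = tsC (-ρ f) := by
          change (1 - tsK (x f)⁻¹ * tsX 1) * _ = _
          rw [mul_left_comm, one_sub_mul_tsGeom (hxinv f), mul_one]
        rw [this]
        exact placeAt_tsC h₀ _
      have q3 := (placeAt R (x f) h₀).rel_π_mul ((placeAt R (x f) h₀).rel_sum (univ.erase f)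
        (z := fun g => tsC (-ρ g) * tsGeom (x g)⁻¹) (w := w)
        fun g hg => hw g fun h => (mem_erase.1 hg).1 (hinj h))
      have := (placeAt R (x f) h₀).rel_add q1 ((placeAt R (x f) h₀).rel_add q2 q3)
      rwa [add_zero, add_neg_cancel] at this
    · have hf' : ∀ f, x f ≠ x₀ := fun f h => hf ⟨f, h⟩
      choose w hw using fun f => hterm x₀ h₀ f (hf' f)
      obtain ⟨w₀, hw₀⟩ := hreg x₀ h₀ hf'
      exact ⟨_, (placeAt R x₀ h₀).rel_add hw₀ ((placeAt R x₀ h₀).rel_sum _ fun f _ => hw f)⟩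
  have := coeff_eq_of_regular hz n
  rw [hz'] at this
  simp only [Prod.fst_add, Prod.snd_add, Prod.fst_sum, Prod.snd_sum, HahnSeries.coeff_add,
    HahnSeries.coeff_sum] at this
  have e1 : ∀ f, (tsC (-ρ f) * tsGeom (x f)⁻¹ : TwoSided R).1.coeff n =
      -ρ f * (tsGeom (x f)⁻¹ : TwoSided R).1.coeff n := by
    intro f
    have := coeff_fst_tsX_mul (-ρ f) 0 n (tsGeom (x f)⁻¹)
    rwa [tsX_zero, mul_one, sub_zero] at this
  have e2 : ∀ f, (tsC (-ρ f) * tsGeom (x f)⁻¹ : TwoSided R).2.coeff (-n) =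
      -ρ f * (tsGeom (x f)⁻¹ : TwoSided R).2.coeff (-n) := by
    intro f
    have := coeff_snd_tsX_mul (-ρ f) 0 (-n) (tsGeom (x f)⁻¹)
    rwa [tsX_zero, mul_one, add_zero] at this
  simp only [Prod.fst_mul, Prod.snd_mul] at e1 e2 this
  simp only [e1, e2] at this
  have e3 : ∀ f, algebraMap ℂ R ((x f)⁻¹ ^ n) * ρ f =
      -ρ f * (tsGeom (x f)⁻¹ : TwoSided R).2.coeff (-n) -
        -ρ f * (tsGeom (x f)⁻¹ : TwoSided R).1.coeff n := by
    intro f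
    rw [← coeff_tsGeom]
    ring
  rw [sum_congr rfl fun f _ => e3 f, sum_sub_distrib]
  linear_combination this

end TwoSided

/-! ### Places of rings of power series -/

/-- Coefficientwise regularity. -/
def Place.powerSeries {K S : Type*} [CommRing K] [CommRing S] (P : Place K S) :
    Place (PowerSeries K) (PowerSeries S) where
  rel z w := ∀ n, P.rel (PowerSeries.coeff n z) (PowerSeries.coeff n w)
  π := PowerSeries.C P.π
  rel_add h h' n := by rw [map_add, map_add]; exact P.rel_add (h n) (h' n)
  rel_mul h h' n := by
    rw [PowerSeries.coeff_mul, PowerSeries.coeff_mul]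
    exact P.rel_sum _ fun x _ => P.rel_mul (h _) (h' _)
  rel_zero n := by rw [map_zero, map_zero]; exact P.rel_zero
  rel_one n := by
    rw [PowerSeries.coeff_one, PowerSeries.coeff_one]
    split_ifs
    · exact P.rel_one
    · exact P.rel_zero
  rel_π n := by
    rw [PowerSeries.coeff_C, map_zero]
    split_ifs
    · exact P.rel_π
    · exact P.rel_zero
  rel_div {z} h := by
    have : ∀ n, ∃ w, P.rel (PowerSeries.coeff n z) w := fun n => P.rel_div (by
      have := h n
      rwa [PowerSeries.coeff_C_mul, map_zero] at this)
    choose w hw using this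
    exact ⟨PowerSeries.mk w, fun n => by rw [PowerSeries.coeff_mk]; exact hw n⟩

theorem Place.powerSeries_C {K S : Type*} [CommRing K] [CommRing S] (P : Place K S) {z : K} {w : S}
    (h : P.rel z w) : P.powerSeries.rel (PowerSeries.C z) (PowerSeries.C w) := by
  intro n
  rw [PowerSeries.coeff_C, PowerSeries.coeff_C]
  split_ifs
  · exact h
  · exact P.rel_zero

theorem Place.powerSeries_map {K S R : Type*} [CommRing K] [CommRing S] [CommRing R]
    (P : Place K S) {φ : R →+* K} {φ' : R →+* S} (h : ∀ r, P.rel (φ r) (φ' r))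
    (A : PowerSeries R) : P.powerSeries.rel (PowerSeries.map φ A) (PowerSeries.map φ' A) := by
  intro n
  rw [PowerSeries.coeff_map, PowerSeries.coeff_map]
  exact h _

theorem Place.powerSeries_rescale {K S : Type*} [CommRing K] [CommRing S]
    (P : Place K S) {c : K} {c' : S} (hc : P.rel c c') {z : PowerSeries K} {w : PowerSeries S}
    (h : P.powerSeries.rel z w) :
    P.powerSeries.rel (PowerSeries.rescale c z) (PowerSeries.rescale c' w) := by
  intro n
  rw [PowerSeries.coeff_rescale, PowerSeries.coeff_rescale]
  exact P.rel_mul (P.rel_pow hc n) (h n)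

end DWA
end

noncomputable section
namespace DWA
open Finset PowerSeries

/-! ## The rational function `g(y) = γ(p^{1/2} y)` -/

theorem qPar_eq (ħ β : ℂ) : qPar ħ = pPow ħ β 1 * tPar ħ β := by
  rw [pPow_one, mul_assoc, inv_mul_cancel₀ (show tPar ħ β ≠ 0 from Complex.exp_ne_zero _), mul_one]

theorem tPar_ne_zero (ħ β : ℂ) : tPar ħ β ≠ 0 := Complex.exp_ne_zero _

theorem pPow_intCast_ne_one {ħ β : ℂ} (hp : ∀ n : ℕ, 0 < n → pPow ħ β n ≠ 1) {h : ℤ} (hh : h ≠ 0) :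
    pPow ħ β h ≠ 1 := by
  rcases lt_or_gt_of_ne hh with h0 | h0
  · obtain ⟨n, rfl⟩ : ∃ n : ℕ, h = -(n : ℤ) := ⟨(-h).toNat, by omega⟩
    have := hp n (by omega)
    intro h1
    apply this
    rw [Int.cast_neg, pPow_neg, Int.cast_natCast, inv_eq_one] at h1
    exact h1
  · obtain ⟨n, rfl⟩ : ∃ n : ℕ, h = (n : ℤ) := ⟨h.toNat, by omega⟩
    have := hp n (by omega)
    rwa [Int.cast_natCast]

/-- `g(y) = (1 - q y) (1 - t⁻¹ y) / ((1 - y) (1 - p y))`. -/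
def gFun (ħ β y : ℂ) : ℂ :=
  (1 - qPar ħ * y) * (1 - (tPar ħ β)⁻¹ * y) / ((1 - y) * (1 - pPow ħ β 1 * y))

theorem γ_eq_gFun (ħ β x : ℂ) : γ ħ β (pPow ħ β (x + 1 / 2)) = gFun ħ β (pPow ħ β x) := by
  have : pPow ħ β (-1 / 2) * pPow ħ β (x + 1 / 2) = pPow ħ β x := by
    rw [← pPow_add]; congr 1; ring
  simp only [γ, gFun, this]

/-- The substitution `y ↦ 1/(p y)` exchanges the zeros `q⁻¹` and `t` of `g`, because `q = p t`, and
exchanges its poles `1` and `p⁻¹`. -/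
theorem gFun_symm (ħ β : ℂ) (r : ℤ) :
    gFun ħ β (pPow ħ β ((-1 - r : ℤ) : ℂ)) = gFun ħ β (pPow ħ β (r : ℂ)) := by
  have e : pPow ħ β ((-1 - r : ℤ) : ℂ) = (pPow ħ β 1 * pPow ħ β r)⁻¹ := by
    rw [← pPow_add, ← pPow_neg]; congr 1; push_cast; ring
  have hy := pPow_ne_zero ħ β r
  have hp := pPow_ne_zero ħ β 1
  have ht := tPar_ne_zero ħ β
  rw [e, gFun, gFun, qPar_eq ħ β]
  set y := pPow ħ β r
  set p := pPow ħ β 1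
  set t := tPar ħ β
  have hk : (p * y ^ 2)⁻¹ ≠ 0 := inv_ne_zero (mul_ne_zero hp (pow_ne_zero _ hy))
  rw [← mul_div_mul_left ((1 - p * t * y) * (1 - t⁻¹ * y)) ((1 - y) * (1 - p * y)) hk]
  congr 1
  · field_simp; ring
  · field_simp; ring

/-- The residue constant `(1 - q) (1 - t⁻¹) / (1 - p)`. -/
def gRes (ħ β : ℂ) : ℂ := (1 - qPar ħ) * (1 - (tPar ħ β)⁻¹) / (1 - pPow ħ β 1)

/-! ### Expansions -/

theorem isExp_mk_pow (c : ℂ) :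
    IsExp (PowerSeries.mk fun n => c ^ n / n) (PowerSeries.mk fun n => c ^ n) := by
  refine ⟨by simp, ?_⟩
  ext n
  rw [coeff_mul]
  simp only [coeff_euler, coeff_mk, smul_eq_mul]
  have : ∀ x ∈ antidiagonal n, (x.1 : ℂ) * (c ^ x.1 / x.1) * c ^ x.2 =
      (fun k => if k = 0 then 0 else c ^ n) x.1 := by
    intro x hx
    rw [← mem_antidiagonal.1 hx]
    by_cases h : x.1 = 0
    · simp [h]
    · have : (x.1 : ℂ) ≠ 0 := by exact_mod_cast h
      simp only [h, if_false, pow_add]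
      field_simp
  rw [sum_congr rfl this, Nat.sum_antidiagonal_eq_sum_range_succ_mk, sum_range_succ']
  simp

/-- The expansion of `g(c x)` at `x = 0`. -/
def gSeries (ħ β c : ℂ) : PowerSeries ℂ :=
  (1 - C (qPar ħ * c) * X) * (1 - C ((tPar ħ β)⁻¹ * c) * X) *
    (PowerSeries.mk fun n => c ^ n) * (PowerSeries.mk fun n => (pPow ħ β 1 * c) ^ n)

/-- Since `p = q t⁻¹`, the logarithm of `g` has the coefficients `1 - qⁿ - t⁻ⁿ + pⁿ = (1 - qⁿ)(1 -
t⁻ⁿ)`, divided by `n`: the same factor as in the commutators and in the structure functions. -/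
theorem isExp_gSeries (ħ β c : ℂ) :
    IsExp (PowerSeries.mk fun n => (1 / (n : ℂ)) * (1 - qPar ħ ^ n) * (1 - (tPar ħ β)⁻¹ ^ n) * c ^ n)
      (gSeries ħ β c) := by
  have hneg : ∀ c : ℂ, IsExp (-(PowerSeries.mk fun n : ℕ => c ^ n / n)) (1 - C c * X) := fun c =>
    isExp_neg (isExp_mk_pow c) (by rw [mul_comm]; exact mk_pow_mul_one_sub c)
  have h := (((hneg (qPar ħ * c)).mul (hneg ((tPar ħ β)⁻¹ * c))).mul (isExp_mk_pow c)).mul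
    (isExp_mk_pow (pPow ħ β 1 * c))
  refine h.congr fun n _ => ?_
  simp only [map_add, map_neg, coeff_mk, pPow_one]
  ring

variable (R : Type*) [CommRing R] [Algebra ℂ R]

/-- Both expansions of `g(c x)`. -/
def gTS (ħ β c : ℂ) : TwoSided R :=
  (1 - tsK (qPar ħ * c) * tsX 1) * (1 - tsK ((tPar ħ β)⁻¹ * c) * tsX 1) * tsGeom c *
    tsGeom (pPow ħ β 1 * c)

theorem gTS_fst (ħ β c : ℂ) :
    (gTS R ħ β c).1 = HahnSeries.ofPowerSeries ℤ R (PowerSeries.map (algebraMap ℂ R) (gSeries ħ β c)) := by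
  have hm : ∀ c : ℂ, PowerSeries.map (algebraMap ℂ R) (PowerSeries.mk fun n => c ^ n) =
      PowerSeries.mk fun n => algebraMap ℂ R (c ^ n) := fun c => by ext n; simp
  simp only [gTS, gSeries, map_mul (PowerSeries.map (algebraMap ℂ R)), map_sub, map_one, map_C, map_X, hm,
    map_mul (HahnSeries.ofPowerSeries ℤ R), HahnSeries.ofPowerSeries_C, HahnSeries.ofPowerSeries_X]
  rfl

/-- By the invariance of `g` under `y ↦ 1/(p y)`, the expansion of `g(c x)` at infinity is the
expansion at `0` of `g` in the variable `(p c x)⁻¹`. -/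
theorem gTS_snd (ħ β : ℂ) {c : ℂ} (hc : c ≠ 0) :
    (gTS R ħ β c).2 = HahnSeries.ofPowerSeries ℤ R
      (PowerSeries.map (algebraMap ℂ R) (gSeries ħ β (pPow ħ β 1 * c)⁻¹)) := by
  have hm : ∀ c : ℂ, PowerSeries.map (algebraMap ℂ R) (PowerSeries.mk fun n => c ^ n) =
      PowerSeries.mk fun n => algebraMap ℂ R (c ^ n) := fun c => by ext n; simp
  have hp := pPow_ne_zero ħ β 1
  have ht := tPar_ne_zero ħ β
  simp only [gTS, gSeries, map_mul (PowerSeries.map (algebraMap ℂ R)), map_sub, map_one, map_C, map_X, hm,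
    map_mul (HahnSeries.ofPowerSeries ℤ R), HahnSeries.ofPowerSeries_C, HahnSeries.ofPowerSeries_X]
  simp only [Prod.snd_mul, Prod.snd_sub, Prod.snd_one, tsGeom, tsK, tsC, tsX, RingHom.comp_apply,
    RingHom.prod_apply, HahnSeries.C_apply]
  have e1 : (pPow ħ β 1 * (pPow ħ β 1 * c)⁻¹) = c⁻¹ := by field_simp
  rw [e1]
  set A := HahnSeries.ofPowerSeries ℤ R (PowerSeries.mk fun n => algebraMap ℂ R (c⁻¹ ^ n))
  set B := HahnSeries.ofPowerSeries ℤ R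
    (PowerSeries.mk fun n => algebraMap ℂ R ((pPow ħ β 1 * c)⁻¹ ^ n))
  have key : ((1 - HahnSeries.single 0 (algebraMap ℂ R (qPar ħ * c)) * HahnSeries.single (-1) 1) *
      HahnSeries.single 1 (-algebraMap ℂ R (pPow ħ β 1 * c)⁻¹)) *
      ((1 - HahnSeries.single 0 (algebraMap ℂ R ((tPar ħ β)⁻¹ * c)) * HahnSeries.single (-1) 1) *
      HahnSeries.single 1 (-algebraMap ℂ R c⁻¹)) =
      (1 - HahnSeries.single 0 (algebraMap ℂ R (qPar ħ * (pPow ħ β 1 * c)⁻¹)) *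
        HahnSeries.single 1 1) *
      (1 - HahnSeries.single 0 (algebraMap ℂ R ((tPar ħ β)⁻¹ * (pPow ħ β 1 * c)⁻¹)) *
        HahnSeries.single 1 1) := by
    have lin : ∀ a b : ℂ, (1 - HahnSeries.single 0 (algebraMap ℂ R a) * HahnSeries.single (-1) 1) *
        HahnSeries.single 1 (-algebraMap ℂ R b) =
        HahnSeries.single 0 (algebraMap ℂ R (a * b)) - HahnSeries.single (1 : ℤ)
          (algebraMap ℂ R b) := by
      intro a b
      rw [sub_mul, one_mul, HahnSeries.single_mul_single, HahnSeries.single_mul_single]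
      simp only [mul_one, mul_neg, HahnSeries.single_neg, ← map_mul]
      simp only [zero_add, neg_add_cancel]
      abel
    rw [lin, lin]
    have hq := qPar_eq ħ β
    have a1 : qPar ħ * c * (pPow ħ β 1 * c)⁻¹ = tPar ħ β := by rw [hq]; field_simp
    have a2 : (tPar ħ β)⁻¹ * c * c⁻¹ = (tPar ħ β)⁻¹ := by field_simp
    have a3 : qPar ħ * (pPow ħ β 1 * c)⁻¹ = tPar ħ β * c⁻¹ := by rw [hq]; field_simp
    rw [a1, a2, a3]
    have split : ∀ a b : ℂ, HahnSeries.single (1 : ℤ) (algebraMap ℂ R (a * b)) =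
        HahnSeries.single 0 (algebraMap ℂ R a) * HahnSeries.single 1 (algebraMap ℂ R b) := by
      intro a b; rw [HahnSeries.single_mul_single, map_mul, zero_add]
    have inv : HahnSeries.single (0 : ℤ) (algebraMap ℂ R (tPar ħ β)) *
        HahnSeries.single 0 (algebraMap ℂ R (tPar ħ β)⁻¹) = 1 := by
      rw [HahnSeries.single_mul_single, ← map_mul, mul_inv_cancel₀ ht, map_one]; rfl
    simp only [HahnSeries.single_mul_single (a := (0 : ℤ)) (b := (1 : ℤ)), zero_add, mul_one]
    rw [split, split]
    linear_combination (1 - HahnSeries.single 1 (algebraMap ℂ R c⁻¹) *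
      HahnSeries.single 1 (algebraMap ℂ R (pPow ħ β 1 * c)⁻¹)) * inv
  linear_combination A * B * key

variable {R}

/-! ### Poles and residues of `g`. -/

section places

variable {ħ β x₀ : ℂ} (hx : x₀ ≠ 0)

theorem placeAt_one_sub (c : ℂ) :
    (placeAt R x₀ hx).rel (1 - tsK c * tsX 1) (algebraMap ℂ R (1 - c * x₀)) :=
  ⟨1, 1 - Polynomial.C (algebraMap ℂ R c) * Polynomial.X, by simp,
    by simp [tsEval_C, tsEval_X, tsK], by simp⟩

theorem placeAt_gTS {c : ℂ} (hc : c ≠ 0) (h1 : 1 - c * x₀ ≠ 0)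
    (h2 : 1 - pPow ħ β 1 * c * x₀ ≠ 0) :
    (placeAt R x₀ hx).rel (gTS R ħ β c) (algebraMap ℂ R (gFun ħ β (c * x₀))) := by
  have := (placeAt R x₀ hx).rel_mul ((placeAt R x₀ hx).rel_mul ((placeAt R x₀ hx).rel_mul
    (placeAt_one_sub hx (qPar ħ * c)) (placeAt_one_sub hx ((tPar ħ β)⁻¹ * c)))
    (placeAt_tsGeom hx hc h1)) (placeAt_tsGeom hx (mul_ne_zero (pPow_ne_zero ħ β 1) hc) h2)
  rw [← map_mul, ← map_mul, ← map_mul] at this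
  have e : gFun ħ β (c * x₀) = (1 - qPar ħ * c * x₀) * (1 - (tPar ħ β)⁻¹ * c * x₀) *
      (1 - c * x₀)⁻¹ * (1 - pPow ħ β 1 * c * x₀)⁻¹ := by
    simp only [gFun, div_eq_mul_inv, mul_inv, mul_assoc]
  rw [e]
  exact this

theorem placeAt_π_mul_tsGeom {c : ℂ} (hc : c * x₀ = 1) :
    (placeAt R x₀ hx).π * tsGeom c = 1 := by
  have : c = x₀⁻¹ := eq_inv_of_mul_eq_one_left hc
  subst this
  exact one_sub_mul_tsGeom (inv_ne_zero hx)

/-- At `c x₀ = p^{-H}` the denominator `(1 - p^h c x)(1 - p^{h+1} c x)` of the weight vanishes only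
for `h = H` and `h = H - 1`, by one factor each, because `p` is not a root of unity. The residues
are opposite because `q/p = t` and `t⁻¹/p = q⁻¹`. -/
theorem goodWeight_gTS (hp : ∀ n : ℕ, 0 < n → pPow ħ β n ≠ 1) {c : ℂ} {H : ℤ}
    (hc : c * x₀ = pPow ħ β ((-H : ℤ) : ℂ)) :
    GoodWeight (placeAt R x₀ hx) H (gRes ħ β) (fun r => gFun ħ β (pPow ħ β r))
      (fun h => gTS R ħ β (pPow ħ β h * c)) := by
  have hc0 : c ≠ 0 := by
    rintro rfl
    rw [zero_mul] at hc
    exact pPow_ne_zero _ _ _ hc.symm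
  have e : ∀ h : ℤ, pPow ħ β h * c * x₀ = pPow ħ β ((h - H : ℤ) : ℂ) := by
    intro h
    rw [mul_assoc, hc, ← pPow_add]; congr 1; push_cast; ring
  have e1 : ∀ h : ℤ, pPow ħ β 1 * (pPow ħ β h * c) * x₀ = pPow ħ β ((h + 1 - H : ℤ) : ℂ) := by
    intro h
    rw [mul_assoc, e, ← pPow_add]; congr 1; push_cast; ring
  have hne : ∀ h : ℤ, pPow ħ β h * c ≠ 0 := fun h => mul_ne_zero (pPow_ne_zero _ _ _) hc0
  have hsub : ∀ h : ℤ, h ≠ 0 → 1 - pPow ħ β h ≠ 0 := fun h hh =>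
    sub_ne_zero.2 (pPow_intCast_ne_one hp hh).symm
  refine ⟨fun h h1 h2 => ?_, ?_, ?_, gFun_symm ħ β⟩
  · rw [← e]
    refine placeAt_gTS hx (hne h) ?_ ?_
    · rw [e]; exact hsub _ (by omega)
    · rw [e1]; exact hsub _ (by omega)
  · have e0 : pPow ħ β H * c * x₀ = 1 := by rw [e, sub_self, Int.cast_zero, pPow_zero]
    have e2 : (placeAt R x₀ hx).π * gTS R ħ β (pPow ħ β H * c) =
        (1 - tsK (qPar ħ * (pPow ħ β H * c)) * tsX 1) *
        (1 - tsK ((tPar ħ β)⁻¹ * (pPow ħ β H * c)) * tsX 1) *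
        tsGeom (pPow ħ β 1 * (pPow ħ β H * c)) := by
      rw [gTS]
      linear_combination (1 - tsK (qPar ħ * (pPow ħ β H * c)) * tsX 1) *
        (1 - tsK ((tPar ħ β)⁻¹ * (pPow ħ β H * c)) * tsX 1) *
        tsGeom (pPow ħ β 1 * (pPow ħ β H * c)) * placeAt_π_mul_tsGeom (R := R) hx e0
    rw [e2]
    have hden : 1 - pPow ħ β 1 * (pPow ħ β H * c) * x₀ ≠ 0 := by
      rw [e1]; exact hsub _ (by omega)
    have := (placeAt R x₀ hx).rel_mul ((placeAt R x₀ hx).rel_mul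
      (placeAt_one_sub hx (qPar ħ * (pPow ħ β H * c)))
      (placeAt_one_sub hx ((tPar ħ β)⁻¹ * (pPow ħ β H * c))))
      (placeAt_tsGeom hx (mul_ne_zero (pPow_ne_zero ħ β 1) (hne H)) hden)
    rw [← map_mul, ← map_mul] at this
    convert this using 2
    rw [mul_assoc (qPar ħ), mul_assoc (tPar ħ β)⁻¹, mul_assoc (pPow ħ β 1), e0, gRes,
      div_eq_mul_inv, mul_one, mul_one, mul_one]
  · have e0 : pPow ħ β 1 * (pPow ħ β ((H - 1 : ℤ) : ℂ) * c) * x₀ = 1 := by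
      rw [e1, sub_add_cancel, sub_self, Int.cast_zero, pPow_zero]
    have e3 : pPow ħ β ((H - 1 : ℤ) : ℂ) * c * x₀ = (pPow ħ β 1)⁻¹ := by
      rw [e, ← pPow_neg]; congr 1; push_cast; ring
    set d := pPow ħ β ((H - 1 : ℤ) : ℂ) * c with hd
    have e2 : (placeAt R x₀ hx).π * gTS R ħ β d =
        (1 - tsK (qPar ħ * d) * tsX 1) * (1 - tsK ((tPar ħ β)⁻¹ * d) * tsX 1) * tsGeom d := by
      rw [gTS]
      linear_combination (1 - tsK (qPar ħ * d) * tsX 1) *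
        (1 - tsK ((tPar ħ β)⁻¹ * d) * tsX 1) * tsGeom d * placeAt_π_mul_tsGeom (R := R) hx e0
    rw [e2]
    have hp1 : pPow ħ β 1 ≠ 1 := by simpa using hp 1 one_pos
    have hp0 := pPow_ne_zero ħ β 1
    have ht0 := tPar_ne_zero ħ β
    have hden : 1 - d * x₀ ≠ 0 := by
      rw [e3]; intro h
      exact hp1 (inv_eq_one.1 (sub_eq_zero.1 h).symm)
    have := (placeAt R x₀ hx).rel_mul ((placeAt R x₀ hx).rel_mul
      (placeAt_one_sub hx (qPar ħ * d)) (placeAt_one_sub hx ((tPar ħ β)⁻¹ * d)))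
      (placeAt_tsGeom hx (hne (H - 1)) hden)
    rw [← map_mul, ← map_mul] at this
    convert this using 1
    rw [← map_neg]
    congr 1
    rw [mul_assoc (qPar ħ), mul_assoc (tPar ħ β)⁻¹, e3, gRes, qPar_eq ħ β]
    have h1 : 1 - pPow ħ β 1 ≠ 0 := sub_ne_zero.2 hp1.symm
    have h2 : pPow ħ β 1 - 1 ≠ 0 := sub_ne_zero.2 hp1
    have h3 : 1 - (pPow ħ β 1)⁻¹ = (pPow ħ β 1 - 1) / pPow ħ β 1 := by field_simp
    rw [h3]
    field_simp
    ring

end places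

theorem GoodWeight.powerSeries {K S : Type*} [CommRing K] [CommRing S] [Algebra ℂ S]
    {P : Place K S} {H : ℤ} {c : ℂ} {g : ℤ → ℂ} {G : ℤ → K} (h : GoodWeight P H c g G) :
    GoodWeight P.powerSeries H c g (fun n => PowerSeries.C (G n)) := by
  have e : ∀ x : ℂ, algebraMap ℂ (PowerSeries S) x = PowerSeries.C (algebraMap ℂ S x) :=
    fun x => PowerSeries.algebraMap_apply
  refine ⟨fun n h1 h2 => ?_, ?_, ?_, h.symm⟩
  · rw [e]; exact P.powerSeries_C (h.rel_of_ne n h1 h2)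
  · have := P.powerSeries_C h.rel_at
    rw [map_mul, ← e] at this
    exact this
  · have := P.powerSeries_C h.rel_pred
    rw [map_mul, map_neg, ← e] at this
    exact this

end DWA
end

noncomputable section
namespace DWA
open Finset

/-! ## Sums over pairs of subsets -/

section rank

variable {ι : Type*} [LinearOrder ι]

/-- The number of elements of `S` below `d`. -/
def rk (S : Finset ι) (d : ι) : ℕ := #{e ∈ S | e < d}

theorem rk_insert_of_lt {S : Finset ι} {a d : ι} (ha : a ∉ S) (h : a < d) :
    rk (insert a S) d = rk S d + 1 := by
  rw [rk, filter_insert, if_pos h, card_insert_of_notMem (by simp [ha]), rk]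

theorem rk_insert_of_le {S : Finset ι} {a d : ι} (h : d ≤ a) : rk (insert a S) d = rk S d := by
  rw [rk, filter_insert, if_neg (not_lt.2 h), rk]

theorem rk_eq_zero {S : Finset ι} {a : ι} (h : ∀ x ∈ S, a ≤ x) : rk S a = 0 := by
  rw [rk, card_eq_zero, filter_eq_empty_iff]
  exact fun x hx => not_lt.2 (h x hx)

theorem rk_eq_card {S : Finset ι} {a : ι} (h : ∀ x ∈ S, x < a) : rk S a = #S := by
  rw [rk, filter_true_of_mem h]

theorem rk_filter_lt {S : Finset ι} {d e : ι} (h : e < d) : rk {x ∈ S | x < d} e = rk S e := by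
  rw [rk, rk, filter_filter]
  congr 1
  ext x
  simp only [mem_filter]
  constructor
  · rintro ⟨h1, _, h2⟩; exact ⟨h1, h2⟩
  · rintro ⟨h1, h2⟩; exact ⟨h1, h2.trans h, h2⟩

theorem sum_rk {M : Type*} [AddCommMonoid M] (S : Finset ι) (F : ℕ → M) :
    ∑ e ∈ S, F (rk S e) = ∑ k ∈ range #S, F k := by
  induction S using Finset.induction_on_max with
  | empty => simp
  | insert a S h ih =>
    have ha : a ∉ S := fun h' => lt_irrefl _ (h a h')
    rw [sum_insert ha, card_insert_of_notMem ha, sum_range_succ, ← ih, add_comm,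
      rk_insert_of_le le_rfl, rk_eq_card h]
    congr 1
    exact sum_congr rfl fun e he => by rw [rk_insert_of_le (h e he).le]

theorem sum_rk_lt {M : Type*} [AddCommMonoid M] (S : Finset ι) (d : ι) (F : ℕ → M) :
    ∑ e ∈ S with e < d, F (rk S e) = ∑ k ∈ range (rk S d), F k := by
  rw [rk, ← sum_rk {e ∈ S | e < d}]
  exact sum_congr rfl fun e he => by rw [rk_filter_lt (mem_filter.1 he).2]

theorem rk_image {a : ℕ} {J : Fin a → ι} (hJ : StrictMono J) (m : Fin a) :
    rk (univ.image J) (J m) = m := by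
  rw [rk, filter_image, card_image_of_injective _ hJ.injective]
  simp only [hJ.lt_iff_lt]
  rw [show ({x | x < m} : Finset (Fin a)) = Iio m by ext; simp, Fin.card_Iio]

theorem sum_strictMono {M : Type*} [AddCommMonoid M] [Fintype ι] (a : ℕ)
    [DecidablePred (StrictMono : (Fin a → ι) → Prop)] (F : Finset ι → M) :
    ∑ J : Fin a → ι with StrictMono J, F (univ.image J) = ∑ S ∈ powersetCard a univ, F S := by
  refine sum_nbij (fun J => univ.image J) ?_ ?_ ?_ fun _ _ => rfl
  · intro J hJ
    rw [mem_filter] at hJ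
    rw [mem_powersetCard]
    exact ⟨subset_univ _, by rw [card_image_of_injective _ hJ.2.injective]; simp⟩
  · intro J hJ J' hJ' h
    simp only [coe_filter, mem_univ, true_and] at hJ hJ'
    refine (hJ.range_inj hJ').1 ?_
    have := congrArg (fun s : Finset ι => (s : Set ι)) h
    simpa using this
  · intro S hS
    have hS := (mem_powersetCard.1 (mem_coe.1 hS)).2
    refine ⟨S.orderEmbOfFin hS, ?_, ?_⟩
    · simp [(S.orderEmbOfFin hS).strictMono]
    · apply coe_injective
      simp

end rank

/-! ### Pairs of subsets as lattice paths. -/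

section pathSum

variable {ι K : Type*} [LinearOrder ι] [CommRing K]

/-- The weight of the path given by the sets `S`, `T` of sites with a step in the first and in the
second coordinate. -/
def pairWeight (a b : ι → ℤ → K) (G : ℤ → K) (S T : Finset ι) (m l : ℤ) : K :=
  (∏ d ∈ S \ T, G (m + rk S d - (l + rk T d))) * (∏ d ∈ S, a d (m + rk S d)) *
    ∏ d ∈ T, b d (l + rk T d)

variable (a b : ι → ℤ → K) (G : ℤ → K) {S T : Finset ι} {s : ι}

/-- A new smallest element raises all other ranks by one, which amounts to a shift of the starting
coordinate. -/
theorem prod_insert_min {M : Type*} [CommMonoid M] (hs : ∀ x ∈ S, s < x) (F : ι → ℤ → M) (m : ℤ) :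
    ∏ d ∈ insert s S, F d (m + rk (insert s S) d) = F s m * ∏ d ∈ S, F d (m + 1 + rk S d) := by
  have h : s ∉ S := fun h' => lt_irrefl _ (hs s h')
  rw [prod_insert h, rk_insert_of_le le_rfl, rk_eq_zero fun x hx => (hs x hx).le, Nat.cast_zero,
    add_zero]
  congr 1
  refine prod_congr rfl fun d hd => ?_
  rw [rk_insert_of_lt h (hs d hd)]
  congr 1
  push_cast
  ring

theorem pairWeight_insert_insert (hS : ∀ x ∈ S, s < x) (hT : ∀ x ∈ T, s < x) (m l : ℤ) :
    pairWeight a b G (insert s S) (insert s T) m l =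
      a s m * b s l * pairWeight a b G S T (m + 1) (l + 1) := by
  have h : s ∉ S := fun h' => lt_irrefl _ (hS s h')
  have h' : s ∉ T := fun h' => lt_irrefl _ (hT s h')
  rw [pairWeight, pairWeight, prod_insert_min hS, prod_insert_min hT]
  have e : insert s S \ insert s T = S \ T := by
    ext x; simp only [mem_sdiff, mem_insert]; grind
  have e2 : ∀ d ∈ S \ T, G (m + rk (insert s S) d - (l + rk (insert s T) d)) =
      G (m + 1 + rk S d - (l + 1 + rk T d)) := by
    intro d hd
    have := hS d (mem_sdiff.1 hd).1
    rw [rk_insert_of_lt h this, rk_insert_of_lt h' this]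
    congr 1
    push_cast
    ring
  rw [e, prod_congr rfl e2]
  ring

theorem pairWeight_insert_left (hS : ∀ x ∈ S, s < x) (hT : ∀ x ∈ T, s < x) (m l : ℤ) :
    pairWeight a b G (insert s S) T m l =
      G (m - l) * a s m * pairWeight a b G S T (m + 1) l := by
  have h : s ∉ S := fun h' => lt_irrefl _ (hS s h')
  have h' : s ∉ T := fun h' => lt_irrefl _ (hT s h')
  rw [pairWeight, pairWeight, prod_insert_min hS]
  have e : insert s S \ T = insert s (S \ T) := by
    ext x; simp only [mem_sdiff, mem_insert]; grind
  have e2 : ∀ d ∈ S \ T, G (m + rk (insert s S) d - (l + rk T d)) =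
      G (m + 1 + rk S d - (l + rk T d)) := by
    intro d hd
    rw [rk_insert_of_lt h (hS d (mem_sdiff.1 hd).1)]
    congr 1
    push_cast
    ring
  rw [e, prod_insert (by simp [h]), prod_congr rfl e2, rk_insert_of_le le_rfl,
    rk_eq_zero fun x hx => (hS x hx).le, rk_eq_zero fun x hx => (hT x hx).le]
  simp only [Nat.cast_zero, add_zero]
  ring

theorem pairWeight_insert_right (hS : ∀ x ∈ S, s < x) (hT : ∀ x ∈ T, s < x) (m l : ℤ) :
    pairWeight a b G S (insert s T) m l = b s l * pairWeight a b G S T m (l + 1) := by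
  have h : s ∉ S := fun h' => lt_irrefl _ (hS s h')
  have h' : s ∉ T := fun h' => lt_irrefl _ (hT s h')
  rw [pairWeight, pairWeight, prod_insert_min hT]
  have e : S \ insert s T = S \ T := by
    ext x; simp only [mem_sdiff, mem_insert]; grind
  have e2 : ∀ d ∈ S \ T, G (m + rk S d - (l + rk (insert s T) d)) =
      G (m + rk S d - (l + 1 + rk T d)) := by
    intro d hd
    rw [rk_insert_of_lt h' (hS d (mem_sdiff.1 hd).1)]
    congr 1
    push_cast
    ring
  rw [e, prod_congr rfl e2]
  ring

/-- Whether the smallest site lies in `S` and in `T` decides which of the four moves the path makes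
first; the rest is the path sum of the remaining sites from the shifted starting point. -/
theorem pathSum_sort (i j : ℤ) (U : Finset ι) (m l : ℤ) :
    pathSum a b G i j (U.sort (· ≤ ·)) m l = ∑ S ∈ U.powerset, ∑ T ∈ U.powerset,
      if m + #S = i ∧ l + #T = j then pairWeight a b G S T m l else 0 := by
  induction U using Finset.induction_on_min generalizing m l with
  | empty => simp [pathSum, pairWeight]
  | insert s U hs ih =>
    have h : s ∉ U := fun h' => lt_irrefl _ (hs s h')
    rw [sort_insert (r := (· ≤ ·)) (fun x hx => (hs x hx).le) h, pathSum, sum_powerset_insert h]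
    simp only [sum_powerset_insert h, ih, sum_add_distrib, mul_sum]
    have hsub : ∀ S ∈ U.powerset, ∀ x ∈ S, s < x := fun S hS x hx => hs x (mem_powerset.1 hS hx)
    have hc : ∀ S ∈ U.powerset, #(insert s S) = #S + 1 := fun S hS =>
      card_insert_of_notMem fun h' => lt_irrefl _ (hsub S hS s h')
    have e1 : ∀ S ∈ U.powerset, ∀ T ∈ U.powerset,
        (if m + #(insert s S) = i ∧ l + #(insert s T) = j then
          pairWeight a b G (insert s S) (insert s T) m l else 0) =
        a s m * b s l * if m + 1 + #S = i ∧ l + 1 + #T = j then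
          pairWeight a b G S T (m + 1) (l + 1) else 0 := by
      intro S hS T hT
      rw [hc S hS, hc T hT, pairWeight_insert_insert a b G (hsub S hS) (hsub T hT), mul_ite, mul_zero]
      push_cast
      simp only [add_assoc, add_comm (1 : ℤ)]
    have e2 : ∀ S ∈ U.powerset, ∀ T ∈ U.powerset,
        (if m + #(insert s S) = i ∧ l + #T = j then
          pairWeight a b G (insert s S) T m l else 0) =
        G (m - l) * a s m * if m + 1 + #S = i ∧ l + #T = j then
          pairWeight a b G S T (m + 1) l else 0 := by
      intro S hS T hT
      rw [hc S hS, pairWeight_insert_left a b G (hsub S hS) (hsub T hT), mul_ite, mul_zero]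
      push_cast
      simp only [add_assoc, add_comm (1 : ℤ)]
    have e3 : ∀ S ∈ U.powerset, ∀ T ∈ U.powerset,
        (if m + #S = i ∧ l + #(insert s T) = j then
          pairWeight a b G S (insert s T) m l else 0) =
        b s l * if m + #S = i ∧ l + 1 + #T = j then
          pairWeight a b G S T m (l + 1) else 0 := by
      intro S hS T hT
      rw [hc T hT, pairWeight_insert_right a b G (hsub S hS) (hsub T hT), mul_ite, mul_zero]
      push_cast
      simp only [add_assoc, add_comm (1 : ℤ)]
    rw [sum_congr rfl fun S hS => sum_congr rfl fun T hT => e1 S hS T hT,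
      sum_congr rfl fun S hS => sum_congr rfl fun T hT => e2 S hS T hT,
      sum_congr rfl fun S hS => sum_congr rfl fun T hT => e3 S hS T hT]
    ring

theorem pathSum_univ [Fintype ι] (i j : ℕ) :
    pathSum a b G i j ((univ : Finset ι).sort (· ≤ ·)) 0 0 =
      ∑ S ∈ powersetCard i univ, ∑ T ∈ powersetCard j univ, pairWeight a b G S T 0 0 := by
  rw [pathSum_sort]
  simp only [powersetCard_eq_filter, sum_filter]
  refine sum_congr rfl fun S _ => ?_
  simp only [zero_add, Nat.cast_inj]
  by_cases h : #S = i
  · simp [h]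
  · simp [h]

end pathSum

/-! ### The contractions -/

section bracket

variable {ι : Type*} [LinearOrder ι]

/-- The numerator of `comm`. -/
def bracket (y Y : ℂ) (d e : ι) : ℂ :=
  if d = e then 1 - Y * y⁻¹ else (1 - y⁻¹) * if d < e then Y else 1

theorem sum_split_lt_eq_gt (T : Finset ι) (d : ι) (F : ι → ℂ) :
    ∑ e ∈ T, F e = ∑ e ∈ T with e < d, F e + (if d ∈ T then F d else 0) +
      ∑ e ∈ T with d < e, F e := by
  rw [← sum_filter_add_sum_filter_not T (· < d), add_assoc]
  congr 1
  simp only [not_lt]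
  rw [← sum_filter_add_sum_filter_not (filter (d ≤ ·) T) (· = d)]
  congr 1
  · rw [filter_filter]
    have : {e ∈ T | d ≤ e ∧ e = d} = if d ∈ T then {d} else ∅ := by
      ext e; split_ifs with h <;> simp <;> grind
    rw [this]
    split_ifs <;> simp
  · rw [filter_filter]
    refine sum_congr ?_ fun _ _ => rfl
    ext e; simp only [mem_filter]; grind

/-- The sum over `T` telescopes on either side of `d`, with an additional factor `Y` beyond `d`. If
`d ∈ T`, the diagonal entry joins the two pieces without a gap; if not, the gap `y⁻¹ ^ rk T d * (1 -
Y)` is left over. -/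
theorem sum_bracket (y Y : ℂ) (T : Finset ι) (d : ι) :
    ∑ e ∈ T, y⁻¹ ^ rk T e * bracket y Y d e =
      (1 - Y * y⁻¹ ^ #T) - if d ∈ T then 0 else y⁻¹ ^ rk T d * (1 - Y) := by
  have tel : ∀ n : ℕ, ∑ k ∈ range n, y⁻¹ ^ k * (1 - y⁻¹) = 1 - y⁻¹ ^ n := by
    intro n
    rw [← sum_mul, ← neg_sub (y⁻¹) 1, mul_neg, geom_sum_mul]; ring
  have h1 : ∑ e ∈ T with e < d, y⁻¹ ^ rk T e * bracket y Y d e = 1 - y⁻¹ ^ rk T d := by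
    rw [← tel, ← sum_rk_lt]
    refine sum_congr rfl fun e he => ?_
    have he := (mem_filter.1 he).2
    rw [bracket, if_neg he.ne', if_neg (not_lt.2 he.le), mul_one]
  have h2 : ∑ e ∈ T with d < e, y⁻¹ ^ rk T e * bracket y Y d e =
      Y * ∑ e ∈ T with d < e, y⁻¹ ^ rk T e * (1 - y⁻¹) := by
    rw [mul_sum]
    refine sum_congr rfl fun e he => ?_
    have he := (mem_filter.1 he).2
    rw [bracket, if_neg he.ne, if_pos he]
    ring
  have h3 := sum_split_lt_eq_gt T d fun e => y⁻¹ ^ rk T e * (1 - y⁻¹)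
  rw [sum_rk T fun k => y⁻¹ ^ k * (1 - y⁻¹), sum_rk_lt T d fun k => y⁻¹ ^ k * (1 - y⁻¹), tel,
    tel] at h3
  rw [sum_split_lt_eq_gt T d, h1, h2]
  split_ifs at h3 ⊢ with hd
  · rw [bracket, if_pos rfl]
    linear_combination (-Y) * h3
  · linear_combination (-Y) * h3

/-- `bracket` is not symmetric, so the product in the opposite order needs its own telescoping sum.
-/
theorem sum_bracket_swap (y Y : ℂ) (hy : y ≠ 0) (T : Finset ι) (d : ι) :
    ∑ e ∈ T, y ^ rk T e * bracket y Y e d =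
      y⁻¹ * ((y ^ #T - Y) - if d ∈ T then 0 else y ^ rk T d * (1 - Y)) := by
  have tel : ∀ n : ℕ, ∑ k ∈ range n, y ^ k * (1 - y⁻¹) = y⁻¹ * (y ^ n - 1) := by
    intro n
    have : 1 - y⁻¹ = (y - 1) * y⁻¹ := by field_simp
    rw [← sum_mul, this, ← mul_assoc, geom_sum_mul]; ring
  have h1 : ∑ e ∈ T with d < e, y ^ rk T e * bracket y Y e d =
      ∑ e ∈ T with d < e, y ^ rk T e * (1 - y⁻¹) := by
    refine sum_congr rfl fun e he => ?_
    have he := (mem_filter.1 he).2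
    rw [bracket, if_neg he.ne', if_neg (not_lt.2 he.le), mul_one]
  have h2 : ∑ e ∈ T with e < d, y ^ rk T e * bracket y Y e d =
      Y * (y⁻¹ * (y ^ rk T d - 1)) := by
    rw [← tel, ← sum_rk_lt, mul_sum]
    refine sum_congr rfl fun e he => ?_
    have he := (mem_filter.1 he).2
    rw [bracket, if_neg he.ne, if_pos he]
    ring
  have h3 := sum_split_lt_eq_gt T d fun e => y ^ rk T e * (1 - y⁻¹)
  rw [sum_rk T fun k => y ^ k * (1 - y⁻¹), sum_rk_lt T d fun k => y ^ k * (1 - y⁻¹), tel,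
    tel] at h3
  rw [sum_split_lt_eq_gt T d, h1, h2]
  split_ifs at h3 ⊢ with hd
  · rw [bracket, if_pos rfl]
    linear_combination - h3
  · linear_combination - h3

/-- The first term depends only on the cardinalities and is the exponent of the structure function;
the second, divided by `1 - Y`, gives the exponent of the product of `g` over `S \ T`. -/
theorem sum_sum_bracket (y Y : ℂ) (S T : Finset ι) :
    ∑ d ∈ S, ∑ e ∈ T, y ^ rk S d * y⁻¹ ^ rk T e * bracket y Y d e =
      (∑ k ∈ range #S, y ^ k) * (1 - Y * y⁻¹ ^ #T) -
        (1 - Y) * ∑ d ∈ S \ T, y ^ rk S d * y⁻¹ ^ rk T d := by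
  have h : ∀ d ∈ S, ∑ e ∈ T, y ^ rk S d * y⁻¹ ^ rk T e * bracket y Y d e =
      y ^ rk S d * (1 - Y * y⁻¹ ^ #T) -
        if d ∈ T then 0 else (1 - Y) * (y ^ rk S d * y⁻¹ ^ rk T d) := by
    intro d _
    simp only [mul_assoc]
    rw [← mul_sum, sum_bracket y Y]
    split_ifs <;> ring
  rw [sum_congr rfl h, sum_sub_distrib, ← sum_mul, sum_rk S fun k => y ^ k, mul_sum,
    sdiff_eq_filter, sum_filter]
  congr 1
  exact sum_congr rfl fun d _ => by split_ifs <;> rfl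

theorem sum_sum_bracket_swap (y Y : ℂ) (hy : y ≠ 0) (S T : Finset ι) :
    ∑ e ∈ T, ∑ d ∈ S, y ^ rk T e * y⁻¹ ^ rk S d * bracket y Y e d =
      y⁻¹ * ((∑ k ∈ range #S, y⁻¹ ^ k) * (y ^ #T - Y) -
        (1 - Y) * ∑ d ∈ S \ T, y⁻¹ ^ rk S d * y ^ rk T d) := by
  rw [sum_comm]
  have h : ∀ d ∈ S, ∑ e ∈ T, y ^ rk T e * y⁻¹ ^ rk S d * bracket y Y e d =
      y⁻¹ * (y⁻¹ ^ rk S d * (y ^ #T - Y) -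
        if d ∈ T then 0 else (1 - Y) * (y⁻¹ ^ rk S d * y ^ rk T d)) := by
    intro d _
    have : ∀ e, y ^ rk T e * y⁻¹ ^ rk S d * bracket y Y e d =
      y⁻¹ ^ rk S d * (y ^ rk T e * bracket y Y e d) := fun e => by ring
    simp only [this]
    rw [← mul_sum, sum_bracket_swap y Y hy]
    split_ifs <;> ring
  rw [sum_congr rfl h, ← mul_sum, sum_sub_distrib, ← sum_mul, sum_rk S fun k => y⁻¹ ^ k, mul_sum,
    sdiff_eq_filter, sum_filter]
  congr 2
  exact sum_congr rfl fun d _ => by split_ifs <;> rfl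

end bracket

end DWA
end

noncomputable section
namespace DWA
open Finset

/-! ## The currents in terms of commuting series -/

section Fock

variable (N : ℕ) (ħ β : ℂ) (lam : Fin N → ℂ)

/-- The algebra generated by the annihilation operators. -/
def annihAlg : Subalgebra ℂ (Module.End ℂ (Fock N)) :=
  Algebra.adjoin ℂ (Set.range fun x : Fin N × ℕ => boson N ħ β lam x.1 ((x.2 + 1 : ℕ) : ℤ))

theorem annihAlg_mul_comm (x y : annihAlg N ħ β lam) : x * y = y * x := by
  have : IsMulCommutative (annihAlg N ħ β lam) := by
    refine Algebra.isMulCommutative_adjoin ℂ ?_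
    rintro _ ⟨x, rfl⟩ _ ⟨y, rfl⟩
    exact boson_pos_commute N ħ β lam x.1 y.1 x.2 y.2
  exact mul_comm' x y

/-- Path sums and places are formulated over commutative rings. -/
instance : CommRing (annihAlg N ħ β lam) :=
  { (inferInstance : Ring (annihAlg N ħ β lam)) with mul_comm := annihAlg_mul_comm N ħ β lam }

/-- The annihilation operators as elements of `annihAlg`; `annihGen i 0 = 0`. -/
def annihGen (i : Fin N) : ℕ → annihAlg N ħ β lam
  | 0 => 0
  | k + 1 => ⟨boson N ħ β lam i ((k + 1 : ℕ) : ℤ), Algebra.subset_adjoin ⟨(i, k), rfl⟩⟩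

theorem coe_annihGen (i : Fin N) {n : ℕ} (hn : n ≠ 0) :
    (annihGen N ħ β lam i n : Module.End ℂ (Fock N)) = boson N ħ β lam i (n : ℤ) := by
  obtain ⟨k, rfl⟩ := Nat.exists_eq_succ_of_ne_zero hn
  rfl

/-- The creation operators as elements of the Fock space. -/
def creGen (i : Fin N) : ℕ → Fock N
  | 0 => 0
  | k + 1 => creationVar N ħ β i k

theorem boson_neg (i : Fin N) {n : ℕ} (hn : n ≠ 0) :
    boson N ħ β lam i (-(n : ℤ)) = Algebra.lmul ℂ (Fock N) (creGen N ħ β i n) := by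
  obtain ⟨k, rfl⟩ := Nat.exists_eq_succ_of_ne_zero hn
  rfl

/-- `exp (∑ₙ h^i_{-n} zⁿ)`. -/
def creExp (i : Fin N) : PowerSeries (Fock N) := expSeries (PowerSeries.mk (creGen N ħ β i))

/-- `exp (∑ₙ h^i_n wⁿ)`. -/
def annExp (i : Fin N) : PowerSeries (annihAlg N ħ β lam) :=
  expSeries (PowerSeries.mk (annihGen N ħ β lam i))

theorem isExp_creExp (i : Fin N) : IsExp (PowerSeries.mk (creGen N ħ β i)) (creExp N ħ β i) :=
  isExp_expSeries_comm (by rw [PowerSeries.coeff_mk]; rfl)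

theorem isExp_annExp (i : Fin N) :
    IsExp (PowerSeries.mk (annihGen N ħ β lam i)) (annExp N ħ β lam i) :=
  isExp_expSeries_comm (by rw [PowerSeries.coeff_mk]; rfl)

/-- The argument `c p^{-m}` of the factor of index `d` in the product over `S`. -/
def site (c : ℂ) (S : Finset (Fin N)) (d : Fin N) : ℂ := c * pPow ħ β (-(rk S d : ℂ))

/-- The creation part of the product of the currents `Λ_d (c p^{-m} z)`, `d ∈ S`. -/
def cre (c : ℂ) (S : Finset (Fin N)) : PowerSeries (Fock N) :=
  ∏ d ∈ S, PowerSeries.rescale (algebraMap ℂ (Fock N) (site N ħ β c S d)) (creExp N ħ β d)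

/-- The annihilation part. -/
def ann (c : ℂ) (S : Finset (Fin N)) : PowerSeries (annihAlg N ħ β lam) :=
  ∏ d ∈ S, PowerSeries.rescale (algebraMap ℂ (annihAlg N ħ β lam) (site N ħ β c S d)⁻¹)
    (annExp N ħ β lam d)

/-- The product of the central factors. -/
def zeroFactor (S : Finset (Fin N)) : ℂ := ∏ d ∈ S, zeroModeFactor N ħ β lam d

theorem isExp_cre (c : ℂ) (S : Finset (Fin N)) :
    IsExp (PowerSeries.mk fun n => ∑ d ∈ S, site N ħ β c S d ^ n • creGen N ħ β d n)
      (cre N ħ β c S) := by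
  refine (IsExp.prod S fun d _ => (isExp_creExp N ħ β d).rescale
    (algebraMap ℂ (Fock N) (site N ħ β c S d))).congr fun n _ => ?_
  rw [map_sum, PowerSeries.coeff_mk]
  refine sum_congr rfl fun d _ => ?_
  rw [PowerSeries.coeff_rescale, PowerSeries.coeff_mk, ← map_pow, Algebra.smul_def]

theorem isExp_ann (c : ℂ) (S : Finset (Fin N)) :
    IsExp (PowerSeries.mk fun n => ∑ d ∈ S, (site N ħ β c S d)⁻¹ ^ n • annihGen N ħ β lam d n)
      (ann N ħ β lam c S) := by
  refine (IsExp.prod S fun d _ => (isExp_annExp N ħ β lam d).rescale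
    (algebraMap ℂ (annihAlg N ħ β lam) (site N ħ β c S d)⁻¹)).congr fun n _ => ?_
  rw [map_sum, PowerSeries.coeff_mk]
  refine sum_congr rfl fun d _ => ?_
  rw [PowerSeries.coeff_rescale, PowerSeries.coeff_mk, ← map_pow, Algebra.smul_def]

/-- The annihilation part, as a series of operators. -/
def annOp (c : ℂ) (S : Finset (Fin N)) : PowerSeries (Module.End ℂ (Fock N)) :=
  PowerSeries.map ((annihAlg N ħ β lam).val : annihAlg N ħ β lam →+* Module.End ℂ (Fock N))
    (ann N ħ β lam c S)

theorem isExp_annOp (c : ℂ) (S : Finset (Fin N)) :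
    IsExp (PowerSeries.mk fun n => ∑ d ∈ S, (site N ħ β c S d)⁻¹ ^ n • boson N ħ β lam d (n : ℤ))
      (annOp N ħ β lam c S) := by
  refine ((isExp_ann N ħ β lam c S).map (annihAlg N ħ β lam).val).congr fun n hn => ?_
  simp only [PowerSeries.coeff_map, PowerSeries.coeff_mk, RingHom.coe_coe, map_sum, map_smul]
  refine sum_congr rfl fun d _ => ?_
  rw [← coe_annihGen N ħ β lam d hn]
  rfl

theorem sum_image_rk {M : Type*} [AddCommMonoid M] {a : ℕ} {J : Fin a → Fin N} (hJ : StrictMono J)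
    (F : Fin N → ℕ → M) : ∑ d ∈ univ.image J, F d (rk (univ.image J) d) = ∑ m, F (J m) m := by
  rw [sum_image hJ.injective.injOn]
  exact sum_congr rfl fun m _ => by rw [rk_image hJ]

/-- The creation part is defined as one exponential in the operator ring, while `cre` is a product
of exponentials in the polynomial ring. They agree because they have the same exponent. -/
theorem creationPart_eq (c : ℂ) {a : ℕ} {J : Fin a → Fin N} (hJ : StrictMono J) :
    creationPart N ħ β lam J (fun m => c * pPow ħ β (-((m : ℕ) : ℂ))) =
      PowerSeries.map (Algebra.lmul ℂ (Fock N) : Fock N →+* Module.End ℂ (Fock N))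
        (cre N ħ β c (univ.image J)) := by
  have hA : ∀ n : ℕ, n ≠ 0 → ∑ m : Fin a, ((c * pPow ħ β (-((m : ℕ) : ℂ))) ^ n) •
      boson N ħ β lam (J m) (-(n : ℤ)) = Algebra.lmul ℂ (Fock N)
        (∑ d ∈ univ.image J, site N ħ β c (univ.image J) d ^ n • creGen N ħ β d n) := by
    intro n hn
    simp only [site]
    rw [sum_image_rk N hJ fun d m => (c * pPow ħ β (-(m : ℂ))) ^ n • creGen N ħ β d n, map_sum]
    refine sum_congr rfl fun m _ => ?_
    rw [map_smul, boson_neg N ħ β lam _ hn]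
  have hc : ∀ n : ℕ, ∃ φ : Fock N, PowerSeries.coeff n (PowerSeries.mk fun n : ℕ =>
      if n = 0 then 0 else ∑ m : Fin a, ((c * pPow ħ β (-((m : ℕ) : ℂ))) ^ n) •
      boson N ħ β lam (J m) (-(n : ℤ))) = Algebra.lmul ℂ (Fock N) φ := by
    intro n
    rw [PowerSeries.coeff_mk]
    split_ifs with hn
    · exact ⟨0, by rw [map_zero]⟩
    · exact ⟨_, hA n hn⟩
  have h1 := isExp_expSeries (A := PowerSeries.mk fun n : ℕ =>
      if n = 0 then 0 else ∑ m : Fin a, ((c * pPow ħ β (-((m : ℕ) : ℂ))) ^ n) •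
      boson N ħ β lam (J m) (-(n : ℤ))) (by simp) fun m n => by
    obtain ⟨φ, hφ⟩ := hc m
    obtain ⟨ψ, hψ⟩ := hc n
    rw [hφ, hψ, Commute, SemiconjBy, ← map_mul, ← map_mul, mul_comm]
  refine h1.unique (((isExp_cre N ħ β c (univ.image J)).map (Algebra.lmul ℂ (Fock N))).congr
    fun n hn => ?_)
  rw [PowerSeries.coeff_map, PowerSeries.coeff_mk, PowerSeries.coeff_mk, if_neg hn]
  exact (hA n hn).symm

theorem annihilationPart_eq (c : ℂ) {a : ℕ} {J : Fin a → Fin N} (hJ : StrictMono J) :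
    annihilationPart N ħ β lam J (fun m => c * pPow ħ β (-((m : ℕ) : ℂ))) =
      annOp N ħ β lam c (univ.image J) := by
  have h1 := isExp_expSeries (A := PowerSeries.mk fun n : ℕ =>
      if n = 0 then 0 else ∑ m : Fin a, ((c * pPow ħ β (-((m : ℕ) : ℂ))) ^ (-(n : ℤ))) •
      boson N ħ β lam (J m) (n : ℤ)) (by simp) fun m n => by
    rw [PowerSeries.coeff_mk, PowerSeries.coeff_mk]
    split_ifs with hm hn hn
    · exact Commute.zero_left _
    · exact Commute.zero_left _
    · exact Commute.zero_right _
    · obtain ⟨k, rfl⟩ := Nat.exists_eq_succ_of_ne_zero hm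
      obtain ⟨l, rfl⟩ := Nat.exists_eq_succ_of_ne_zero hn
      exact Commute.sum_left _ _ _ fun x _ => Commute.sum_right _ _ _ fun y _ =>
        ((show Commute _ _ from boson_pos_commute N ħ β lam (J x) (J y) k l).smul_left
          _).smul_right _
  refine h1.unique ((isExp_annOp N ħ β lam c (univ.image J)).congr fun n hn => ?_)
  rw [PowerSeries.coeff_mk, PowerSeries.coeff_mk, if_neg hn]
  simp only [site]
  rw [sum_image_rk N hJ fun d m => (c * pPow ħ β (-(m : ℂ)))⁻¹ ^ n • boson N ħ β lam d (n : ℤ)]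
  refine sum_congr rfl fun m _ => ?_
  rw [zpow_neg, zpow_natCast, inv_pow]

theorem exists_image (S : Finset (Fin N)) :
    ∃ J : Fin #S → Fin N, StrictMono J ∧ univ.image J = S :=
  ⟨S.orderEmbOfFin rfl, (S.orderEmbOfFin rfl).strictMono, by
    apply coe_injective; simp⟩

theorem lowers_annOp (c : ℂ) (S : Finset (Fin N)) (s : ℕ) :
    Lowers s (PowerSeries.coeff s (annOp N ħ β lam c S)) := by
  obtain ⟨J, hJ, hS⟩ := exists_image N S
  have := lowers_annihilationPart N ħ β lam J (fun m => c * pPow ħ β (-((m : ℕ) : ℂ))) s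
  rwa [annihilationPart_eq N ħ β lam c hJ, hS] at this

/-- The mode of a normal ordered product in terms of the set of its indices. -/
def setMode (c : ℂ) (S : Finset (Fin N)) (n : ℤ) (v : Fock N) : Fock N :=
  zeroFactor N ħ β lam S • ∑ᶠ s : ℕ, zcoeff ((s : ℤ) - n) (cre N ħ β c S) *
    PowerSeries.coeff s (annOp N ħ β lam c S) v

theorem normalOrderedMode_eq (c : ℂ) {a : ℕ} {J : Fin a → Fin N} (hJ : StrictMono J) (n : ℤ)
    (v : Fock N) :
    normalOrderedMode N ħ β lam J (fun m => c * pPow ħ β (-((m : ℕ) : ℂ))) n v =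
      setMode N ħ β lam c (univ.image J) n v := by
  have e1 : ∏ m : Fin a, zeroModeFactor N ħ β lam (J m) =
      zeroFactor N ħ β lam (univ.image J) := by
    rw [zeroFactor, prod_image hJ.injective.injOn]
  have e2 : ∀ s : ℕ, normalOrderedTerm N ħ β lam J
      (fun m => c * pPow ħ β (-((m : ℕ) : ℂ))) n s v =
      zcoeff ((s : ℤ) - n) (cre N ħ β c (univ.image J)) *
        PowerSeries.coeff s (annOp N ħ β lam c (univ.image J)) v := by
    intro s
    rw [normalOrderedTerm, creationPart_eq N ħ β lam c hJ, annihilationPart_eq N ħ β lam c hJ, zcoeff]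
    simp only [sub_nonneg]
    split_ifs
    · rw [PowerSeries.coeff_map]; rfl
    · simp
  change (∏ m : Fin a, zeroModeFactor N ħ β lam (J m)) • ∑ᶠ s : ℕ, normalOrderedTerm N ħ β lam J
    (fun m => c * pPow ħ β (-((m : ℕ) : ℂ))) n s v = _
  simp only [e1, e2, setMode]

/-- The scale `p^{(a-1)/2}` of the arguments in `W^a`. -/
def wScale (a : ℕ) : ℂ := pPow ħ β (((a : ℂ) - 1) / 2)

theorem setMode_trivial {c : ℂ} {S : Finset (Fin N)} (h1 : cre N ħ β c S = 1)
    (h2 : annOp N ħ β lam c S = 1) (h3 : zeroFactor N ħ β lam S = 1) (n : ℤ) (v : Fock N) :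
    setMode N ħ β lam c S n v = if n = 0 then v else 0 := by
  rw [setMode, h1, h2, h3, one_smul, finsum_eq_single _ 0]
  · rw [PowerSeries.coeff_one, if_pos rfl, Module.End.one_apply, Nat.cast_zero, zero_sub, zcoeff]
    split_ifs with h h' h'
    · subst h'; simp
    · rw [PowerSeries.coeff_one, if_neg (by omega), zero_mul]
    · omega
    · rw [zero_mul]
  · intro s hs
    rw [PowerSeries.coeff_one, if_neg hs, LinearMap.zero_apply, mul_zero]

theorem rk_univ (d : Fin N) : rk univ d = (d : ℕ) := by
  have := rk_image (J := (id : Fin N → Fin N)) strictMono_id d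
  rwa [image_id] at this

/-- In the full set the ranks are `0, …, N - 1`, so the exponent is a multiple of the linear
relation between the bosons and vanishes. -/
theorem cre_univ (hN : 0 < N) (c : ℂ) : cre N ħ β c univ = 1 := by
  refine (isExp_cre N ħ β c univ).unique (isExp_zero.congr fun n hn => ?_)
  rw [PowerSeries.coeff_mk, map_zero]
  obtain ⟨k, rfl⟩ := Nat.exists_eq_succ_of_ne_zero hn
  have h := congrArg (fun y => (c ^ (k + 1) * pPow ħ β ((k : ℂ) + 1)) • y)
    (creationVar_sum N hN ħ β k)
  simp only [smul_zero, smul_sum, smul_smul] at h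
  rw [← h]
  refine sum_congr rfl fun d _ => ?_
  rw [site, rk_univ, mul_pow, ← pPow_nat_mul, mul_assoc, ← pPow_add]
  change _ = (c ^ (k + 1) * _) • creationVar N ħ β d k
  congr 3
  push_cast
  ring

theorem annOp_univ (hlam : ∑ i, lam i = 0) {c : ℂ} : annOp N ħ β lam c univ = 1 := by
  refine (isExp_annOp N ħ β lam c univ).unique (isExp_zero.congr fun n hn => ?_)
  rw [PowerSeries.coeff_mk, map_zero]
  have h := congrArg (fun y => (c⁻¹ ^ n * pPow ħ β (-(n : ℂ))) • y) (boson_sum N ħ β lam hlam n)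
  simp only [smul_zero, smul_sum, smul_smul] at h
  rw [← h]
  refine sum_congr rfl fun d _ => ?_
  rw [site, rk_univ, mul_inv, mul_pow, ← pPow_neg, ← pPow_nat_mul, mul_assoc, ← pPow_add]
  congr 3
  push_cast
  ring

theorem zeroFactor_univ (hlam : ∑ i, lam i = 0) : zeroFactor N ħ β lam univ = 1 := by
  rw [zeroFactor]
  simp only [zeroModeFactor, pPow, ← Complex.exp_add]
  rw [← Complex.exp_sum, sum_add_distrib, ← mul_sum, ← mul_sum, hlam, ← sum_mul]
  have : ∑ i : Fin N, (((N : ℂ) + 1) / 2 - ((i : ℕ) + 1)) = 0 := by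
    rw [Fin.sum_univ_eq_sum_range (fun i : ℕ => ((N : ℂ) + 1) / 2 - ((i : ℂ) + 1)) N]
    have h : ∀ n : ℕ, ∑ i ∈ range n, (((N : ℂ) + 1) / 2 - ((i : ℂ) + 1)) =
        n * (((N : ℂ) + 1) / 2) - n * (n + 1) / 2 := by
      intro n
      induction n with
      | zero => simp
      | succ n ih => rw [sum_range_succ, ih]; push_cast; ring
    rw [h]; ring
  rw [this]; simp

/-- The subset formula also covers the conventions: the empty and the full set give the identity,
and for `a > N` there are no subsets. Hence `W^0`, `W^N` and vanishing currents need no separate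
treatment afterwards. -/
theorem W_eq (hN : 2 ≤ N) (hlam : ∑ i, lam i = 0) (a : ℕ) (n : ℤ) (v : Fock N) :
    W N ħ β lam a n v =
      ∑ S ∈ powersetCard a univ, setMode N ħ β lam (wScale ħ β a) S n v := by
  classical
  rw [W]
  by_cases h0 : (a : ℤ) = 0 ∨ (a : ℤ) = N
  · rw [if_pos h0]
    have key : ∑ S ∈ powersetCard a univ, setMode N ħ β lam (wScale ħ β a) S n v =
        if n = 0 then v else 0 := by
      rcases h0 with h0 | h0
      · obtain rfl : a = 0 := by omega
        rw [powersetCard_zero, sum_singleton]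
        exact setMode_trivial N ħ β lam (by simp [cre]) (by rw [annOp, ann, prod_empty, map_one]) (by simp [zeroFactor])
          n v
      · obtain rfl : a = N := by omega
        have : powersetCard a (univ : Finset (Fin a)) = {univ} := by
          have := powersetCard_self (univ : Finset (Fin a))
          rwa [card_univ, Fintype.card_fin] at this
        rw [this, sum_singleton]
        exact setMode_trivial a ħ β lam (cre_univ a ħ β (by omega) _) (annOp_univ a ħ β lam hlam)
          (zeroFactor_univ a ħ β lam hlam) n v
    rw [key]
    split_ifs <;> rfl
  · rw [if_neg h0]
    split_ifs with h1
    · rw [LinearMap.sum_apply, ← sum_strictMono a fun S => setMode N ħ β lam (wScale ħ β a) S n v]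
      refine sum_congr rfl fun J hJ => ?_
      have hJ := (mem_filter.1 hJ).2
      rw [← normalOrderedMode_eq N ħ β lam (wScale ħ β a) hJ n v]
      have : (fun m : Fin a => pPow ħ β ((((a : ℤ) : ℂ) - 1) / 2 - (m : ℕ))) =
          fun m : Fin a => wScale ħ β a * pPow ħ β (-((m : ℕ) : ℂ)) := by
        funext m
        rw [wScale, ← pPow_add, Int.cast_natCast, sub_eq_add_neg]
      exact congrArg (fun r => normalOrderedMode N ħ β lam (a := a) J r n v) this
    · rw [powersetCard_eq_empty.2 (by rw [card_univ, Fintype.card_fin]; omega), sum_empty]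
      rfl

end Fock
end DWA
end

noncomputable section
namespace DWA
open Finset PowerSeries

/-! ## Products of two currents -/

/-- Commutation with `a` acts as a derivation, and it sends the exponent to the scalar `c` in degree
`n`; on the exponential it is therefore multiplication by `c zⁿ`. -/
theorem IsExp.mul_zcoeff {R : Type*} [Ring R] [Algebra ℂ R] {x E : PowerSeries R} (hE : IsExp x E)
    {a : R} {c : ℂ} {n : ℕ} (hn : n ≠ 0)
    (h : ∀ k, k ≠ 0 → a * coeff k x = coeff k x * a + if k = n then algebraMap ℂ R c else 0)
    (s : ℤ) : a * zcoeff s E = zcoeff s E * a + c • zcoeff (s - n) E := by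
  rcases lt_or_ge s 0 with hs | hs
  · rw [zcoeff_of_neg hs, zcoeff_of_neg (by omega)]; simp
  obtain ⟨s, rfl⟩ := Int.eq_ofNat_of_zero_le hs
  induction s using Nat.strong_induction_on with
  | _ s ih =>
  rcases Nat.eq_zero_or_pos s with rfl | hpos
  · rw [zcoeff_natCast, hE.coeff_zero, zcoeff_of_neg (by omega)]; simp
  have e1 := hE.zcoeff_eq (M := s + n + 1) (t := s) (by push_cast; omega)
  have e2 := hE.zcoeff_eq (M := s + n + 1) (t := s - n) (by push_cast; omega)
  have hs0 : ((s : ℤ) : ℂ) ≠ 0 := by exact_mod_cast hpos.ne'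
  have key : ((s : ℤ) : ℂ) • (a * zcoeff s E) =
      ((s : ℤ) : ℂ) • (zcoeff s E * a + c • zcoeff (s - n) E) := by
    rw [← mul_smul_comm, smul_add, ← smul_mul_assoc, e1, mul_sum, sum_mul]
    have e3 : ∀ k ∈ range (s + n + 1), a * ((k : ℂ) • (coeff k x * zcoeff ((s : ℤ) - k) E)) =
        (k : ℂ) • (coeff k x * zcoeff ((s : ℤ) - k) E) * a +
        (c • ((k : ℂ) • (coeff k x * zcoeff (((s : ℤ) - n) - k) E)) +
        if k = n then ((n : ℂ) * c) • zcoeff ((s : ℤ) - n) E else 0) := by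
      intro k _
      rcases Nat.eq_zero_or_pos k with rfl | hk
      · simp [Ne.symm hn]
      have ih' : a * zcoeff ((s : ℤ) - k) E =
          zcoeff ((s : ℤ) - k) E * a + c • zcoeff ((s : ℤ) - k - n) E := by
        rcases le_or_gt k s with hks | hks
        · have := ih (s - k) (by omega) (by omega)
          rwa [Nat.cast_sub hks] at this
        · rw [zcoeff_of_neg (by omega), zcoeff_of_neg (by omega)]; simp
      rw [mul_smul_comm, ← mul_assoc, h k hk.ne', add_mul, mul_assoc, ih', sub_right_comm,
        mul_add, smul_add, smul_add, mul_smul_comm, smul_comm (k : ℂ) c, smul_mul_assoc, mul_assoc,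
        add_assoc]
      congr 2
      split_ifs with hkn
      · rw [hkn, ← Algebra.smul_def, smul_smul]
      · rw [zero_mul, smul_zero]
    rw [sum_congr rfl e3, sum_add_distrib, sum_add_distrib, ← smul_sum, ← e2, sum_ite_eq',
      if_pos (mem_range.2 (by omega)), smul_smul, smul_smul, ← add_smul]
    congr 2
    push_cast
    ring
  exact (smul_right_injective _ hs0) key

section Fock

variable (N : ℕ) (ħ β : ℂ) (lam : Fin N → ℂ)

/-- The scalar series which results from normal ordering the product of the currents of the index
sets `S` and `T`. -/
def contraction (c₁ : ℂ) (S : Finset (Fin N)) (c₂ : ℂ) (T : Finset (Fin N)) : PowerSeries ℂ :=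
  expSeries (PowerSeries.mk fun n => ∑ d ∈ S, ∑ e ∈ T,
    (site N ħ β c₁ S d)⁻¹ ^ n * site N ħ β c₂ T e ^ n * comm N ħ β d e n)

theorem isExp_contraction (c₁ : ℂ) (S : Finset (Fin N)) (c₂ : ℂ) (T : Finset (Fin N)) :
    IsExp (PowerSeries.mk fun n => ∑ d ∈ S, ∑ e ∈ T,
      (site N ħ β c₁ S d)⁻¹ ^ n * site N ħ β c₂ T e ^ n * comm N ħ β d e n)
      (contraction N ħ β c₁ S c₂ T) :=
  isExp_expSeries_comm (by simp [comm])

/-- The creation part, as a series of operators. -/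
def creOp (c : ℂ) (S : Finset (Fin N)) : PowerSeries (Module.End ℂ (Fock N)) :=
  PowerSeries.map (Algebra.lmul ℂ (Fock N) : Fock N →+* Module.End ℂ (Fock N)) (cre N ħ β c S)

theorem isExp_creOp (c : ℂ) (S : Finset (Fin N)) :
    IsExp (PowerSeries.mk fun n => ∑ d ∈ S, site N ħ β c S d ^ n •
      Algebra.lmul ℂ (Fock N) (creGen N ħ β d n)) (creOp N ħ β c S) := by
  refine ((isExp_cre N ħ β c S).map (Algebra.lmul ℂ (Fock N))).congr fun n _ => ?_
  simp only [PowerSeries.coeff_map, PowerSeries.coeff_mk, RingHom.coe_coe, map_sum, map_smul]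

theorem boson_mul_creGen (d e : Fin N) {n k : ℕ} (hn : n ≠ 0) (hk : k ≠ 0) :
    boson N ħ β lam d (n : ℤ) * Algebra.lmul ℂ (Fock N) (creGen N ħ β e k) =
      Algebra.lmul ℂ (Fock N) (creGen N ħ β e k) * boson N ħ β lam d (n : ℤ) +
      if k = n then algebraMap ℂ _ (comm N ħ β d e n) else 0 := by
  obtain ⟨n, rfl⟩ := Nat.exists_eq_succ_of_ne_zero hn
  obtain ⟨k, rfl⟩ := Nat.exists_eq_succ_of_ne_zero hk
  refine LinearMap.ext fun v => ?_
  have h := boson_pos_apply_mul N ħ β lam d e n k v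
  refine h.trans ?_
  rw [LinearMap.add_apply]
  congr 1
  by_cases hkn : k = n
  · subst hkn
    rw [if_pos rfl, if_pos rfl]
    rfl
  · rw [if_neg (Ne.symm hkn), if_neg (by omega), zero_smul, LinearMap.zero_apply]

theorem annOp_mul_creOp (c₁ : ℂ) (S : Finset (Fin N)) (c₂ : ℂ) (T : Finset (Fin N)) {M : ℕ} {t : ℤ}
    (ht : t < M) (s : ℤ) :
    zcoeff t (annOp N ħ β lam c₁ S) * zcoeff s (creOp N ħ β c₂ T) =
      ∑ e ∈ range M, coeff e (contraction N ħ β c₁ S c₂ T) •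
        (zcoeff (s - e) (creOp N ħ β c₂ T) * zcoeff (t - e) (annOp N ħ β lam c₁ S)) := by
  refine (isExp_annOp N ħ β lam c₁ S).exchange (isExp_contraction N ħ β c₁ S c₂ T)
    (fun n s hn => ?_) ht s
  refine (isExp_creOp N ħ β c₂ T).mul_zcoeff hn (fun k hk => ?_) s
  simp only [coeff_mk, sum_mul, mul_sum, smul_mul_smul_comm, boson_mul_creGen N ħ β lam _ _ hn hk,
    smul_add, sum_add_distrib]
  congr 1
  · rw [sum_comm]
    refine sum_congr rfl fun e _ => sum_congr rfl fun d _ => ?_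
    rw [mul_comm]
  · split_ifs with h
    · subst h
      rw [sum_comm, map_sum]
      refine sum_congr rfl fun d _ => ?_
      rw [map_sum]
      refine sum_congr rfl fun e _ => ?_
      rw [Algebra.smul_def, ← map_mul]
    · simp

theorem lowers_zcoeff_annOp (c : ℂ) (S : Finset (Fin N)) {d : ℤ} {t : ℤ} {v : Fock N}
    (hv : v ∈ deg N d) : zcoeff t (annOp N ħ β lam c S) v ∈ deg N (d - t) := by
  rcases lt_or_ge t 0 with ht | ht
  · rw [zcoeff_of_neg ht]; exact Submodule.zero_mem _
  · obtain ⟨t, rfl⟩ := Int.eq_ofNat_of_zero_le ht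
    rw [zcoeff_natCast]
    exact lowers_annOp N ħ β lam c S t d v hv

theorem eq_zero_of_mem_deg {d : ℤ} {v : Fock N} (hv : v ∈ deg N d) (hd : d < 0) : v = 0 := by
  rwa [deg_neg hd, Submodule.mem_bot] at hv

theorem coeff_annOp_eq_zero (c : ℂ) (S : Finset (Fin N)) {d : ℤ} {t : ℕ} {v : Fock N}
    (hv : v ∈ deg N d) (h : d < t) : coeff t (annOp N ħ β lam c S) v = 0 :=
  eq_zero_of_mem_deg N (lowers_annOp N ħ β lam c S t d v hv) (by omega)

theorem setMode_eq_sum (c : ℂ) (S : Finset (Fin N)) (n : ℤ) {v : Fock N} {B : ℕ}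
    (h : ∀ s : ℕ, B ≤ s → coeff s (annOp N ħ β lam c S) v = 0) :
    setMode N ħ β lam c S n v = zeroFactor N ħ β lam S • ∑ s ∈ range B,
      zcoeff ((s : ℤ) - n) (cre N ħ β c S) * coeff s (annOp N ħ β lam c S) v := by
  rw [setMode, finsum_eq_sum_of_support_subset]
  intro s hs
  rw [coe_range, Set.mem_Iio]
  by_contra h'
  exact hs (by simp only [h s (not_lt.1 h'), mul_zero])

theorem sum_range_sub_eq {M : Type*} [AddCommMonoid M] {B : ℕ} (e : ℕ) (G : ℤ → M)
    (hneg : ∀ z, z < 0 → G z = 0) (hbig : ∀ z, (B : ℤ) ≤ z + e → G z = 0) :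
    ∑ t ∈ range B, G ((t : ℤ) - e) = ∑ t ∈ range B, G t := by
  have h1 := sum_range_add (fun t : ℕ => G ((t : ℤ) - e)) B e
  have h2 := sum_range_add (fun t : ℕ => G ((t : ℤ) - e)) e B
  rw [add_comm e B, h1] at h2
  rw [sum_eq_zero (s := range e) fun k _ => hbig _ (by push_cast; omega), add_zero,
    sum_eq_zero (s := range e) fun k hk => hneg _ (by have := mem_range.1 hk; omega), zero_add] at h2
  rw [h2]
  refine sum_congr rfl fun t _ => ?_
  congr 1
  push_cast
  ring

theorem sum_range_shift {M : Type*} [AddCommMonoid M] (B : ℕ) (F : ℤ → ℕ → ℕ → M)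
    (hneg : ∀ z s e, z < 0 → F z s e = 0) (hbig : ∀ (z : ℤ) (s e : ℕ), (B : ℤ) ≤ z + e → F z s e = 0) :
    ∑ t ∈ range B, ∑ s ∈ range B, ∑ e ∈ range B, F ((t : ℤ) - e) s e =
      ∑ e ∈ range B, ∑ t ∈ range B, ∑ s ∈ range B, F t s e := by
  have h1 : ∑ e ∈ range B, ∑ t ∈ range B, ∑ s ∈ range B, F t s e =
      ∑ s ∈ range B, ∑ e ∈ range B, ∑ t ∈ range B, F t s e := by
    rw [sum_comm]
    exact (sum_congr rfl fun t _ => sum_comm).trans (sum_comm.trans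
      (sum_congr rfl fun s _ => sum_comm))
  rw [h1, sum_comm]
  refine sum_congr rfl fun s _ => ?_
  rw [sum_comm]
  exact sum_congr rfl fun e _ => sum_range_sub_eq e (fun z => F z s e) (fun z hz => hneg z s e hz)
    fun z hz => hbig z s e hz

theorem zcoeff_creOp (c : ℂ) (S : Finset (Fin N)) (s : ℤ) (v : Fock N) :
    zcoeff s (creOp N ħ β c S) v = zcoeff s (cre N ħ β c S) * v := by
  rw [creOp, zcoeff_map]; rfl

/-- On a vector of degree at most `d` a nonzero term has annihilation degrees with `t + s ≤ d`, and
its creation degree `s - m - e` is nonnegative, so `e ≤ d - m`. The two conditions on `B` therefore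
make all sums finite without loss. -/
theorem setMode_setMode (c₁ : ℂ) (S : Finset (Fin N)) (c₂ : ℂ) (T : Finset (Fin N)) (n m : ℤ)
    {d : ℕ} {v : Fock N} (hv : v ∈ deg N d) {B : ℕ} (hd : d < B) (hdm : (d : ℤ) - m < B) :
    setMode N ħ β lam c₁ S n (setMode N ħ β lam c₂ T m v) =
      (zeroFactor N ħ β lam S * zeroFactor N ħ β lam T) • ∑ e ∈ range B, ∑ t ∈ range B,
        ∑ s ∈ range B, coeff e (contraction N ħ β c₁ S c₂ T) •
          (zcoeff ((t : ℤ) + e - n) (cre N ħ β c₁ S) * zcoeff ((s : ℤ) - m - e) (cre N ħ β c₂ T) *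
            coeff t (annOp N ħ β lam c₁ S) (coeff s (annOp N ħ β lam c₂ T) v)) := by
  have hT : ∀ s : ℕ, B ≤ s → coeff s (annOp N ħ β lam c₂ T) v = 0 := fun s hs =>
    coeff_annOp_eq_zero N ħ β lam c₂ T hv (by omega)
  have hlow : ∀ (z : ℤ) (s : ℕ), (d : ℤ) < z + s →
      zcoeff z (annOp N ħ β lam c₁ S) (coeff s (annOp N ħ β lam c₂ T) v) = 0 := fun z s hz =>
    eq_zero_of_mem_deg N (lowers_zcoeff_annOp N ħ β lam c₁ S
      (lowers_annOp N ħ β lam c₂ T s d v hv)) (by omega)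
  have hex : ∀ (t s M : ℕ), t < M → coeff t (annOp N ħ β lam c₁ S)
      (zcoeff ((s : ℤ) - m) (cre N ħ β c₂ T) * coeff s (annOp N ħ β lam c₂ T) v) =
      ∑ e ∈ range M, coeff e (contraction N ħ β c₁ S c₂ T) •
        (zcoeff ((s : ℤ) - m - e) (cre N ħ β c₂ T) * zcoeff ((t : ℤ) - e) (annOp N ħ β lam c₁ S)
          (coeff s (annOp N ħ β lam c₂ T) v)) := by
    intro t s M ht
    have := LinearMap.congr_fun (annOp_mul_creOp N ħ β lam c₁ S c₂ T (t := t) (M := M)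
      (by exact_mod_cast ht) ((s : ℤ) - m)) (coeff s (annOp N ħ β lam c₂ T) v)
    rw [Module.End.mul_apply, zcoeff_creOp, zcoeff_natCast] at this
    rw [this, LinearMap.sum_apply]
    refine sum_congr rfl fun e _ => ?_
    rw [LinearMap.smul_apply, Module.End.mul_apply, zcoeff_creOp]
  rw [setMode_eq_sum N ħ β lam c₂ T m hT, setMode_eq_sum N ħ β lam c₁ S n (B := B), mul_smul]
  · congr 1
    have : ∀ t ∈ range B, zcoeff ((t : ℤ) - n) (cre N ħ β c₁ S) * coeff t (annOp N ħ β lam c₁ S)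
        (zeroFactor N ħ β lam T • ∑ s ∈ range B,
          zcoeff ((s : ℤ) - m) (cre N ħ β c₂ T) * coeff s (annOp N ħ β lam c₂ T) v) =
        zeroFactor N ħ β lam T • ∑ s ∈ range B, ∑ e ∈ range B,
          coeff e (contraction N ħ β c₁ S c₂ T) •
          (zcoeff ((t : ℤ) - e + e - n) (cre N ħ β c₁ S) * zcoeff ((s : ℤ) - m - e) (cre N ħ β c₂ T) *
            zcoeff ((t : ℤ) - e) (annOp N ħ β lam c₁ S) (coeff s (annOp N ħ β lam c₂ T) v)) := by
      intro t ht
      rw [map_smul, map_sum, mul_smul_comm, mul_sum]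
      congr 1
      refine sum_congr rfl fun s _ => ?_
      rw [hex t s B (mem_range.1 ht), mul_sum]
      refine sum_congr rfl fun e _ => ?_
      rw [mul_smul_comm, sub_add_cancel, mul_assoc]
    rw [sum_congr rfl this, ← smul_sum]
    refine congrArg _ ?_
    refine (sum_range_shift B (fun z s e => coeff e (contraction N ħ β c₁ S c₂ T) •
          (zcoeff (z + e - n) (cre N ħ β c₁ S) * zcoeff ((s : ℤ) - m - e) (cre N ħ β c₂ T) *
            -- The sum is written in terms of the annihilation degree `z = t - e` left after
            -- contraction. Replacing `z` by an unshifted index is harmless, since nonzero terms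
            -- satisfy `0 ≤ z` and `z + e < B`.
            zcoeff z (annOp N ħ β lam c₁ S) (coeff s (annOp N ħ β lam c₂ T) v))) ?_ ?_).trans ?_
    · intro z s e hz
      rw [zcoeff_of_neg hz, LinearMap.zero_apply, mul_zero, smul_zero]
    · intro z s e hz
      by_cases h : (s : ℤ) - m - e < 0
      · rw [zcoeff_of_neg h, mul_zero, zero_mul, smul_zero]
      · rw [hlow z s (by omega), mul_zero, smul_zero]
    · simp only [zcoeff_natCast]
  · intro t ht
    rw [map_smul, map_sum, sum_eq_zero, smul_zero]
    intro s _
    rw [hex t s (t + 1) (by omega)]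
    refine sum_eq_zero fun e _ => ?_
    by_cases h : (s : ℤ) - m - e < 0
    · rw [zcoeff_of_neg h, zero_mul, smul_zero]
    · rw [hlow _ s (by omega), mul_zero, smul_zero]

theorem W_apply_eq_zero (hN : 2 ≤ N) (hlam : ∑ i, lam i = 0) (a : ℕ) {n : ℤ} {d : ℕ} {v : Fock N}
    (hv : v ∈ deg N d) (h : d < n) : W N ħ β lam a n v = 0 := by
  rw [W_eq N ħ β lam hN hlam]
  refine sum_eq_zero fun S _ => ?_
  rw [setMode_eq_sum N ħ β lam _ S n (B := d + 1) fun s hs =>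
    coeff_annOp_eq_zero N ħ β lam _ S hv (by omega), sum_eq_zero, smul_zero]
  intro s hs
  rw [zcoeff_of_neg (by have := mem_range.1 hs; omega), zero_mul]

/-- The mode of the product of the normal ordered currents of `S` and `T` with the scalar kernel
`φ`. -/
def pairMode (φ : PowerSeries ℂ) (B : ℕ) (c₁ : ℂ) (S : Finset (Fin N)) (c₂ : ℂ)
    (T : Finset (Fin N)) (n m : ℤ) (v : Fock N) : Fock N :=
  (zeroFactor N ħ β lam S * zeroFactor N ħ β lam T) • ∑ e ∈ range B, ∑ t ∈ range B,
    ∑ s ∈ range B, coeff e φ •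
      (zcoeff ((t : ℤ) + e - n) (cre N ħ β c₁ S) * zcoeff ((s : ℤ) - m - e) (cre N ħ β c₂ T) *
        coeff t (annOp N ħ β lam c₁ S) (coeff s (annOp N ħ β lam c₂ T) v))

/-- The index of the structure function shifts the modes in the same way as the degree of the
contraction, so the two series combine into their product. -/
theorem fWW_eq (hN : 2 ≤ N) (hlam : ∑ i, lam i = 0) (a b : ℕ) (n m : ℤ) {d : ℕ} {v : Fock N}
    (hv : v ∈ deg N d) {B : ℕ} (hd : d < B) (hdm : (d : ℤ) - m < B) :
    fWW N ħ β lam a b n m v = ∑ S ∈ powersetCard a univ, ∑ T ∈ powersetCard b univ,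
      pairMode N ħ β lam (f N ħ β a b * contraction N ħ β (wScale ħ β a) S (wScale ħ β b) T) B
        (wScale ħ β a) S (wScale ħ β b) T n m v := by
  rw [fWW, finsum_eq_sum_of_support_subset (s := range B)]
  · have : ∀ l ∈ range B, coeff l (f N ħ β a b) •
        W N ħ β lam a (n - l) (W N ħ β lam b (m + l) v) =
        ∑ S ∈ powersetCard a univ, ∑ T ∈ powersetCard b univ, coeff l (f N ħ β a b) •
          setMode N ħ β lam (wScale ħ β a) S (n - l)
            (setMode N ħ β lam (wScale ħ β b) T (m + l) v) := by
      intro l _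
      rw [W_eq N ħ β lam hN hlam b, map_sum, sum_congr rfl fun T _ => W_eq N ħ β lam hN hlam a _ _,
        sum_comm, smul_sum]
      exact sum_congr rfl fun S _ => smul_sum
    rw [sum_congr rfl this, sum_comm]
    refine sum_congr rfl fun S _ => ?_
    rw [sum_comm]
    refine sum_congr rfl fun T _ => ?_
    rw [sum_congr rfl fun l _ => by
      rw [setMode_setMode N ħ β lam _ S _ T (n - l) (m + l) hv hd (by omega), smul_comm, smul_sum],
      ← smul_sum, pairMode]
    congr 1
    rw [sum_range_sum_range_eq_antidiagonal B]
    · refine sum_congr rfl fun L _ => ?_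
      rw [coeff_mul]
      simp only [smul_sum, sum_smul]
      rw [sum_comm]
      refine sum_congr rfl fun t _ => ?_
      rw [sum_comm]
      refine sum_congr rfl fun s _ => ?_
      refine sum_congr rfl fun x hx => ?_
      have hx := mem_antidiagonal.1 hx
      rw [smul_smul, show (t : ℤ) + x.2 - (n - x.1) = t + L - n by omega,
        show (s : ℤ) - (m + x.1) - x.2 = s - m - L by omega]
    · intro l e hle
      rw [smul_eq_zero_of_right]
      refine sum_eq_zero fun t _ => sum_eq_zero fun s _ => ?_
      by_cases h : (s : ℤ) - (m + l) - e < 0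
      · rw [zcoeff_of_neg h, mul_zero, zero_mul, smul_zero]
      · rw [coeff_annOp_eq_zero N ħ β lam _ T hv (by omega), map_zero, mul_zero, smul_zero]
  · intro l hl
    rw [coe_range, Set.mem_Iio]
    by_contra h
    exact hl (by simp only [W_apply_eq_zero N ħ β lam hN hlam b hv
      (show (d : ℤ) < m + l by omega), map_zero, smul_zero])

end Fock
end DWA
end

noncomputable section
namespace DWA
open Finset PowerSeries

/-! ## The structure functions cancel the common factors -/

section Kernel

variable (N : ℕ) (ħ β : ℂ)

theorem pPow_mul_natCast (x : ℂ) (n : ℕ) : pPow ħ β (x * n) = pPow ħ β x ^ n := by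
  rw [mul_comm, pPow_nat_mul]

theorem comm_eq_bracket (d e : Fin N) (n : ℕ) :
    comm N ħ β d e n = -((1 / (n : ℂ)) * (1 - qPar ħ ^ n) * (1 - (tPar ħ β)⁻¹ ^ n)) *
      (bracket (pPow ħ β 1 ^ n) (pPow ħ β N ^ n) d e / (1 - pPow ħ β N ^ n)) := by
  have hy : pPow ħ β (n : ℂ) = pPow ħ β 1 ^ n := by rw [← pPow_mul_natCast, one_mul]
  have hY : pPow ħ β ((N : ℂ) * n) = pPow ħ β N ^ n := pPow_mul_natCast ħ β _ _
  simp only [comm, bracket, Int.cast_natCast, zpow_natCast, zpow_neg, inv_pow, hY]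
  rcases eq_or_ne d e with rfl | h
  · simp only [if_true, lt_irrefl, if_false, mul_one, mul_zero, pPow_zero, sub_mul, one_mul]
    rw [sub_eq_add_neg ((N : ℂ) * n), pPow_add, pPow_neg, hY, hy]
    ring
  · simp only [if_neg h, mul_zero, zero_sub, neg_mul, one_mul, pPow_neg, hy, mul_ite, mul_one,
      apply_ite (pPow ħ β), pPow_zero, hY]
    split_ifs <;> ring

theorem f_comm (a b : ℤ) : f N ħ β a b = f N ħ β b a := by
  rw [f, f, min_comm, max_comm, abs_sub_comm]

theorem isExp_f {a b : ℕ} (hab : a ≤ b) :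
    IsExp (PowerSeries.mk fun n => (1 / (n : ℂ)) * (1 - qPar ħ ^ n) * (1 - (tPar ħ β)⁻¹ ^ n) *
      ((1 - (pPow ħ β 1 ^ n) ^ a) / (1 - pPow ħ β 1 ^ n) *
        ((1 - pPow ħ β N ^ n * (pPow ħ β 1 ^ n)⁻¹ ^ b) / (1 - pPow ħ β N ^ n)) *
        pPow ħ β (((b : ℂ) - a) / 2) ^ n)) (f N ħ β a b) := by
  refine (isExp_expSeries_comm (by simp)).congr fun n hn => ?_
  have hy : pPow ħ β (n : ℂ) = pPow ħ β 1 ^ n := by rw [← pPow_mul_natCast, one_mul]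
  have hY : pPow ħ β ((N : ℂ) * n) = pPow ħ β N ^ n := pPow_mul_natCast ħ β _ _
  have h1 : min (a : ℤ) b = a := min_eq_left (by omega)
  have h2 : max (a : ℤ) b = b := max_eq_right (by omega)
  have h3 : |(a : ℤ) - b| = b - a := by rw [abs_of_nonpos (by omega)]; ring
  have h4 : pPow ħ β ((a : ℂ) * n) = (pPow ħ β 1 ^ n) ^ a := by rw [pPow_nat_mul, hy]
  have h5 : pPow ħ β (((N : ℂ) - b) * n) = pPow ħ β N ^ n * (pPow ħ β 1 ^ n)⁻¹ ^ b := by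
    rw [sub_mul, sub_eq_add_neg, pPow_add, pPow_neg, hY, pPow_nat_mul, hy, inv_pow]
  rw [coeff_mk, coeff_mk, if_neg hn, h1, h2, h3]
  push_cast
  rw [h4, h5, hy, hY, pPow_mul_natCast]
  ring

theorem site_pow (c : ℂ) (S : Finset (Fin N)) (d : Fin N) (n : ℕ) :
    site N ħ β c S d ^ n = c ^ n * (pPow ħ β 1 ^ n)⁻¹ ^ rk S d := by
  have : pPow ħ β (-(rk S d : ℂ)) = (pPow ħ β 1)⁻¹ ^ rk S d := by
    rw [pPow_neg, inv_pow, ← pPow_mul_natCast, one_mul]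
  rw [site, mul_pow, this, inv_pow, inv_pow, inv_pow, ← pow_mul, ← pow_mul, mul_comm n]

variable {N ħ β}

theorem one_sub_pPow_pow_ne_zero (hp : ∀ n : ℕ, 0 < n → pPow ħ β n ≠ 1) {m n : ℕ} (hm : m ≠ 0)
    (hn : n ≠ 0) : 1 - pPow ħ β m ^ n ≠ 0 := by
  rw [← pPow_nat_mul, ← Nat.cast_mul, sub_ne_zero]
  exact (hp _ (Nat.pos_of_ne_zero (mul_ne_zero hn hm))).symm

/-- Both sides are exponentials, and the exponents agree in each degree by `sum_sum_bracket` at `y =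
pⁿ`, `Y = p^{Nn}`. The divisions are legitimate because `p` is not a root of unity. -/
theorem f_mul_contraction (hN : N ≠ 0) (hp : ∀ n : ℕ, 0 < n → pPow ħ β n ≠ 1)
    {S T : Finset (Fin N)} (hST : #S ≤ #T) {c₁ c₂ : ℂ}
    (hc : c₁⁻¹ * c₂ = pPow ħ β (((#T : ℂ) - #S) / 2)) :
    f N ħ β #S #T * contraction N ħ β c₁ S c₂ T = ∏ d ∈ S \ T,
      gSeries ħ β (pPow ħ β ((rk S d - rk T d : ℤ) : ℂ) * pPow ħ β (((#T : ℂ) - #S) / 2)) := by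
  refine ((isExp_f N ħ β hST).mul (isExp_contraction N ħ β c₁ S c₂ T)).unique
    ((IsExp.prod _ fun d _ => isExp_gSeries ħ β _).congr fun n hn => ?_)
  simp only [map_add, map_sum, coeff_mk, comm_eq_bracket, site_pow, inv_pow, mul_inv, inv_inv]
  have hy1 : 1 - pPow ħ β 1 ^ n ≠ 0 := by
    have := one_sub_pPow_pow_ne_zero hp (m := 1) (n := n) one_ne_zero hn
    rwa [Nat.cast_one] at this
  have hY1 := one_sub_pPow_pow_ne_zero hp hN hn
  have hy0 : pPow ħ β 1 ^ n ≠ 0 := pow_ne_zero _ (pPow_ne_zero _ _ _)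
  have hr : ∀ k : ℤ, pPow ħ β (k : ℂ) ^ n = (pPow ħ β 1 ^ n) ^ k := by
    intro k
    rw [pPow, pPow, ← Complex.exp_nat_mul, ← Complex.exp_nat_mul, ← Complex.exp_int_mul]
    congr 1; ring
  simp only [mul_pow, hr, zpow_sub₀ hy0, zpow_natCast]
  have hc' : (c₁ ^ n)⁻¹ * c₂ ^ n = pPow ħ β (((#T : ℂ) - #S) / 2) ^ n := by
    rw [← hc, mul_pow, inv_pow]
  set y := pPow ħ β 1 ^ n
  set Y := pPow ħ β N ^ n
  set r := pPow ħ β (((#T : ℂ) - #S) / 2) ^ n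
  set A := (1 / (n : ℂ)) * (1 - qPar ħ ^ n) * (1 - ((tPar ħ β) ^ n)⁻¹)
  have h := sum_sum_bracket y Y S T
  have e1 : ∑ d ∈ S, ∑ e ∈ T, (c₁ ^ n)⁻¹ * y ^ rk S d * (c₂ ^ n * (y ^ rk T e)⁻¹) *
      (-A * (bracket y Y d e / (1 - Y))) = -A * r / (1 - Y) *
      ∑ d ∈ S, ∑ e ∈ T, y ^ rk S d * y⁻¹ ^ rk T e * bracket y Y d e := by
    rw [← hc']
    simp only [mul_sum, inv_pow]
    exact sum_congr rfl fun d _ => sum_congr rfl fun e _ => by ring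
  have e2 : ∑ d ∈ S \ T, A * (y ^ rk S d / y ^ rk T d * r) =
      A * r * ∑ d ∈ S \ T, y ^ rk S d * y⁻¹ ^ rk T d := by
    simp only [mul_sum, inv_pow]
    exact sum_congr rfl fun d _ => by ring
  have e3 : ∑ k ∈ range #S, y ^ k = (1 - y ^ #S) / (1 - y) := by
    rw [eq_div_iff hy1, geom_sum_mul_neg]
  rw [e1, e2, h, e3, inv_pow]
  field_simp
  ring

/-- The arguments `(p c)⁻¹` are those of the expansions at infinity of the factors `g(c x)`
occurring in `f_mul_contraction`. -/
theorem f_mul_contraction_swap (hN : N ≠ 0) (hp : ∀ n : ℕ, 0 < n → pPow ħ β n ≠ 1)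
    {S T : Finset (Fin N)} (hST : #S ≤ #T) {c₁ c₂ : ℂ}
    (hc : c₁⁻¹ * c₂ = pPow ħ β (((#T : ℂ) - #S) / 2)) :
    f N ħ β #T #S * contraction N ħ β c₂ T c₁ S = ∏ d ∈ S \ T,
      gSeries ħ β (pPow ħ β 1 *
        (pPow ħ β ((rk S d - rk T d : ℤ) : ℂ) * pPow ħ β (((#T : ℂ) - #S) / 2)))⁻¹ := by
  rw [f_comm]
  refine ((isExp_f N ħ β hST).mul (isExp_contraction N ħ β c₂ T c₁ S)).unique
    ((IsExp.prod _ fun d _ => isExp_gSeries ħ β _).congr fun n hn => ?_)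
  simp only [map_add, map_sum, coeff_mk, comm_eq_bracket, site_pow, inv_pow, mul_inv, inv_inv]
  have hy1 : 1 - pPow ħ β 1 ^ n ≠ 0 := by
    have := one_sub_pPow_pow_ne_zero hp (m := 1) (n := n) one_ne_zero hn
    rwa [Nat.cast_one] at this
  have hY1 := one_sub_pPow_pow_ne_zero hp hN hn
  have hy0 : pPow ħ β 1 ^ n ≠ 0 := pow_ne_zero _ (pPow_ne_zero _ _ _)
  have hr : ∀ k : ℤ, pPow ħ β (k : ℂ) ^ n = (pPow ħ β 1 ^ n) ^ k := by
    intro k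
    rw [pPow, pPow, ← Complex.exp_nat_mul, ← Complex.exp_nat_mul, ← Complex.exp_int_mul]
    congr 1; ring
  simp only [mul_pow, inv_pow, hr, zpow_sub₀ hy0, zpow_natCast]
  have hr0 : pPow ħ β (((#T : ℂ) - #S) / 2) ^ n ≠ 0 := pow_ne_zero _ (pPow_ne_zero _ _ _)
  have hc' : (c₂ ^ n)⁻¹ * c₁ ^ n = (pPow ħ β (((#T : ℂ) - #S) / 2) ^ n)⁻¹ := by
    rw [← hc, mul_pow, inv_pow, mul_inv, inv_inv, mul_comm]
  -- The factor `p^{|i-j|n/2}` of the structure function is symmetric in the two currents, whereas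
  -- the contraction contains the inverse of the ratio of the scales; the discrepancy is this
  -- square.
  have hrr : (pPow ħ β (((#T : ℂ) - #S) / 2) ^ n) ^ 2 =
      (pPow ħ β 1 ^ n) ^ #T * ((pPow ħ β 1 ^ n) ^ #S)⁻¹ := by
    rw [← div_eq_mul_inv, ← zpow_natCast _ #T, ← zpow_natCast _ #S, ← zpow_sub₀ hy0, ← hr,
      ← pow_mul, mul_comm, pow_mul, ← pPow_nat_mul]
    congr 2; push_cast; ring
  set y := pPow ħ β 1 ^ n
  set Y := pPow ħ β N ^ n
  set r := pPow ħ β (((#T : ℂ) - #S) / 2) ^ n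
  set A := (1 / (n : ℂ)) * (1 - qPar ħ ^ n) * (1 - ((tPar ħ β) ^ n)⁻¹)
  have h := sum_sum_bracket_swap y Y hy0 S T
  have e1 : ∑ e ∈ T, ∑ d ∈ S, (c₂ ^ n)⁻¹ * y ^ rk T e * (c₁ ^ n * (y ^ rk S d)⁻¹) *
      (-A * (bracket y Y e d / (1 - Y))) = -A * r⁻¹ / (1 - Y) *
      ∑ e ∈ T, ∑ d ∈ S, y ^ rk T e * y⁻¹ ^ rk S d * bracket y Y e d := by
    rw [← hc']
    simp only [mul_sum, inv_pow]
    exact sum_congr rfl fun d _ => sum_congr rfl fun e _ => by ring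
  have e2 : ∑ d ∈ S \ T, A * (y⁻¹ * ((y ^ rk S d / y ^ rk T d)⁻¹ * r⁻¹)) =
      A * r⁻¹ * y⁻¹ * ∑ d ∈ S \ T, y⁻¹ ^ rk S d * y ^ rk T d := by
    simp only [mul_sum, inv_pow]
    exact sum_congr rfl fun d _ => by rw [inv_div]; ring
  have e3 : y⁻¹ * ∑ k ∈ range #S, y⁻¹ ^ k = (y ^ #S)⁻¹ * ((1 - y ^ #S) / (1 - y)) := by
    have : ∑ k ∈ range #S, y⁻¹ ^ k * (1 - y⁻¹) = 1 - y⁻¹ ^ #S := by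
      rw [← sum_mul, geom_sum_mul_neg]
    rw [← sum_mul] at this
    have h1 : 1 - y⁻¹ ≠ 0 := by
      intro h0; apply hy1
      have : y⁻¹ = 1 := (sub_eq_zero.1 h0).symm
      rw [inv_eq_one.1 this, sub_self]
    rw [← mul_left_inj' h1, mul_assoc, this, inv_pow]
    have hyS : y ^ #S ≠ 0 := pow_ne_zero _ hy0
    field_simp
    ring
  rw [e1, e2, h, mul_sub, ← mul_assoc y⁻¹, e3]
  have hyS : y ^ #S ≠ 0 := pow_ne_zero _ hy0
  have hyT : y ^ #T ≠ 0 := pow_ne_zero _ hy0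
  have hrr' : y ^ #T = r ^ 2 * y ^ #S := by rw [hrr]; field_simp
  rw [hrr']
  field_simp
  ring

end Kernel
end DWA
end

noncomputable section
namespace DWA
open Finset PowerSeries

/-! ## Normal ordered products with commuting factors -/

theorem zcoeff_mul {R : Type*} [Semiring R] (A B : PowerSeries R) {z : ℤ} {M : ℕ} (h : z < M) :
    zcoeff z (A * B) = ∑ s ∈ range M, coeff s A * zcoeff (z - s) B := by
  rcases lt_or_ge z 0 with hz | hz
  · rw [zcoeff_of_neg hz]
    exact (sum_eq_zero fun s _ => by rw [zcoeff_of_neg (by omega), mul_zero]).symm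
  obtain ⟨z, rfl⟩ := Int.eq_ofNat_of_zero_le hz
  rw [zcoeff_natCast, coeff_mul, Nat.sum_antidiagonal_eq_sum_range_succ_mk]
  have hsub : range (z + 1) ⊆ range M := range_subset_range.2 (by omega)
  rw [← sum_subset hsub]
  · refine sum_congr rfl fun s hs => ?_
    have := mem_range.1 hs
    rw [← Nat.cast_sub (by omega), zcoeff_natCast]
  · intro s _ hs
    have := mem_range.not.1 hs
    rw [zcoeff_of_neg (by omega), mul_zero]

theorem coeff_ofPowerSeries {R : Type*} [Semiring R] (A : PowerSeries R) (n : ℤ) :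
    (HahnSeries.ofPowerSeries ℤ R A).coeff n = zcoeff n A := by
  rcases lt_or_ge n 0 with hn | hn
  · rw [zcoeff_of_neg hn]
    exact (PowerSeries.coeff_coe A n).trans (if_pos hn)
  · obtain ⟨n, rfl⟩ := Int.eq_ofNat_of_zero_le hn
    rw [zcoeff_natCast, HahnSeries.ofPowerSeries_apply_coeff]

theorem sum_range_eq_finsum {M : Type*} [AddCommMonoid M] (Q : ℤ → M) (a : ℤ) (B : ℕ)
    (h : ∀ s, s < a ∨ a + B ≤ s → Q s = 0) : ∑ L ∈ range B, Q (a + L) = ∑ᶠ s, Q s := by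
  have hinj : Set.InjOn (fun L : ℕ => a + (L : ℤ)) (range B) := fun x _ y _ hxy => by
    simpa using hxy
  rw [finsum_eq_sum_of_support_subset (s := (range B).image fun L : ℕ => a + (L : ℤ)),
    sum_image hinj]
  intro s hs
  rw [coe_image, Set.mem_image]
  have h1 : ¬ (s < a ∨ a + B ≤ s) := fun h' => hs (h s h')
  exact ⟨(s - a).toNat, by rw [coe_range, Set.mem_Iio]; omega, by omega⟩

section Pair

/-- The part of total mode `tot` and of annihilation degree less than `B`, the coefficients of the
outer variable being the parts of given annihilation degree and those of the inner variable the
parts of given creation degree. -/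
def modePart {K : Type*} [CommRing K] (B : ℕ) (tot : ℤ) (Z : PowerSeries (PowerSeries K)) : K :=
  ∑ t ∈ range B, zcoeff ((t : ℤ) - tot) (coeff t Z)

section

variable {K S : Type*} [CommRing K] [CommRing S]

theorem zcoeff_add (k : ℤ) (A B : PowerSeries K) : zcoeff k (A + B) = zcoeff k A + zcoeff k B := by
  rw [zcoeff, zcoeff, zcoeff]; split_ifs <;> simp

theorem zcoeff_C_mul (k : ℤ) (a : K) (B : PowerSeries K) : zcoeff k (C a * B) = a * zcoeff k B := by
  rw [zcoeff, zcoeff]; split_ifs <;> simp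

theorem modePart_add (B : ℕ) (tot : ℤ) (Z Z' : PowerSeries (PowerSeries K)) :
    modePart B tot (Z + Z') = modePart B tot Z + modePart B tot Z' := by
  simp only [modePart, map_add, zcoeff_add, sum_add_distrib]

theorem modePart_zero (B : ℕ) (tot : ℤ) : modePart B tot (0 : PowerSeries (PowerSeries K)) = 0 := by
  refine sum_eq_zero fun t _ => ?_
  rw [map_zero, zcoeff]; split_ifs <;> simp

theorem modePart_sum {ι : Type*} (s : Finset ι) (B : ℕ) (tot : ℤ)
    (Z : ι → PowerSeries (PowerSeries K)) :
    modePart B tot (∑ x ∈ s, Z x) = ∑ x ∈ s, modePart B tot (Z x) := by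
  classical
  induction s using Finset.induction_on with
  | empty => rw [sum_empty, sum_empty, modePart_zero]
  | insert x s hx ih => rw [sum_insert hx, sum_insert hx, modePart_add, ih]

theorem modePart_C_mul (B : ℕ) (tot : ℤ) (a : K) (Z : PowerSeries (PowerSeries K)) :
    modePart B tot (C (C a) * Z) = a * modePart B tot Z := by
  simp only [modePart, coeff_C_mul, zcoeff_C_mul, mul_sum]

theorem Place.zcoeff (P : Place K S) {A : PowerSeries K} {A' : PowerSeries S}
    (h : P.powerSeries.rel A A') (k : ℤ) : P.rel (zcoeff k A) (DWA.zcoeff k A') := by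
  rw [DWA.zcoeff, DWA.zcoeff]
  split_ifs
  · exact h _
  · exact P.rel_zero

theorem Place.modePart (P : Place K S) {Z : PowerSeries (PowerSeries K)}
    {w : PowerSeries (PowerSeries S)} (h : P.powerSeries.powerSeries.rel Z w) (B : ℕ) (tot : ℤ) :
    P.rel (modePart B tot Z) (DWA.modePart B tot w) :=
  P.rel_sum _ fun t _ => P.zcoeff (h t) _

theorem Place.powerSeries_map_C (P : Place K S) {A : PowerSeries K} {A' : PowerSeries S}
    (h : P.powerSeries.rel A A') :
    P.powerSeries.powerSeries.rel (PowerSeries.map C A) (PowerSeries.map C A') := by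
  intro n
  rw [coeff_map, coeff_map]
  exact P.powerSeries_C (h n)

end

variable (N : ℕ) (ħ β : ℂ) (lam : Fin N → ℂ)

/-- A commutative algebra of normal ordered products of bosons, with its action on the Fock
space. -/
structure NormalOrdering (R : Type*) [CommRing R] [Algebra ℂ R] where
  /-- The creation operators. -/
  cr : Fock N →ₐ[ℂ] R
  /-- The annihilation operators. -/
  an : annihAlg N ħ β lam →ₐ[ℂ] R
  /-- The action on the vectors of the Fock space. -/
  act : Fock N → R →ₗ[ℂ] Fock N
  act_mul : ∀ v φ D, act v (cr φ * an D) = φ * (D : Module.End ℂ (Fock N)) v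

/-- In the tensor product creation and annihilation operators commute, their ordering having been
recorded in the scalar kernel. The action is only linear: it sends a normal ordered symbol to the
operator and applies that to `v`. -/
theorem exists_normalOrdering :
    Nonempty (NormalOrdering N ħ β lam (TensorProduct ℂ (Fock N) (annihAlg N ħ β lam))) := by
  refine ⟨⟨Algebra.TensorProduct.includeLeft, Algebra.TensorProduct.includeRight,
    fun v => TensorProduct.lift ((LinearMap.mul ℂ (Fock N)).compl₂
      ((LinearMap.applyₗ v).comp (annihAlg N ħ β lam).val.toLinearMap)), fun v φ D => ?_⟩⟩
  rw [Algebra.TensorProduct.includeLeft_apply, Algebra.TensorProduct.includeRight_apply,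
    Algebra.TensorProduct.tmul_mul_tmul, mul_one, one_mul, TensorProduct.lift.tmul]
  rfl

variable {N ħ β lam} {R : Type*} [CommRing R] [Algebra ℂ R] (O : NormalOrdering N ħ β lam R)

/-- The current of index `d` at the point `c X^k`. -/
def siteWeight (k : ℤ) (c : ℂ) (d : Fin N) : PowerSeries (PowerSeries (TwoSided R)) :=
  C (C (tsK (zeroModeFactor N ħ β lam d))) *
    C (rescale (tsK c * tsX k) (PowerSeries.map (tsC.comp (O.cr : Fock N →+* R))
      (creExp N ħ β d))) *
    PowerSeries.map C (rescale (tsK c⁻¹ * tsX (-k))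
      (PowerSeries.map (tsC.comp (O.an : annihAlg N ħ β lam →+* R)) (annExp N ħ β lam d)))

/-- The current of index `d` at the point `y`. -/
def siteValue (y : ℂ) (d : Fin N) : PowerSeries (PowerSeries R) :=
  C (C (algebraMap ℂ R (zeroModeFactor N ħ β lam d))) *
    C (rescale (algebraMap ℂ R y) (PowerSeries.map (O.cr : Fock N →+* R) (creExp N ħ β d))) *
    PowerSeries.map C (rescale (algebraMap ℂ R y⁻¹)
      (PowerSeries.map (O.an : annihAlg N ħ β lam →+* R) (annExp N ħ β lam d)))

theorem rel_siteWeight {x₀ : ℂ} (hx : x₀ ≠ 0) (k : ℤ) (c : ℂ) (d : Fin N) :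
    (placeAt R x₀ hx).powerSeries.powerSeries.rel (siteWeight O k c d)
      (siteValue O (c * x₀ ^ k) d) := by
  set P := placeAt R x₀ hx
  have hz : ∀ (c : ℂ) (k : ℤ), P.rel (tsK c * tsX k) (algebraMap ℂ R (c * x₀ ^ k)) := by
    intro c k
    rw [map_mul]
    exact P.rel_mul (placeAt_tsK hx c) (placeAt_tsX hx k)
  have hi : (c * x₀ ^ k)⁻¹ = c⁻¹ * x₀ ^ (-k) := by rw [mul_inv, zpow_neg]
  rw [siteValue, hi]
  refine P.powerSeries.powerSeries.rel_mul (P.powerSeries.powerSeries.rel_mul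
    (P.powerSeries.powerSeries_C (P.powerSeries_C (placeAt_tsK hx _)))
    (P.powerSeries.powerSeries_C (P.powerSeries_rescale (hz _ _) (P.powerSeries_map (fun r => ?_) _))))
    (P.powerSeries_map_C (P.powerSeries_rescale (hz _ _) (P.powerSeries_map (fun r => ?_) _)))
  · exact placeAt_tsC hx _
  · exact placeAt_tsC hx _

/-- The product of the currents of the indices in `S` at the points `c p^{-m} X^k`. -/
def setWeight (k : ℤ) (c : ℂ) (S : Finset (Fin N)) : PowerSeries (PowerSeries (TwoSided R)) :=
  C (C (tsK (zeroFactor N ħ β lam S))) *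
    C (rescale (tsX k) (PowerSeries.map (tsC.comp (O.cr : Fock N →+* R)) (cre N ħ β c S))) *
    PowerSeries.map C (rescale (tsX (-k))
      (PowerSeries.map (tsC.comp (O.an : annihAlg N ħ β lam →+* R)) (ann N ħ β lam c S)))

theorem rescale_map_rescale {A B : Type*} [CommRing A] [CommRing B] (φ : A →+* B) (x : B) (c : A)
    (F : PowerSeries A) : rescale x (PowerSeries.map φ (rescale c F)) =
      rescale (φ c * x) (PowerSeries.map φ F) := by
  ext n
  simp only [coeff_rescale, coeff_map, map_mul, map_pow, mul_pow]
  ring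

theorem prod_siteWeight (k : ℤ) (c : ℂ) (S : Finset (Fin N)) :
    ∏ d ∈ S, siteWeight O k (site N ħ β c S d) d = setWeight O k c S := by
  have h1 : ∀ c, (tsC.comp (O.cr : Fock N →+* R)) (algebraMap ℂ (Fock N) c) = tsK c := fun c => by
    rw [RingHom.comp_apply, RingHom.coe_coe, O.cr.commutes]; rfl
  have h2 : ∀ c, (tsC.comp (O.an : annihAlg N ħ β lam →+* R)) (algebraMap ℂ _ c) = tsK c :=
    fun c => by rw [RingHom.comp_apply, RingHom.coe_coe, O.an.commutes]; rfl
  simp only [siteWeight, setWeight, prod_mul_distrib, zeroFactor, cre, ann, map_prod,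
    rescale_map_rescale, h1, h2]

theorem coeff_coeff_setWeight (k : ℤ) (c : ℂ) (S : Finset (Fin N)) (s t : ℕ) :
    coeff s (coeff t (setWeight O k c S)) =
      tsC (algebraMap ℂ R (zeroFactor N ħ β lam S) * (O.cr (coeff s (cre N ħ β c S)) *
        O.an (coeff t (ann N ħ β lam c S)))) * tsX (k * (s - t)) := by
  have hpow : ∀ (k : ℤ) (n : ℕ), (tsX k : TwoSided R) ^ n = tsX (k * n) := by
    intro k n
    induction n with
    | zero => rw [pow_zero, Nat.cast_zero, mul_zero, tsX_zero]
    | succ n ih => rw [pow_succ, ih, tsX_mul]; congr 1; push_cast; ring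
  have e : k * ((s : ℤ) - t) = k * s + -k * t := by ring
  rw [setWeight, ← map_mul, coeff_C_mul, coeff_map, mul_comm _ (C _), ← mul_assoc, mul_assoc,
    coeff_C_mul, coeff_C_mul, coeff_rescale, coeff_rescale, coeff_map, coeff_map, hpow, hpow, e,
    ← tsX_mul, map_mul, map_mul]
  simp only [tsK, RingHom.comp_apply, RingHom.coe_coe]
  ring

/-- The coefficients of the product of two normal ordered currents. -/
def pairCoeff (c₁ : ℂ) (S : Finset (Fin N)) (c₂ : ℂ) (T : Finset (Fin N)) (s z : ℤ) (t₁ t₂ : ℕ) : R :=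
  algebraMap ℂ R (zeroFactor N ħ β lam S * zeroFactor N ħ β lam T) *
    (O.cr (zcoeff s (cre N ħ β c₁ S) * zcoeff z (cre N ħ β c₂ T)) *
      O.an (coeff t₁ (ann N ħ β lam c₁ S) * coeff t₂ (ann N ħ β lam c₂ T)))

/-- The variable is `X = z₂/z₁` with `z₂ = 1`, so only the first current depends on it: creation
degree `s` and annihilation degree `x.1` give `X ^ (x.1 - s)`. `M` is any bound for the creation
degrees. -/
theorem modePart_setWeight (g : TwoSided R) (c₁ : ℂ) (S : Finset (Fin N)) (c₂ : ℂ)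
    (T : Finset (Fin N)) {B M : ℕ} {tot : ℤ} (hM : (B : ℤ) - tot ≤ M) :
    modePart B tot (C (C g) * setWeight O (-1) c₁ S * setWeight O 0 c₂ T) =
      ∑ t ∈ range B, ∑ x ∈ antidiagonal t, ∑ s ∈ range M,
        tsC (pairCoeff O c₁ S c₂ T s ((x.1 : ℤ) + x.2 - tot - s) x.1 x.2) * tsX (x.1 - s) * g := by
  rw [mul_assoc, modePart_C_mul, modePart, mul_sum]
  refine sum_congr rfl fun t ht => ?_
  have htM : (t : ℤ) - tot < M := by have := mem_range.1 ht; omega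
  have hsum : ∀ F : ℕ × ℕ → PowerSeries (TwoSided R), zcoeff ((t : ℤ) - tot)
      (∑ x ∈ antidiagonal t, F x) = ∑ x ∈ antidiagonal t, zcoeff ((t : ℤ) - tot) (F x) := by
    intro F
    simp only [zcoeff]
    split_ifs
    · exact map_sum _ _ _
    · exact sum_const_zero.symm
  rw [coeff_mul, hsum, mul_sum]
  refine sum_congr rfl fun x hx => ?_
  have hx : (t : ℤ) = x.1 + x.2 := by have := mem_antidiagonal.1 hx; omega
  rw [zcoeff_mul _ _ htM, mul_sum]
  refine sum_congr rfl fun s _ => ?_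
  rw [← hx, coeff_coeff_setWeight]
  have hz : zcoeff ((t : ℤ) - tot - s) (coeff x.2 (setWeight O 0 c₂ T)) =
      tsC (algebraMap ℂ R (zeroFactor N ħ β lam T) *
        (O.cr (zcoeff ((t : ℤ) - tot - s) (cre N ħ β c₂ T)) *
        O.an (coeff x.2 (ann N ħ β lam c₂ T)))) := by
    rw [zcoeff, zcoeff]
    split_ifs
    · rw [coeff_coeff_setWeight, zero_mul, tsX_zero, mul_one]
    · simp
  have e : -1 * ((s : ℤ) - x.1) = x.1 - s := by ring
  rw [hz, e, pairCoeff, zcoeff_natCast]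
  simp only [map_mul]
  ring

theorem act_pairCoeff (c₁ : ℂ) (S : Finset (Fin N)) (c₂ : ℂ) (T : Finset (Fin N)) (s z : ℤ)
    (t₁ t₂ : ℕ) (y : ℂ) (v : Fock N) :
    O.act v (pairCoeff O c₁ S c₂ T s z t₁ t₂ * algebraMap ℂ R y) =
      (zeroFactor N ħ β lam S * zeroFactor N ħ β lam T) • y •
        (zcoeff s (cre N ħ β c₁ S) * zcoeff z (cre N ħ β c₂ T) *
          coeff t₁ (annOp N ħ β lam c₁ S) (coeff t₂ (annOp N ħ β lam c₂ T) v)) := by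
  rw [pairCoeff, mul_assoc, mul_comm _ (algebraMap ℂ R y), ← Algebra.smul_def, ← Algebra.smul_def,
    map_smul, map_smul, O.act_mul]
  rfl

theorem act_pairCoeff_eq_zero (c₁ : ℂ) (S : Finset (Fin N)) (c₂ : ℂ) (T : Finset (Fin N)) (s z : ℤ)
    {t₁ t₂ d : ℕ} (y : ℂ) {v : Fock N} (hv : v ∈ deg N d) (h : d < t₁ + t₂) :
    O.act v (pairCoeff O c₁ S c₂ T s z t₁ t₂ * algebraMap ℂ R y) = 0 := by
  rw [act_pairCoeff, coeff_annOp_eq_zero N ħ β lam c₁ S (lowers_annOp N ħ β lam c₂ T t₂ d v hv)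
    (by omega), mul_zero, smul_zero, smul_zero]

theorem sum_range_eq_sum_range {M : Type*} [AddCommMonoid M] {F : ℕ → M} {d B B' : ℕ} (hB : d < B)
    (hB' : d < B') (h : ∀ t, d < t → F t = 0) : ∑ t ∈ range B, F t = ∑ t ∈ range B', F t := by
  have key : ∀ {B}, d < B → ∑ t ∈ range (d + 1), F t = ∑ t ∈ range B, F t := fun hB =>
    sum_subset (range_subset_range.2 hB) fun t _ ht => h t (by have := mem_range.not.1 ht; omega)
  rw [← key hB, ← key hB']

/-- The coefficient of `xⁿ` takes degree `n - (t₁ - s)` from the kernel, which is the index `e` of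
`pairMode`. The truncations `B` and `B'` may differ because annihilation degrees above `d` kill `v`.
-/
theorem act_modePart_fst {g : TwoSided R} {φ : PowerSeries ℂ}
    (hg : g.1 = HahnSeries.ofPowerSeries ℤ R (PowerSeries.map (algebraMap ℂ R) φ)) (c₁ : ℂ)
    (S : Finset (Fin N)) (c₂ : ℂ) (T : Finset (Fin N)) {n m : ℤ} {d : ℕ} {v : Fock N}
    (hv : v ∈ deg N d) {B B' : ℕ} (hB : d < B) (hd : d < B') (hdm : (d : ℤ) - m < B') :
    O.act v ((modePart B (n + m) (C (C g) * setWeight O (-1) c₁ S * setWeight O 0 c₂ T)).1.coeff n) =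
      pairMode N ħ β lam φ B' c₁ S c₂ T n m v := by
  obtain ⟨M, hM, hM'⟩ : ∃ M : ℕ, (B : ℤ) - (n + m) ≤ M ∧ (B' : ℤ) - (n + m) ≤ M :=
    ⟨((B : ℤ) - (n + m)).toNat + ((B' : ℤ) - (n + m)).toNat, by omega, by omega⟩
  set Q : ℕ → ℕ → ℤ → Fock N := fun t₁ t₂ s => O.act v (pairCoeff O c₁ S c₂ T s
    ((t₁ : ℤ) + t₂ - (n + m) - s) t₁ t₂ * algebraMap ℂ R (zcoeff (n - (t₁ - s)) φ)) with hQ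
  have e1 : O.act v ((modePart B (n + m)
      (C (C g) * setWeight O (-1) c₁ S * setWeight O 0 c₂ T)).1.coeff n) =
      ∑ t ∈ range B, ∑ x ∈ antidiagonal t, ∑ s ∈ range M, Q x.1 x.2 s := by
    rw [modePart_setWeight O g c₁ S c₂ T hM]
    simp only [Prod.fst_sum, HahnSeries.coeff_sum, map_sum, coeff_fst_tsX_mul, hg,
      coeff_ofPowerSeries, zcoeff_map, hQ]
  have hzero : ∀ t₁ t₂ s, d < t₁ + t₂ → Q t₁ t₂ s = 0 := fun t₁ t₂ s h =>
    act_pairCoeff_eq_zero O c₁ S c₂ T _ _ _ hv h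
  have hrange : ∀ (t₁ t₂ : ℕ) (s : ℤ), (s < 0 ∨ (t₁ : ℤ) + t₂ - (n + m) < s ∨ s < t₁ - n) → Q t₁ t₂ s = 0 := by
    intro t₁ t₂ s h
    simp only [hQ, act_pairCoeff]
    rcases h with h | h | h
    · rw [zcoeff_of_neg h, zero_mul, zero_mul, smul_zero, smul_zero]
    · rw [zcoeff_of_neg (by omega : (t₁ : ℤ) + t₂ - (n + m) - s < 0), mul_zero, zero_mul, smul_zero,
        smul_zero]
    · rw [zcoeff_of_neg (by omega : n - (t₁ - s) < 0), zero_smul, smul_zero]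
  rw [e1, sum_range_eq_sum_range
      (F := fun t => ∑ x ∈ antidiagonal t, ∑ s ∈ range M, Q x.1 x.2 s) hB hd fun t ht => sum_eq_zero fun x hx => sum_eq_zero fun s _ =>
      hzero x.1 x.2 s (by have := mem_antidiagonal.1 hx; omega),
    ← sum_range_sum_range_eq_antidiagonal B' (fun t₁ t₂ => ∑ s ∈ range M, Q t₁ t₂ s)
    fun t₁ t₂ h => sum_eq_zero fun s _ => hzero t₁ t₂ s (by omega)]
  -- The creation degree `s` is replaced by the degree `L` of the kernel, `s = t₁ - n + L`. Both
  -- ranges contain all nonzero terms.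
  have e2 : ∀ t₁ t₂, ∑ s ∈ range M, Q t₁ t₂ s = ∑ L ∈ range B', Q t₁ t₂ (t₁ - n + L) := by
    intro t₁ t₂
    by_cases h : d < t₁ + t₂
    · simp only [hzero t₁ t₂ _ h, sum_const_zero]
    rw [sum_range_eq_finsum (Q t₁ t₂) (t₁ - n) B', ← sum_range_eq_finsum (Q t₁ t₂) 0 M]
    · simp only [zero_add]
    · intro s hs
      exact hrange t₁ t₂ s (by omega)
    · intro s hs
      exact hrange t₁ t₂ s (by omega)
  simp only [e2, pairMode, smul_sum]
  rw [sum_congr rfl fun t₁ _ => sum_comm, sum_comm]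
  refine sum_congr rfl fun L _ => sum_congr rfl fun t₁ _ => sum_congr rfl fun t₂ _ => ?_
  simp only [hQ, act_pairCoeff]
  rw [show n - ((t₁ : ℤ) - (t₁ - n + L)) = L by ring, zcoeff_natCast,
    show (t₁ : ℤ) - n + L = t₁ + L - n by ring,
    show (t₁ : ℤ) + t₂ - (n + m) - (t₁ + L - n) = t₂ - m - L by ring]

theorem act_modePart_snd {g : TwoSided R} {φ : PowerSeries ℂ}
    (hg : g.2 = HahnSeries.ofPowerSeries ℤ R (PowerSeries.map (algebraMap ℂ R) φ)) (c₁ : ℂ)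
    (S : Finset (Fin N)) (c₂ : ℂ) (T : Finset (Fin N)) {n m : ℤ} {d : ℕ} {v : Fock N}
    (hv : v ∈ deg N d) {B B' : ℕ} (hB : d < B) (hd : d < B') (hdn : (d : ℤ) - n < B') :
    O.act v ((modePart B (n + m)
      (C (C g) * setWeight O (-1) c₁ S * setWeight O 0 c₂ T)).2.coeff (-n)) =
      pairMode N ħ β lam φ B' c₂ T c₁ S m n v := by
  obtain ⟨M, hM, hM'⟩ : ∃ M : ℕ, (B : ℤ) - (n + m) ≤ M ∧ (B' : ℤ) - (n + m) ≤ M :=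
    ⟨((B : ℤ) - (n + m)).toNat + ((B' : ℤ) - (n + m)).toNat, by omega, by omega⟩
  -- Commutativity of `R` exchanges the two currents; the expansion in `x⁻¹` then yields the product
  -- in the opposite order.
  have hswap : ∀ s z t₁ t₂, pairCoeff O c₁ S c₂ T s z t₁ t₂ = pairCoeff O c₂ T c₁ S z s t₂ t₁ := by
    intro s z t₁ t₂
    simp only [pairCoeff, mul_comm (zeroFactor N ħ β lam S),
      mul_comm (zcoeff s (cre N ħ β c₁ S)), mul_comm (coeff t₁ (ann N ħ β lam c₁ S))]
  set Q : ℕ → ℕ → ℤ → Fock N := fun t₁ t₂ s => O.act v (pairCoeff O c₁ S c₂ T s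
    ((t₁ : ℤ) + t₂ - (n + m) - s) t₁ t₂ * algebraMap ℂ R (zcoeff (-n + (t₁ - s)) φ)) with hQ
  have e1 : O.act v ((modePart B (n + m)
      (C (C g) * setWeight O (-1) c₁ S * setWeight O 0 c₂ T)).2.coeff (-n)) =
      ∑ t ∈ range B, ∑ x ∈ antidiagonal t, ∑ s ∈ range M, Q x.1 x.2 s := by
    rw [modePart_setWeight O g c₁ S c₂ T hM]
    simp only [Prod.snd_sum, HahnSeries.coeff_sum, map_sum, coeff_snd_tsX_mul, hg,
      coeff_ofPowerSeries, zcoeff_map, hQ]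
  have hzero : ∀ t₁ t₂ s, d < t₁ + t₂ → Q t₁ t₂ s = 0 := fun t₁ t₂ s h =>
    act_pairCoeff_eq_zero O c₁ S c₂ T _ _ _ hv h
  have hrange : ∀ (t₁ t₂ : ℕ) (s : ℤ), (s < 0 ∨ (t₁ : ℤ) + t₂ - (n + m) < s ∨ t₁ - n < s) → Q t₁ t₂ s = 0 := by
    intro t₁ t₂ s h
    simp only [hQ, act_pairCoeff]
    rcases h with h | h | h
    · rw [zcoeff_of_neg h, zero_mul, zero_mul, smul_zero, smul_zero]
    · rw [zcoeff_of_neg (by omega : (t₁ : ℤ) + t₂ - (n + m) - s < 0), mul_zero, zero_mul, smul_zero,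
        smul_zero]
    · rw [zcoeff_of_neg (by omega : -n + (t₁ - s) < 0), zero_smul, smul_zero]
  rw [e1, sum_range_eq_sum_range
      (F := fun t => ∑ x ∈ antidiagonal t, ∑ s ∈ range M, Q x.1 x.2 s) hB hd fun t ht => sum_eq_zero fun x hx => sum_eq_zero fun s _ =>
      hzero x.1 x.2 s (by have := mem_antidiagonal.1 hx; omega),
    ← sum_range_sum_range_eq_antidiagonal B' (fun t₁ t₂ => ∑ s ∈ range M, Q t₁ t₂ s)
    fun t₁ t₂ h => sum_eq_zero fun s _ => hzero t₁ t₂ s (by omega)]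
  have e2 : ∀ t₁ t₂, ∑ s ∈ range M, Q t₁ t₂ s = ∑ L ∈ range B', Q t₁ t₂ (t₁ - n - L) := by
    intro t₁ t₂
    by_cases h : d < t₁ + t₂
    · simp only [hzero t₁ t₂ _ h, sum_const_zero]
    rw [← sum_range_reflect (fun L : ℕ => Q t₁ t₂ (t₁ - n - L))]
    have e3 : ∀ L ∈ range B', Q t₁ t₂ (t₁ - n - (B' - 1 - L : ℕ)) =
        Q t₁ t₂ ((t₁ - n - (B' - 1)) + L) := by
      intro L hL
      have := mem_range.1 hL
      congr 1
      omega
    rw [sum_congr rfl e3, sum_range_eq_finsum (Q t₁ t₂), ← sum_range_eq_finsum (Q t₁ t₂) 0 M]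
    · simp only [zero_add]
    · intro s hs
      exact hrange t₁ t₂ s (by omega)
    · intro s hs
      exact hrange t₁ t₂ s (by omega)
  simp only [e2, pairMode, smul_sum]
  rw [sum_comm, sum_congr rfl fun t₁ _ => sum_comm, sum_comm]
  refine sum_congr rfl fun L _ => sum_congr rfl fun t₂ _ => sum_congr rfl fun t₁ _ => ?_
  simp only [hQ]
  rw [hswap, act_pairCoeff, show -n + ((t₁ : ℤ) - (t₁ - n - L)) = L by ring, zcoeff_natCast,
    show (t₁ : ℤ) - n - L = t₁ - n - L by ring,
    show (t₁ : ℤ) + t₂ - (n + m) - (t₁ - n - L) = t₂ + L - m by ring]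

end Pair
end DWA
end

noncomputable section
namespace DWA
open Finset PowerSeries

/-! ## Scaling of the arguments -/

section Scaling

variable (N : ℕ) (ħ β : ℂ) (lam : Fin N → ℂ)

theorem site_mul (γ c : ℂ) (S : Finset (Fin N)) (d : Fin N) :
    site N ħ β (γ * c) S d = γ * site N ħ β c S d := by rw [site, site, mul_assoc]

theorem cre_mul (γ c : ℂ) (S : Finset (Fin N)) :
    cre N ħ β (γ * c) S = rescale (algebraMap ℂ (Fock N) γ) (cre N ħ β c S) := by
  simp only [cre, map_prod, site_mul, map_mul, rescale_rescale, mul_comm (algebraMap ℂ (Fock N) γ)]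

theorem ann_mul (γ c : ℂ) (S : Finset (Fin N)) :
    ann N ħ β lam (γ * c) S = rescale (algebraMap ℂ (annihAlg N ħ β lam) γ⁻¹) (ann N ħ β lam c S) := by
  simp only [ann, map_prod, site_mul, mul_inv, map_mul, rescale_rescale,
    mul_comm (algebraMap ℂ (annihAlg N ħ β lam) γ⁻¹)]

theorem zcoeff_cre_mul {γ : ℂ} (c : ℂ) (S : Finset (Fin N)) (s : ℤ) :
    zcoeff s (cre N ħ β (γ * c) S) = γ ^ s • zcoeff s (cre N ħ β c S) := by
  rcases lt_or_ge s 0 with hs | hs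
  · rw [zcoeff_of_neg hs, zcoeff_of_neg hs, smul_zero]
  · obtain ⟨s, rfl⟩ := Int.eq_ofNat_of_zero_le hs
    rw [zcoeff_natCast, zcoeff_natCast, cre_mul, coeff_rescale, ← map_pow, ← Algebra.smul_def,
      zpow_natCast]

theorem coeff_annOp_mul (γ c : ℂ) (S : Finset (Fin N)) (t : ℕ) (v : Fock N) :
    coeff t (annOp N ħ β lam (γ * c) S) v = γ⁻¹ ^ t • coeff t (annOp N ħ β lam c S) v := by
  rw [annOp, annOp, ann_mul, coeff_map, coeff_map, coeff_rescale, ← map_pow, ← Algebra.smul_def]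
  rfl

theorem gSeries_mul (x c : ℂ) : gSeries ħ β (x * c) = rescale x (gSeries ħ β c) := by
  refine (isExp_gSeries ħ β (x * c)).unique (((isExp_gSeries ħ β c).rescale x).congr fun n _ => ?_)
  rw [coeff_rescale, coeff_mk, coeff_mk]
  ring

theorem pairMode_mul {γ₁ γ₂ : ℂ} (h₁ : γ₁ ≠ 0) (h₂ : γ₂ ≠ 0) (φ : PowerSeries ℂ) (B : ℕ) (c₁ : ℂ)
    (S : Finset (Fin N)) (c₂ : ℂ) (T : Finset (Fin N)) (n m : ℤ) (v : Fock N) :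
    pairMode N ħ β lam (rescale (γ₁⁻¹ * γ₂) φ) B (γ₁ * c₁) S (γ₂ * c₂) T n m v =
      (γ₁ ^ (-n) * γ₂ ^ (-m)) • pairMode N ħ β lam φ B c₁ S c₂ T n m v := by
  simp only [pairMode, smul_sum]
  refine sum_congr rfl fun e _ => sum_congr rfl fun t _ => sum_congr rfl fun s _ => ?_
  simp only [coeff_rescale, zcoeff_cre_mul, coeff_annOp_mul, map_smul, smul_mul_smul_comm, smul_smul]
  congr 1
  have e1 : γ₁ ^ ((t : ℤ) + e - n) = γ₁ ^ t * γ₁ ^ e * γ₁ ^ (-n) := by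
    rw [sub_eq_add_neg, zpow_add₀ h₁, zpow_add₀ h₁, zpow_natCast, zpow_natCast]
  have e2 : γ₂ ^ ((s : ℤ) - m - e) = γ₂ ^ s * γ₂ ^ (-m) * (γ₂ ^ e)⁻¹ := by
    rw [sub_eq_add_neg, sub_eq_add_neg, zpow_add₀ h₂, zpow_add₀ h₂, zpow_natCast, zpow_neg _ (e : ℤ),
      zpow_natCast]
  rw [e1, e2, mul_pow, inv_pow, inv_pow, inv_pow]
  have := pow_ne_zero t h₁
  have := pow_ne_zero e h₁
  have := pow_ne_zero e h₂
  have := pow_ne_zero s h₂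
  field_simp

end Scaling

/-! ## The sum over all pairs of currents -/

section PathSum

/-- Moving the starting point by `(k, -k)` changes all heights by `2k`. -/
theorem pathSum_shift {ι K : Type*} [CommRing K] (a b : ι → ℤ → K) (G : ℤ → K) (i j k : ℤ)
    (L : List ι) (m l : ℤ) :
    pathSum a b G i j L (m + k) (l - k) = pathSum (fun s m => a s (m + k)) (fun s l => b s (l - k))
      (fun h => G (h + 2 * k)) (i - k) (j + k) L m l := by
  induction L generalizing m l with
  | nil =>
    simp only [pathSum]
    exact if_congr (by constructor <;> rintro ⟨h1, h2⟩ <;> constructor <;> omega) rfl rfl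
  | cons s L ih =>
    simp only [pathSum, ← ih, show m + k - (l - k) = m - l + 2 * k by ring,
      show m + 1 + k = m + k + 1 by ring, show l + 1 - k = l - k + 1 by ring]

theorem rel_pathSum {ι K S : Type*} [CommRing K] [CommRing S] (P : Place K S) {a b : ι → ℤ → K}
    {G : ℤ → K} (ha : ∀ s m, ∃ w, P.rel (a s m) w) (hb : ∀ s m, ∃ w, P.rel (b s m) w)
    (hG : ∀ h, ∃ w, P.rel (G h) w) (i j : ℤ) (L : List ι) (m l : ℤ) :
    ∃ w, P.rel (pathSum a b G i j L m l) w := by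
  induction L generalizing m l with
  | nil =>
    rw [pathSum]
    split_ifs
    · exact ⟨1, P.rel_one⟩
    · exact ⟨0, P.rel_zero⟩
  | cons s L ih =>
    obtain ⟨x, hx⟩ := ha s m
    obtain ⟨y, hy⟩ := hb s l
    obtain ⟨g, hg⟩ := hG (m - l)
    obtain ⟨w₁, h₁⟩ := ih m l
    obtain ⟨w₂, h₂⟩ := ih (m + 1) (l + 1)
    obtain ⟨w₃, h₃⟩ := ih (m + 1) l
    obtain ⟨w₄, h₄⟩ := ih m (l + 1)
    exact ⟨_, P.rel_add (P.rel_add (P.rel_add h₁ (P.rel_mul (P.rel_mul hx hy) h₂))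
      (P.rel_mul (P.rel_mul hg hx) h₃)) (P.rel_mul hy h₄)⟩

variable {N : ℕ} {ħ β : ℂ} {lam : Fin N → ℂ} {R : Type*} [CommRing R] [Algebra ℂ R]
  (O : NormalOrdering N ħ β lam R)

/-- The sum of `∏ g(u p^{m-l}) :∏ Λ_d(c₁ X⁻¹ p^{-m}) ∏ Λ_d(c₂ p^{-l}):`, `u = c₁⁻¹ c₂ X`, over all
pairs of sets of indices, the ranks `m` and `l` of the indices being counted from `m` and `l` and
ending with `i` and `j`. -/
def currentSum (c₁ c₂ : ℂ) (i j m l : ℤ) : PowerSeries (PowerSeries (TwoSided R)) :=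
  pathSum (fun d m => siteWeight O (-1) (c₁ * pPow ħ β (-(m : ℂ))) d)
    (fun d l => siteWeight O 0 (c₂ * pPow ħ β (-(l : ℂ))) d)
    (fun h => C (C (gTS R ħ β (pPow ħ β h * (c₁⁻¹ * c₂))))) i j ((univ : Finset (Fin N)).sort (· ≤ ·))
    m l

theorem currentSum_eq (c₁ c₂ : ℂ) (i j : ℕ) :
    currentSum O c₁ c₂ i j 0 0 = ∑ S ∈ powersetCard i univ, ∑ T ∈ powersetCard j univ,
      C (C (∏ d ∈ S \ T, gTS R ħ β (pPow ħ β ((rk S d - rk T d : ℤ) : ℂ) * (c₁⁻¹ * c₂)))) *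
        setWeight O (-1) c₁ S * setWeight O 0 c₂ T := by
  rw [currentSum, pathSum_univ]
  refine sum_congr rfl fun S _ => sum_congr rfl fun T _ => ?_
  rw [pairWeight, map_prod, map_prod, ← prod_siteWeight, ← prod_siteWeight]
  simp only [zero_add, site, Int.cast_natCast]

/-- Shifted ranks amount to rescaled arguments, so paths from `(k, -k)` to `(i, j)` describe `i - k`
and `j + k` currents with arguments multiplied by `p^{-k}` and `p^k`. -/
theorem currentSum_shift (c₁ c₂ : ℂ) (i j k : ℤ) :
    currentSum O c₁ c₂ i j k (-k) =
      currentSum O (pPow ħ β (-(k : ℂ)) * c₁) (pPow ħ β k * c₂) (i - k) (j + k) 0 0 := by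
  have := pathSum_shift (fun d m => siteWeight O (-1) (c₁ * pPow ħ β (-(m : ℂ))) d)
    (fun d l => siteWeight O 0 (c₂ * pPow ħ β (-(l : ℂ))) d)
    (fun h => C (C (gTS R ħ β (pPow ħ β h * (c₁⁻¹ * c₂))))) i j k
    ((univ : Finset (Fin N)).sort (· ≤ ·)) 0 0
  rw [zero_add, zero_sub] at this
  have e1 : ∀ m : ℤ, c₁ * pPow ħ β (-((m + k : ℤ) : ℂ)) =
      pPow ħ β (-(k : ℂ)) * c₁ * pPow ħ β (-(m : ℂ)) := fun m => by
    rw [mul_comm _ c₁, mul_assoc, ← pPow_add]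
    congr 2; push_cast; ring
  have e2 : ∀ m : ℤ, c₂ * pPow ħ β (-((m - k : ℤ) : ℂ)) =
      pPow ħ β k * c₂ * pPow ħ β (-(m : ℂ)) := fun m => by
    rw [mul_comm _ c₂, mul_assoc, ← pPow_add]
    congr 2; push_cast; ring
  have e3 : ∀ h : ℤ, pPow ħ β ((h + 2 * k : ℤ) : ℂ) * (c₁⁻¹ * c₂) =
      pPow ħ β h * ((pPow ħ β (-(k : ℂ)) * c₁)⁻¹ * (pPow ħ β k * c₂)) := fun h => by
    have : pPow ħ β ((h + 2 * k : ℤ) : ℂ) = pPow ħ β h * (pPow ħ β k * pPow ħ β k) := by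
      rw [← pPow_add, ← pPow_add]; congr 1; push_cast; ring
    rw [this, mul_inv, ← pPow_neg, neg_neg]
    ring
  simp only [e1, e2, e3] at this
  exact this

theorem fst_prod_gTS {ι : Type*} (s : Finset ι) (c : ι → ℂ) :
    (∏ d ∈ s, gTS R ħ β (c d)).1 = HahnSeries.ofPowerSeries ℤ R
      (PowerSeries.map (algebraMap ℂ R) (∏ d ∈ s, gSeries ħ β (c d))) := by
  simp only [Prod.fst_prod, gTS_fst, map_prod]

theorem snd_prod_gTS {ι : Type*} (s : Finset ι) {c : ι → ℂ} (hc : ∀ d, c d ≠ 0) :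
    (∏ d ∈ s, gTS R ħ β (c d)).2 = HahnSeries.ofPowerSeries ℤ R
      (PowerSeries.map (algebraMap ℂ R) (∏ d ∈ s, gSeries ħ β (pPow ħ β 1 * c d)⁻¹)) := by
  simp only [Prod.snd_prod, gTS_snd R ħ β (hc _), map_prod]

theorem wScale_inv_mul (a b : ℕ) :
    (wScale ħ β a)⁻¹ * wScale ħ β b = pPow ħ β (((b : ℂ) - a) / 2) := by
  rw [wScale, wScale, ← pPow_neg, ← pPow_add]
  congr 1; ring

/-- The free scales `γ₁`, `γ₂` are needed because the residues are products of currents at shifted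
arguments. -/
theorem act_currentSum_fst (hN : 2 ≤ N) (hp : ∀ n : ℕ, 0 < n → pPow ħ β n ≠ 1)
    (hlam : ∑ i, lam i = 0) {a b : ℕ} (hab : a ≤ b) {γ₁ γ₂ : ℂ} (h₁ : γ₁ ≠ 0) (h₂ : γ₂ ≠ 0)
    {n m : ℤ} {d : ℕ} {v : Fock N} (hv : v ∈ deg N d) {B : ℕ} (hB : d < B) :
    O.act v ((modePart B (n + m) (currentSum O (γ₁ * wScale ħ β a) (γ₂ * wScale ħ β b) a b 0 0)).1.coeff
      n) = (γ₁ ^ (-n) * γ₂ ^ (-m)) • fWW N ħ β lam a b n m v := by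
  obtain ⟨B', hd, hdm⟩ : ∃ B' : ℕ, d < B' ∧ (d : ℤ) - m < B' :=
    ⟨d + 1 + ((d : ℤ) - m + 1).toNat, by omega, by omega⟩
  rw [fWW_eq N ħ β lam hN hlam a b n m hv hd hdm, currentSum_eq, modePart_sum]
  simp only [modePart_sum, Prod.fst_sum, HahnSeries.coeff_sum, map_sum, smul_sum]
  refine sum_congr rfl fun S hS => sum_congr rfl fun T hT => ?_
  rw [act_modePart_fst O (fst_prod_gTS _ _) _ S _ T hv hB hd hdm]
  obtain rfl := (mem_powersetCard.1 hS).2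
  obtain rfl := (mem_powersetCard.1 hT).2
  rw [f_mul_contraction (by omega) hp hab (wScale_inv_mul _ _),
    ← pairMode_mul N ħ β lam h₁ h₂, map_prod]
  congr 1
  refine prod_congr rfl fun d _ => ?_
  rw [← gSeries_mul, ← wScale_inv_mul, mul_inv]
  congr 1
  ring

theorem act_currentSum_snd (hN : 2 ≤ N) (hp : ∀ n : ℕ, 0 < n → pPow ħ β n ≠ 1)
    (hlam : ∑ i, lam i = 0) {a b : ℕ} (hab : a ≤ b) {n m : ℤ} {d : ℕ} {v : Fock N}
    (hv : v ∈ deg N d) {B : ℕ} (hB : d < B) :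
    O.act v ((modePart B (n + m) (currentSum O (wScale ħ β a) (wScale ħ β b) a b 0 0)).2.coeff
      (-n)) = fWW N ħ β lam b a m n v := by
  obtain ⟨B', hd, hdn⟩ : ∃ B' : ℕ, d < B' ∧ (d : ℤ) - n < B' :=
    ⟨d + 1 + ((d : ℤ) - n + 1).toNat, by omega, by omega⟩
  rw [fWW_eq N ħ β lam hN hlam b a m n hv hd hdn, currentSum_eq, modePart_sum]
  conv_rhs => rw [sum_comm]
  simp only [modePart_sum, Prod.snd_sum, HahnSeries.coeff_sum, map_sum]
  refine sum_congr rfl fun S hS => sum_congr rfl fun T hT => ?_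
  rw [act_modePart_snd O (snd_prod_gTS _ fun d => ?_) _ S _ T hv hB hd hdn]
  · obtain rfl := (mem_powersetCard.1 hS).2
    obtain rfl := (mem_powersetCard.1 hT).2
    rw [f_mul_contraction_swap (by omega) hp hab (wScale_inv_mul _ _), wScale_inv_mul]
  · rw [wScale_inv_mul]
    exact mul_ne_zero (pPow_ne_zero _ _ _) (pPow_ne_zero _ _ _)

/-! ### Poles -/

variable {x₀ : ℂ} (hx : x₀ ≠ 0)

/-- At `x₀` the argument `c₁ p^{-m} / x₀` of a current of the first kind equals the argument `c₂
p^{-(m-H)}` of one of the second kind. -/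
theorem siteValue_reflect {c₁ c₂ : ℂ} (hc : c₁ ≠ 0) {H : ℤ}
    (hH : c₁⁻¹ * c₂ * x₀ = pPow ħ β ((-H : ℤ) : ℂ)) (d : Fin N) (m : ℤ) :
    siteValue O (c₁ * pPow ħ β (-(m : ℂ)) * x₀ ^ (-1 : ℤ)) d =
      siteValue O (c₂ * pPow ħ β (-((m - H : ℤ) : ℂ)) * x₀ ^ (0 : ℤ)) d := by
  congr 1
  have e : pPow ħ β (-((m - H : ℤ) : ℂ)) = pPow ħ β (-(m : ℂ)) * (pPow ħ β ((-H : ℤ) : ℂ))⁻¹ := by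
    rw [← pPow_neg, ← pPow_add]; congr 1; push_cast; ring
  rw [e, ← hH, zpow_zero, mul_one, zpow_neg_one]
  have hc2 : c₂ ≠ 0 := by
    rintro rfl
    rw [mul_zero, zero_mul] at hH
    exact pPow_ne_zero _ _ _ hH.symm
  field_simp

theorem tame_currentSum_end (hp : ∀ n : ℕ, 0 < n → pPow ħ β n ≠ 1) {c₁ c₂ : ℂ} (hc : c₁ ≠ 0) {H : ℤ}
    (hH : c₁⁻¹ * c₂ * x₀ = pPow ħ β ((-H : ℤ) : ℂ)) {m₀ l₀ : ℤ} (h : H ≤ m₀ - l₀) :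
    ∃ w, Tame (placeAt R x₀ hx).powerSeries.powerSeries H (gRes ħ β)
      (fun r => gFun ħ β (pPow ħ β r)) (fun i j => currentSum O c₁ c₂ i j m₀ l₀) w :=
  tame_pathSum_end (placeAt R x₀ hx).powerSeries.powerSeries
    (G := fun h => C (C (gTS R ħ β (pPow ħ β h * (c₁⁻¹ * c₂)))))
    (a := fun d m => siteWeight O (-1) (c₁ * pPow ħ β (-(m : ℂ))) d)
    (b := fun d l => siteWeight O 0 (c₂ * pPow ħ β (-(l : ℂ))) d)
    (a₀ := fun d m => siteValue O (c₁ * pPow ħ β (-(m : ℂ)) * x₀ ^ (-1 : ℤ)) d)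
    (b₀ := fun d l => siteValue O (c₂ * pPow ħ β (-(l : ℂ)) * x₀ ^ (0 : ℤ)) d)
    (goodWeight_gTS hx hp hH).powerSeries.powerSeries
    (fun d _ => rel_siteWeight O hx (-1) _ d) (fun d _ => rel_siteWeight O hx 0 _ d)
    (siteValue_reflect O hc hH) h _

theorem tame_currentSum_start (hp : ∀ n : ℕ, 0 < n → pPow ħ β n ≠ 1) {c₁ c₂ : ℂ} (hc : c₁ ≠ 0)
    {H : ℤ} (hH : c₁⁻¹ * c₂ * x₀ = pPow ħ β ((-H : ℤ) : ℂ)) {i j : ℤ} (h : i - j ≤ H) :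
    ∃ w, Tame (placeAt R x₀ hx).powerSeries.powerSeries (-H) (-gRes ħ β)
      (fun r => gFun ħ β (pPow ħ β r)) (fun m l => currentSum O c₁ c₂ i j (-m) (-l)) w :=
  tame_pathSum_start (placeAt R x₀ hx).powerSeries.powerSeries
    (G := fun h => C (C (gTS R ħ β (pPow ħ β h * (c₁⁻¹ * c₂)))))
    (a := fun d m => siteWeight O (-1) (c₁ * pPow ħ β (-(m : ℂ))) d)
    (b := fun d l => siteWeight O 0 (c₂ * pPow ħ β (-(l : ℂ))) d)
    (a₀ := fun d m => siteValue O (c₁ * pPow ħ β (-(m : ℂ)) * x₀ ^ (-1 : ℤ)) d)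
    (b₀ := fun d l => siteValue O (c₂ * pPow ħ β (-(l : ℂ)) * x₀ ^ (0 : ℤ)) d)
    (goodWeight_gTS hx hp hH).powerSeries.powerSeries
    (fun d _ => rel_siteWeight O hx (-1) _ d) (fun d _ => rel_siteWeight O hx 0 _ d)
    (siteValue_reflect O hc hH) h _

theorem currentSum_eq_zero (c₁ c₂ : ℂ) {i j m l : ℤ} (h : i < m ∨ j < l) :
    currentSum O c₁ c₂ i j m l = 0 :=
  pathSum_eq_zero _ _ _ _ h

/-- If `u` is not an integral power of `p`, every up-step weight is regular, and so is the sum. -/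
theorem rel_currentSum {c₁ c₂ : ℂ} (h₁ : c₁ ≠ 0) (h₂ : c₂ ≠ 0)
    (hH : ∀ H : ℤ, c₁⁻¹ * c₂ * x₀ ≠ pPow ħ β ((-H : ℤ) : ℂ)) (i j m l : ℤ) :
    ∃ w, (placeAt R x₀ hx).powerSeries.powerSeries.rel (currentSum O c₁ c₂ i j m l) w := by
  have hne : ∀ h : ℤ, 1 - pPow ħ β h * (c₁⁻¹ * c₂) * x₀ ≠ 0 := by
    intro h h0
    apply hH h
    have h1 := sub_eq_zero.1 h0
    rw [Int.cast_neg, pPow_neg, ← mul_right_inj' (pPow_ne_zero ħ β h), mul_inv_cancel₀ (pPow_ne_zero _ _ _), h1]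
    ring
  refine rel_pathSum _ (fun d m => ⟨_, rel_siteWeight O hx (-1) _ d⟩)
    (fun d l => ⟨_, rel_siteWeight O hx 0 _ d⟩) (fun h => ⟨_,
    Place.powerSeries_C _ (Place.powerSeries_C _ (placeAt_gTS hx ?_ (hne h) ?_))⟩) i j _ m l
  · exact mul_ne_zero (pPow_ne_zero _ _ _) (mul_ne_zero (inv_ne_zero h₁) h₂)
  · have := hne (h + 1)
    rwa [show pPow ħ β ((h + 1 : ℤ) : ℂ) = pPow ħ β 1 * pPow ħ β h by
      rw [← pPow_add]; congr 1; push_cast; ring, mul_assoc (pPow ħ β 1)] at this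

end PathSum
end DWA
end

noncomputable section
namespace DWA
open Finset PowerSeries

/-! ## Regular values and residues -/

theorem HasRegularValue.of_scale {V : Type*} [AddCommGroup V] [Module ℂ V] {S S' : ℤ → V}
    {x₀ c e : ℂ} (hc : c ≠ 0) (he : e ≠ 0) (hS : ∀ n, S' n = (c ^ n * e) • S n) {w : V}
    (h : HasRegularValue S' x₀ w) : HasRegularValue S (c * x₀) (e⁻¹ • w) := by
  obtain ⟨Q, P, hQ, hP, hw⟩ := h
  have hQe : (Q.comp (Polynomial.C c⁻¹ * Polynomial.X)).eval (c * x₀) = Q.eval x₀ := by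
    rw [Polynomial.eval_comp, Polynomial.eval_mul, Polynomial.eval_C, Polynomial.eval_X,
      inv_mul_cancel_left₀ hc]
  refine ⟨Q.comp (Polynomial.C c⁻¹ * Polynomial.X),
    Finsupp.onFinset P.support (fun n => (c ^ (-n) * e⁻¹) • P n) fun n hn => ?_, ?_, fun n => ?_, ?_⟩
  · rw [Finsupp.mem_support_iff]
    intro h0
    exact hn (by rw [h0, smul_zero])
  · rwa [hQe]
  · rw [Finsupp.onFinset_apply, ← hP, Polynomial.sum_eq_of_subset (s := Q.support)
      (fun (k : ℕ) (a : ℂ) => a • S (n - k)) (fun i => zero_smul _ _), Polynomial.sum_def, smul_sum]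
    · refine sum_congr rfl fun k _ => ?_
      rw [Polynomial.comp_C_mul_X_coeff, hS, smul_smul, smul_smul]
      congr 1
      have e1 : c ^ (n - k) = c ^ n * (c ^ k)⁻¹ := by
        rw [zpow_sub₀ hc, zpow_natCast, div_eq_mul_inv]
      have := zpow_ne_zero n hc
      rw [e1, zpow_neg, inv_pow]
      field_simp
    · intro k hk
      rw [Polynomial.mem_support_iff, Polynomial.comp_C_mul_X_coeff] at hk
      exact Polynomial.mem_support_iff.2 (left_ne_zero_of_mul hk)
  · rw [hQe, smul_comm, ← hw, Finsupp.onFinset_sum _ (fun n => smul_zero _), Finsupp.sum, smul_sum]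
    refine sum_congr rfl fun n _ => ?_
    rw [smul_smul, smul_smul, mul_zpow, zpow_neg]
    congr 1
    have := zpow_ne_zero n hc
    field_simp

theorem regularValue_eq {V : Type*} [AddCommGroup V] [Module ℂ V] {S : ℤ → V} {x₀ : ℂ} (hx : x₀ ≠ 0)
    {w : V} (h : HasRegularValue S x₀ w) : regularValue S x₀ = w := by
  have h' : ∃ w, HasRegularValue S x₀ w := ⟨w, h⟩
  rw [regularValue, dif_pos h']
  exact h'.choose_spec.unique hx h

section Main

variable {N : ℕ} {ħ β : ℂ} {lam : Fin N → ℂ} {R : Type*} [CommRing R] [Algebra ℂ R]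
  (O : NormalOrdering N ħ β lam R)

theorem hasRegularValue_fWWSeries (hN : 2 ≤ N) (hp : ∀ n : ℕ, 0 < n → pPow ħ β n ≠ 1)
    (hlam : ∑ i, lam i = 0) {a b : ℕ} (hab : a ≤ b) {γ₁ γ₂ : ℂ} (h₁ : γ₁ ≠ 0) (h₂ : γ₂ ≠ 0)
    {x₀ : ℂ} (hx : x₀ ≠ 0) {w : PowerSeries (PowerSeries R)}
    (hw : (placeAt R x₀ hx).powerSeries.powerSeries.rel
      (currentSum O (γ₁ * wScale ħ β a) (γ₂ * wScale ħ β b) a b 0 0) w)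
    (tot : ℤ) {d : ℕ} {v : Fock N} (hv : v ∈ deg N d) {B : ℕ} (hB : d < B) :
    HasRegularValue (fWWSeries N ħ β lam a b tot v) (γ₁⁻¹ * γ₂ * x₀)
      (γ₂ ^ tot • O.act v (modePart B tot w)) := by
  have h := hasRegularValue_of_rel hx (O.act v) (Place.modePart _ hw B tot)
  have := HasRegularValue.of_scale (c := γ₁⁻¹ * γ₂) (e := γ₂ ^ (-tot))
    (S := fWWSeries N ħ β lam a b tot v) (mul_ne_zero (inv_ne_zero h₁) h₂) (zpow_ne_zero _ h₂)
    (fun n => ?_) h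
  · rwa [zpow_neg, inv_inv] at this
  · have e := act_currentSum_fst O hN hp hlam hab h₁ h₂ (n := n) (m := tot - n) hv hB
    rw [add_sub_cancel] at e
    rw [e, fWWSeries]
    congr 1
    rw [mul_zpow, inv_zpow', neg_sub, zpow_sub₀ h₂, zpow_neg _ tot]
    ring

theorem deltaTerm_eq (hN : 2 ≤ N) (hp : ∀ n : ℕ, 0 < n → pPow ħ β n ≠ 1)
    (hlam : ∑ i, lam i = 0) {a b : ℕ} (hab : a ≤ b) {γ₁ γ₂ : ℂ} (h₁ : γ₁ ≠ 0) (h₂ : γ₂ ≠ 0)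
    {x₀ : ℂ} (hx : x₀ ≠ 0) {w : PowerSeries (PowerSeries R)}
    (hw : (placeAt R x₀ hx).powerSeries.powerSeries.rel
      (currentSum O (γ₁ * wScale ħ β a) (γ₂ * wScale ħ β b) a b 0 0) w)
    (n m : ℤ) {d : ℕ} {v : Fock N} (hv : v ∈ deg N d) {B : ℕ} (hB : d < B) :
    deltaTerm N ħ β lam a b x₀⁻¹ γ₁ γ₂ n m v = x₀⁻¹ ^ n • O.act v (modePart B (n + m) w) := by
  have h := hasRegularValue_fWWSeries O hN hp hlam hab h₁ h₂ hx hw (n + m) hv hB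
  have hx' : γ₂ / (γ₁ * x₀⁻¹) = γ₁⁻¹ * γ₂ * x₀ := by field_simp
  rw [deltaTerm, hx', regularValue_eq (mul_ne_zero (mul_ne_zero (inv_ne_zero h₁) h₂) hx) h, smul_smul,
    mul_assoc, ← zpow_add₀ h₂, neg_add_cancel, zpow_zero, mul_one]

theorem algebraMap_powerSeries_powerSeries (c : ℂ) :
    algebraMap ℂ (PowerSeries (PowerSeries R)) c = C (C (algebraMap ℂ R c)) := by
  rw [PowerSeries.algebraMap_apply, PowerSeries.algebraMap_apply]

/-- `gRes · g(p) ⋯ g(p^{k-1})`. -/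
def currentRes (ħ β : ℂ) (k : ℤ) : ℂ :=
  residueFactor (gRes ħ β) (fun r => gFun ħ β (pPow ħ β r)) k

theorem wScale_ne_zero (a : ℕ) : wScale ħ β a ≠ 0 := pPow_ne_zero _ _ _

/-- Here `H = i - j - k ≤ 0`, so the start lies at height at least `H`; the end point `(i, j)` is
`k` above `H` and its reflection is `(j + H, i - H) = (i - k, j + k)`. -/
theorem currentSum_pole_upper (hp : ∀ n : ℕ, 0 < n → pPow ħ β n ≠ 1) {i j : ℕ} (hij : i ≤ j) {k : ℤ}
    (hk : 1 ≤ k) {x₀ : ℂ} (hx : x₀ ≠ 0) (h : x₀ = pPow ħ β (((j : ℂ) - i) / 2 + k)) :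
    ∃ w, (placeAt R x₀ hx).powerSeries.powerSeries.rel
        (currentSum O (wScale ħ β i) (wScale ħ β j) (i - k) (j + k) 0 0) w ∧
      (placeAt R x₀ hx).powerSeries.powerSeries.rel
        (C (C (placeAt R x₀ hx).π) * currentSum O (wScale ħ β i) (wScale ħ β j) i j 0 0)
        (C (C (algebraMap ℂ R (currentRes ħ β k))) * w) := by
  have hH : (wScale ħ β i)⁻¹ * wScale ħ β j * x₀ = pPow ħ β ((-(i - j - k) : ℤ) : ℂ) := by
    rw [wScale_inv_mul, h, ← pPow_add]
    congr 1; push_cast; ring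
  obtain ⟨w, h1, h2⟩ := tame_currentSum_end O hx hp (wScale_ne_zero i) hH
    (m₀ := 0) (l₀ := 0) (by omega)
  refine ⟨w (i - k) (j + k), h1 _ _ (by omega), ?_⟩
  have := h2 i j (by omega)
  rw [algebraMap_powerSeries_powerSeries, show (i : ℤ) - j - (i - j - k) = k by ring,
    show (j : ℤ) + (i - j - k) = i - k by ring, show (i : ℤ) - (i - j - k) = j + k by ring] at this
  exact this

/-- Here `H = k > 0 ≥ i - j`, so the starting point is reflected instead, from `(0, 0)` to `(k,
-k)`; `currentSum_shift` moves it back to the origin. -/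
theorem currentSum_pole_lower (hp : ∀ n : ℕ, 0 < n → pPow ħ β n ≠ 1) {i j : ℕ} (hij : i ≤ j) {k : ℤ}
    (hk : 1 ≤ k) {x₀ : ℂ} (hx : x₀ ≠ 0) (h : x₀ = pPow ħ β (-(((j : ℂ) - i) / 2 + k))) :
    ∃ w, (placeAt R x₀ hx).powerSeries.powerSeries.rel
        (currentSum O (pPow ħ β (-(k : ℂ)) * wScale ħ β i) (pPow ħ β k * wScale ħ β j)
          (i - k) (j + k) 0 0) w ∧
      (placeAt R x₀ hx).powerSeries.powerSeries.rel
        (C (C (placeAt R x₀ hx).π) * currentSum O (wScale ħ β i) (wScale ħ β j) i j 0 0)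
        (C (C (algebraMap ℂ R (-currentRes ħ β k))) * w) := by
  have hH : (wScale ħ β i)⁻¹ * wScale ħ β j * x₀ = pPow ħ β ((-k : ℤ) : ℂ) := by
    rw [wScale_inv_mul, h, ← pPow_add]
    congr 1; push_cast; ring
  obtain ⟨w, h1, h2⟩ := tame_currentSum_start O hx hp (wScale_ne_zero i) hH
    (i := i) (j := j) (by omega)
  refine ⟨w (-k) k, ?_, ?_⟩
  · have := h1 (-k) k (by omega)
    beta_reduce at this
    rwa [neg_neg, currentSum_shift] at this
  · have := h2 0 0 (by omega)
    beta_reduce at this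
    rw [algebraMap_powerSeries_powerSeries, show (0 : ℤ) - 0 - -k = k by ring,
      show (0 : ℤ) + -k = -k by ring, show (0 : ℤ) - -k = k by ring, neg_zero,
      show residueFactor (-gRes ħ β) (fun r => gFun ħ β (pPow ħ β r)) k = -currentRes ħ β k by
        rw [currentRes, residueFactor, residueFactor, neg_mul]] at this
    exact this

/-- The reflected sum is `0`, but its value `w` is only some element related to `0`. Adding `-c`
times that relation turns the residue into `0` without appealing to uniqueness of values. -/
theorem exists_rel_of_pole_zero {x₀ : ℂ} (hx : x₀ ≠ 0) {Z : PowerSeries (PowerSeries (TwoSided R))}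
    {w : PowerSeries (PowerSeries R)} {c : ℂ}
    (h0 : (placeAt R x₀ hx).powerSeries.powerSeries.rel 0 w)
    (h : (placeAt R x₀ hx).powerSeries.powerSeries.rel (C (C (placeAt R x₀ hx).π) * Z)
      (C (C (algebraMap ℂ R c)) * w)) :
    ∃ w', (placeAt R x₀ hx).powerSeries.powerSeries.rel Z w' := by
  set P := (placeAt R x₀ hx).powerSeries.powerSeries
  have hc : P.rel (C (C (tsK (-c)))) (C (C (algebraMap ℂ R (-c)))) :=
    Place.powerSeries_C _ (Place.powerSeries_C _ (placeAt_tsK hx _))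
  have := P.rel_add h (P.rel_mul hc h0)
  rw [mul_zero, add_zero, ← add_mul, ← map_add, ← map_add, ← map_add, add_neg_cancel, map_zero,
    map_zero, map_zero, zero_mul] at this
  exact P.rel_div this

theorem exists_rel_currentSum (hp : ∀ n : ℕ, 0 < n → pPow ħ β n ≠ 1) {i j : ℕ} (hij : i ≤ j)
    {x₀ : ℂ} (hx : x₀ ≠ 0)
    (hu : ∀ k ∈ Icc (1 : ℤ) i, x₀ ≠ pPow ħ β (((j : ℂ) - i) / 2 + k))
    (hl : ∀ k ∈ Icc (1 : ℤ) i, x₀ ≠ pPow ħ β (-(((j : ℂ) - i) / 2 + k))) :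
    ∃ w, (placeAt R x₀ hx).powerSeries.powerSeries.rel
      (currentSum O (wScale ħ β i) (wScale ħ β j) i j 0 0) w := by
  by_cases h : ∃ H : ℤ, (wScale ħ β i)⁻¹ * wScale ħ β j * x₀ = pPow ħ β ((-H : ℤ) : ℂ)
  swap
  · exact rel_currentSum O hx (wScale_ne_zero i) (wScale_ne_zero j) (fun H hH => h ⟨H, hH⟩) _ _ _ _
  obtain ⟨H, hH⟩ := h
  have hx₀ : x₀ = pPow ħ β (-(((j : ℂ) - i) / 2 + H)) := by
    rw [wScale_inv_mul] at hH
    rw [neg_add, pPow_add, pPow_neg ħ β ((j - i) / 2), eq_inv_mul_iff_mul_eq₀ (pPow_ne_zero _ _ _), hH]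
    push_cast; rfl
  -- The start lies at height `0`, the end at `i - j ≤ 0`. For `i - j ≤ H ≤ 0` the sum is regular;
  -- below this range the end point is reflected, above it the starting point.
  rcases le_or_gt H 0 with h0 | h0
  · by_cases h1 : (i : ℤ) - j ≤ H
    · obtain ⟨w, hw, _⟩ := tame_currentSum_end O hx hp (wScale_ne_zero i) hH
        (m₀ := 0) (l₀ := 0) (by omega)
      exact ⟨_, hw i j h1⟩
    · have hx₁ : x₀ = pPow ħ β (((j : ℂ) - i) / 2 + (i - j - H : ℤ)) := by
        rw [hx₀]; congr 1; push_cast; ring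
      -- The points with `k ≤ i` are excluded by hypothesis. For `k > i` no path ends at the
      -- negative first coordinate `i - k`, so the residue vanishes.
      have hk : (i : ℤ) < i - j - H := by
        by_contra hk
        exact hu _ (mem_Icc.2 ⟨by omega, by omega⟩) hx₁
      obtain ⟨w, hw, hw'⟩ := currentSum_pole_upper O hp hij (by omega) hx hx₁
      rw [currentSum_eq_zero O _ _ (Or.inl (by omega))] at hw
      exact exists_rel_of_pole_zero hx hw hw'
  · have hk : (i : ℤ) < H := by
      by_contra hk
      exact hl _ (mem_Icc.2 ⟨by omega, by omega⟩) hx₀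
    obtain ⟨w, hw, hw'⟩ := currentSum_pole_lower O hp hij (by omega) hx hx₀
    rw [currentSum_eq_zero O _ _ (Or.inl (by omega))] at hw
    exact exists_rel_of_pole_zero hx hw hw'

theorem pPow_ne_pPow (hp : ∀ n : ℕ, 0 < n → pPow ħ β n ≠ 1) {x y : ℂ} {n : ℤ} (hn : n ≠ 0)
    (h : x - y = n) : pPow ħ β x ≠ pPow ħ β y := by
  intro hxy
  apply pPow_intCast_ne_one hp hn
  rw [← h, sub_eq_add_neg, pPow_add, pPow_neg, hxy, mul_inv_cancel₀ (pPow_ne_zero _ _ _)]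

/-- The positions of the poles. -/
def polePos (ħ β : ℂ) (i j : ℕ) (f : Bool × Icc (1 : ℤ) i) : ℂ :=
  pPow ħ β (if f.1 then ((j : ℂ) - i) / 2 + (f.2 : ℤ) else -(((j : ℂ) - i) / 2 + (f.2 : ℤ)))

/-- The exponents of two different poles differ by a nonzero integer; between the two families the
difference is `±(j - i + k + k')`. -/
theorem polePos_injective (hp : ∀ n : ℕ, 0 < n → pPow ħ β n ≠ 1) {i j : ℕ} (hij : i ≤ j) :
    Function.Injective (polePos ħ β i j) := by
  rintro ⟨b, k, hk⟩ ⟨b', k', hk'⟩ h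
  rw [mem_Icc] at hk hk'
  by_contra hne
  revert h
  cases b <;> cases b' <;> simp only [polePos, if_true, if_false, Bool.false_eq_true]
  · exact pPow_ne_pPow hp (n := k' - k) (fun h0 => hne (by
      obtain rfl : k = k' := by omega
      rfl)) (by push_cast; ring)
  · exact pPow_ne_pPow hp (n := -(j - i + k + k')) (by omega) (by push_cast; ring)
  · exact pPow_ne_pPow hp (n := j - i + k + k') (by omega) (by push_cast; ring)
  · exact pPow_ne_pPow hp (n := k - k') (fun h0 => hne (by
      obtain rfl : k = k' := by omega
      rfl)) (by push_cast; ring)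

theorem wScale_sub {a i : ℕ} {k : ℤ} (h : (a : ℤ) = i - k) :
    wScale ħ β i = pPow ħ β ((k : ℂ) / 2) * wScale ħ β a := by
  have : (a : ℂ) = i - k := by exact_mod_cast congrArg (Int.cast : ℤ → ℂ) h
  rw [wScale, wScale, ← pPow_add, this]
  congr 1; ring

theorem pPow_mul_pPow_mul {x y z : ℂ} (h : x + y = z) (u : ℂ) :
    pPow ħ β x * (pPow ħ β y * u) = pPow ħ β z * u := by
  rw [← mul_assoc, ← pPow_add, h]

theorem fWW_sub_fWW (hN : 2 ≤ N) (hp : ∀ n : ℕ, 0 < n → pPow ħ β n ≠ 1)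
    (hlam : ∑ i, lam i = 0) (O : NormalOrdering N ħ β lam R) {i j : ℕ} (hij : i ≤ j) (n m : ℤ)
    (v : Fock N) :
    fWW N ħ β lam i j n m v - fWW N ħ β lam j i m n v = ∑ k ∈ Icc (1 : ℤ) i,
      (currentRes ħ β k • deltaTerm N ħ β lam (i - k) (j + k)
          (pPow ħ β (-(((j : ℂ) - i) / 2 + k))) (pPow ħ β ((k : ℂ) / 2))
          (pPow ħ β (-((k : ℂ) / 2))) n m v -
        currentRes ħ β k • deltaTerm N ħ β lam (i - k) (j + k)
          (pPow ħ β (((j : ℂ) - i) / 2 + k)) (pPow ħ β (-((k : ℂ) / 2)))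
          (pPow ħ β ((k : ℂ) / 2)) n m v) := by
  obtain ⟨d, hv⟩ := exists_mem_deg v
  have hB : d < d + 1 := by omega
  have hx : ∀ f, polePos ħ β i j f ≠ 0 := fun f => pPow_ne_zero _ _ _
  -- The scales of `W^i`, `W^j` are those of `W^{i-k}`, `W^{j+k}` times `p^{k/2}`, `p^{-k/2}`. This
  -- gives the arguments at the upper poles; at the lower poles the additional factors `p^{-k}`,
  -- `p^k` reverse both signs.
  have hpole : ∀ f, ∃ ρ : R, (placeAt R (polePos ħ β i j f) (hx f)).rel
      ((placeAt R (polePos ħ β i j f) (hx f)).π *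
        modePart (d + 1) (n + m) (currentSum O (wScale ħ β i) (wScale ħ β j) i j 0 0)) ρ ∧
      (polePos ħ β i j f)⁻¹ ^ n • O.act v ρ = if f.1 then
        currentRes ħ β (f.2 : ℤ) • deltaTerm N ħ β lam (i - (f.2 : ℤ)) (j + (f.2 : ℤ))
          (pPow ħ β (-(((j : ℂ) - i) / 2 + (f.2 : ℤ)))) (pPow ħ β (((f.2 : ℤ) : ℂ) / 2))
          (pPow ħ β (-(((f.2 : ℤ) : ℂ) / 2))) n m v
      else -(currentRes ħ β (f.2 : ℤ) • deltaTerm N ħ β lam (i - (f.2 : ℤ)) (j + (f.2 : ℤ))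
          (pPow ħ β (((j : ℂ) - i) / 2 + (f.2 : ℤ))) (pPow ħ β (-(((f.2 : ℤ) : ℂ) / 2)))
          (pPow ħ β (((f.2 : ℤ) : ℂ) / 2)) n m v) := by
    rintro ⟨b, k, hk⟩
    have hk' := mem_Icc.1 hk
    obtain ⟨a, ha⟩ : ∃ a : ℕ, (a : ℤ) = i - k := ⟨((i : ℤ) - k).toNat, by omega⟩
    obtain ⟨b', hb⟩ : ∃ b' : ℕ, (b' : ℤ) = j + k := ⟨((j : ℤ) + k).toNat, by omega⟩
    have hs₁ := wScale_sub (ħ := ħ) (β := β) ha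
    have hs₂ := wScale_sub (ħ := ħ) (β := β) (k := -k) (a := b') (i := j) (by omega)
    rw [Int.cast_neg, neg_div] at hs₂
    have hab : a ≤ b' := by omega
    cases b
    · obtain ⟨w, hw, hw'⟩ := currentSum_pole_lower O hp hij hk'.1 (hx (false, ⟨k, hk⟩)) (by
        simp [polePos])
      refine ⟨_, by rw [← modePart_C_mul]; exact Place.modePart _ hw' _ _, ?_⟩
      rw [hs₁, hs₂, pPow_mul_pPow_mul (z := -((k : ℂ) / 2)) (by ring),
        pPow_mul_pPow_mul (z := (k : ℂ) / 2) (by ring), ← ha, ← hb] at hw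
      have := deltaTerm_eq O hN hp hlam hab (pPow_ne_zero _ _ _) (pPow_ne_zero _ _ _) _ hw n m hv hB
      rw [modePart_C_mul, ← Algebra.smul_def, map_smul, smul_comm, ← this, if_neg (by simp), ← ha, ← hb,
        neg_smul]
      simp only [polePos, if_false, Bool.false_eq_true, ← pPow_neg, neg_neg]
    · obtain ⟨w, hw, hw'⟩ := currentSum_pole_upper O hp hij hk'.1 (hx (true, ⟨k, hk⟩)) (by
        simp [polePos])
      refine ⟨_, by rw [← modePart_C_mul]; exact Place.modePart _ hw' _ _, ?_⟩
      rw [hs₁, hs₂, ← ha, ← hb] at hw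
      have := deltaTerm_eq O hN hp hlam hab (pPow_ne_zero _ _ _) (pPow_ne_zero _ _ _) _ hw n m hv hB
      rw [modePart_C_mul, ← Algebra.smul_def, map_smul, smul_comm, ← this, if_pos rfl, ← ha, ← hb]
      simp only [polePos, if_true, ← pPow_neg]
  choose ρ hρ hρ' using hpole
  have h := coeff_sub_coeff_of_simple_poles (polePos ħ β i j) hx (polePos_injective hp hij) ρ hρ
    (fun x₀ h₀ hne => by
      obtain ⟨w, hw⟩ := exists_rel_currentSum O hp hij h₀
        (fun k hk h => hne (true, ⟨k, hk⟩) (by simp [polePos, h]))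
        (fun k hk h => hne (false, ⟨k, hk⟩) (by simp [polePos, h]))
      exact ⟨_, Place.modePart _ hw (d + 1) (n + m)⟩) n
  have h' := congrArg (O.act v) h
  have e1 := act_currentSum_fst O hN hp hlam hij one_ne_zero one_ne_zero (n := n) (m := m) hv hB
  rw [one_mul, one_mul, one_zpow, one_zpow, one_mul, one_smul] at e1
  rw [map_sub, e1, act_currentSum_snd O hN hp hlam hij hv hB] at h'
  rw [h', map_sum]
  have e2 : ∀ f, O.act v (algebraMap ℂ R ((polePos ħ β i j f)⁻¹ ^ n) * ρ f) =
      (polePos ħ β i j f)⁻¹ ^ n • O.act v (ρ f) := fun f => by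
    rw [← Algebra.smul_def, map_smul]
  rw [sum_congr rfl fun f _ => (e2 f).trans (hρ' f), Fintype.sum_prod_type, Fintype.sum_bool]
  simp only [if_true, if_false, Bool.false_eq_true, sum_neg_distrib, ← sub_eq_add_neg]
  rw [← sum_sub_distrib]
  exact sum_coe_sort (Icc (1 : ℤ) i) fun k =>
    currentRes ħ β k • deltaTerm N ħ β lam (i - k) (j + k)
          (pPow ħ β (-(((j : ℂ) - i) / 2 + k))) (pPow ħ β ((k : ℂ) / 2))
          (pPow ħ β (-((k : ℂ) / 2))) n m v -
        currentRes ħ β k • deltaTerm N ħ β lam (i - k) (j + k)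
          (pPow ħ β (((j : ℂ) - i) / 2 + k)) (pPow ħ β (-((k : ℂ) / 2)))
          (pPow ħ β ((k : ℂ) / 2)) n m v

/-- The start `(0, 0)` lies at height at least `H` and the end `(a, b)` at height at most `H`, so
the reflection principle gives no pole. -/
theorem exists_hasRegularValue (hN : 2 ≤ N) (hp : ∀ n : ℕ, 0 < n → pPow ħ β n ≠ 1)
    (hlam : ∑ i, lam i = 0) (O : NormalOrdering N ħ β lam R) {a b : ℕ} (hab : a ≤ b) {H : ℤ}
    (hH : H ≤ 0) (hH' : (a : ℤ) - b ≤ H) (s : ℤ) (v : Fock N) :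
    ∃ w, HasRegularValue (fWWSeries N ħ β lam a b s v)
      (pPow ħ β (-((((b : ℂ) - a) / 2) + H))) w := by
  obtain ⟨d, hv⟩ := exists_mem_deg v
  have hu : (wScale ħ β a)⁻¹ * wScale ħ β b * pPow ħ β (-((((b : ℂ) - a) / 2) + H)) =
      pPow ħ β ((-H : ℤ) : ℂ) := by
    rw [wScale_inv_mul, ← pPow_add]; congr 1; push_cast; ring
  obtain ⟨w, hw, _⟩ := tame_currentSum_end O (pPow_ne_zero _ _ _) hp (wScale_ne_zero a) hu
    (m₀ := 0) (l₀ := 0) (by omega)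
  have h := hw a b hH'
  rw [← one_mul (wScale ħ β a), ← one_mul (wScale ħ β b)] at h
  have := hasRegularValue_fWWSeries O hN hp hlam hab one_ne_zero one_ne_zero _ h s hv (Nat.lt_succ_self d)
  rw [inv_one, one_mul, one_mul] at this
  exact ⟨_, this⟩

end Main
end DWA
end

/-! ### The quadratic relations. -/

theorem mainTheorem1 (N : ℕ) (hN : 2 ≤ N) (ħ β : ℂ)
    (hp : ∀ n : ℕ, 0 < n → DWA.pPow ħ β n ≠ 1)
    (lam : Fin N → ℂ) (hlam : ∑ i, lam i = 0)
    (i j : ℤ) (hi : 0 ≤ i) (hij : i ≤ j) (hj : j ≤ N) :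
    (∀ k ∈ Finset.Icc 1 i, ∀ (s : ℤ) (v : DWA.Fock N),
      (∃ w, DWA.HasRegularValue (DWA.fWWSeries N ħ β lam (i - k) (j + k) s v)
        (DWA.pPow ħ β (-(((j : ℂ) - i) / 2))) w) ∧
      (∃ w, DWA.HasRegularValue (DWA.fWWSeries N ħ β lam (i - k) (j + k) s v)
        (DWA.pPow ħ β (((j : ℂ) - i) / 2)) w)) ∧
    ∀ (n m : ℤ) (v : DWA.Fock N),
      DWA.fWW N ħ β lam i j n m v - DWA.fWW N ħ β lam j i m n v =
        -((1 - DWA.qPar ħ) * (1 - (DWA.tPar ħ β)⁻¹) / (1 - DWA.pPow ħ β 1)) •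
          ∑ k ∈ Finset.Icc 1 i,
            (∏ l ∈ Finset.Icc 1 (k - 1), DWA.γ ħ β (DWA.pPow ħ β ((l : ℂ) + 1 / 2))) •
              (DWA.deltaTerm N ħ β lam (i - k) (j + k)
                  (DWA.pPow ħ β (((j : ℂ) - i) / 2 + k))
                  (DWA.pPow ħ β (-((k : ℂ) / 2))) (DWA.pPow ħ β ((k : ℂ) / 2)) n m v -
                DWA.deltaTerm N ħ β lam (i - k) (j + k)
                  (DWA.pPow ħ β (-(((j : ℂ) - i) / 2 + k)))
                  (DWA.pPow ħ β ((k : ℂ) / 2)) (DWA.pPow ħ β (-((k : ℂ) / 2))) n m v) := by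
  obtain ⟨O⟩ := DWA.exists_normalOrdering N ħ β lam
  obtain ⟨i, rfl⟩ := Int.eq_ofNat_of_zero_le hi
  obtain ⟨j, rfl⟩ := Int.eq_ofNat_of_zero_le (hi.trans hij)
  have hij' : i ≤ j := by omega
  simp only [Int.cast_natCast]
  refine ⟨fun k hk s v => ?_, fun n m v => ?_⟩
  · have hk := Finset.mem_Icc.1 hk
    obtain ⟨a, ha⟩ : ∃ a : ℕ, (a : ℤ) = i - k := ⟨((i : ℤ) - k).toNat, by omega⟩
    obtain ⟨b, hb⟩ : ∃ b : ℕ, (b : ℤ) = j + k := ⟨((j : ℤ) + k).toNat, by omega⟩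
    have ha' : (a : ℂ) = i - k := by exact_mod_cast congrArg (Int.cast : ℤ → ℂ) ha
    have hb' : (b : ℂ) = j + k := by exact_mod_cast congrArg (Int.cast : ℤ → ℂ) hb
    rw [← ha, ← hb]
    -- The paths of `W^{i-k} W^{j+k}` end at height `i - j - 2k`. The points `p^{-(j-i)/2}` and
    -- `p^{(j-i)/2}` correspond to `H = -k` and `H = i - j - k`, both between this height and `0`.
    have h₁ := DWA.exists_hasRegularValue hN hp hlam O (a := a) (b := b) (by omega) (H := -k)
      (by omega) (by omega) s v
    have h₂ := DWA.exists_hasRegularValue hN hp hlam O (a := a) (b := b) (by omega)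
      (H := i - j - k) (by omega) (by omega) s v
    have e₁ : -(((b : ℂ) - a) / 2 + ((-k : ℤ) : ℂ)) = -(((j : ℂ) - i) / 2) := by
      rw [ha', hb']; push_cast; ring
    have e₂ : -(((b : ℂ) - a) / 2 + ((i - j - k : ℤ) : ℂ)) = ((j : ℂ) - i) / 2 := by
      rw [ha', hb']; push_cast; ring
    rw [e₁] at h₁
    rw [e₂] at h₂
    exact ⟨h₁, h₂⟩
  · rw [DWA.fWW_sub_fWW hN hp hlam O hij', Finset.smul_sum]
    refine Finset.sum_congr rfl fun k _ => ?_
    have hk : DWA.currentRes ħ β k = DWA.gRes ħ β * ∏ l ∈ Finset.Icc 1 (k - 1),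
        DWA.γ ħ β (DWA.pPow ħ β ((l : ℂ) + 1 / 2)) := by
      rw [DWA.currentRes, DWA.residueFactor]
      exact congrArg _ (Finset.prod_congr rfl fun l _ => (DWA.γ_eq_gFun ħ β l).symm)
    -- The overall minus sign of the statement exchanges the two delta terms.
    rw [hk, ← smul_sub, mul_smul, neg_smul, ← smul_neg, ← smul_neg, neg_sub]
    rfl
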